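/- Let $L$ be a nondegenerate even lattice of finite rank: a free abelian group of finite rank with a nondegenerate symmetric $\mathbb Z$-valued bilinear form $\langle\cdot,\cdot\rangle$ such that $\langle\alpha,\alpha\rangle\in2\mathbb Z$ for all $\alpha\in L$. Put $\mathfrak h=\mathbb C\otimes_{\mathbb Z}L$ with the $\mathbb C$-bilinear extension of the form, and $\widehat{\mathfrak h}^-=\mathfrak h\otimes t^{-1}\mathbb C[t^{-1}]$, and write $h(-n)=h\otimes t^{-n}$. Let $\varepsilon:L\times L\to\mathbb C^\times$ be a 2-cocycle with $\varepsilon(\alpha,\beta)\varepsilon(\beta,\alpha)^{-1}=(-1)^{\langle\alpha,\beta\rangle}$ and $\varepsilon(\alpha,0)=1=\varepsilon(0,\alpha)$ for $\alpha,\beta\in L$, and let $\mathbb C_\varepsilon[L]$ be the twisted group algebra with basis $e_\alpha$ $(\alpha\in L)$ and product $e_\alpha e_\beta=\varepsilon(\alpha,\beta)e_{\alpha+\beta}$. **The lattice vertex algebra.** Let $V_L=S(\widehat{\mathfrak h}^-)\otimes\mathbb C_\varepsilon[L]$. For $h\in\mathfrak h$ and $n\ge1$, let $h(-n)$ act on $V_L$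 by multiplication on $S(\widehat{\mathfrak h}^-)$, let $h(n)$ act by the derivation of $S(\widehat{\mathfrak h}^-)$ with $h'(-k)\mapsto n\,\delta_{n,k}\langle h,h'\rangle$, and let $h(0)$ act by $h(0)(u\otimes e_\beta)=\langle h,\beta\rangle\,u\otimes e_\beta$. Identify $h\in\mathfrak h$ with $h(-1)\otimes e_0$ and $e_\alpha$ with $1\otimes e_\alpha$. There is exactly one vertex algebra structure on $V_L$ with vacuum $\mathbf 1=1\otimes e_0$ and $$Y(h,z)=\sum_{n\in\mathbb Z}h(n)z^{-n-1},\qquad Y(e_\alpha,z)=\exp\Big(\sum_{n\ge1}\frac{\alpha(-n)}{n}z^{n}\Big)\exp\Big(-\sum_{n\ge1}\frac{\alpha(n)}{n}z^{-n}\Big)e_\alpha z^{\alpha}$$ for $h\in\mathfrak h$, $\alpha\in L$, where $e_\alpha z^\alpha(u\otimes e_\beta)=z^{\langle\alpha,\beta\rangle}\varepsilon(\alpha,\beta)\,u\otimes e_{\alpha+\beta}$. **The vertex bialgebra.** Let $B_L=S(\widehat{\mathfrak h}^-)\otimes\mathbb C[L]$ with the tensor product bialgebra structure, in which the $h(-n)$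 are primitive and the $e^\alpha$ are group-like. Let $\partial$ be the derivation of $B_L$ with $\partial(h(-n))=n\,h(-n-1)$ and $\partial(u\otimes e^\alpha)=\alpha(-1)u\otimes e^\alpha+\partial u\otimes e^\alpha$, and put $Y_{B_L}(a,x)b=(e^{x\partial}a)b$. Then $B_L$ is a commutative and cocommutative vertex bialgebra, that is, a commutative vertex algebra whose (cocommutative) comultiplication $\Delta:B_L\to B_L\otimes B_L$ and counit $\epsilon:B_L\to\mathbb C$ are homomorphisms of vertex algebras. **Theorem.** There is exactly one right $B_L$-comodule vertex algebra structure on $V_L$, that is, a vertex algebra homomorphism $\rho:V_L\to V_L\otimes B_L$ with $(\rho\otimes1)\rho=(1\otimes\Delta)\rho$ and $(1\otimes\epsilon)\rho=\mathrm{Id}$, such that $$\rho(h)=h\otimes1+\mathbf 1\otimes h(-1),\qquad\rho(e_\alpha)=e_\alpha\otimes e^\alpha\qquad(h\in\mathfrak h,\ \alpha\in L).$$ -/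

import Mathlib

open scoped TensorProduct

noncomputable section

/-! ### Vertex algebras -/

/-- The data underlying a vertex algebra over `ℂ`: a linear map `Y(·,x) : V → Hom(V, V((x)))` and a
vector `vac` (the vacuum `𝟏`). -/
@[ext]
structure VertexData (V : Type*) [AddCommGroup V] [Module ℂ V] where
  /-- the vertex operator map `v ↦ Y(v,x)` -/
  Y : V →ₗ[ℂ] VertexOperator ℂ V
  /-- the vacuum vector -/
  vac : V

namespace VertexData

variable {V W H : Type*} [AddCommGroup V] [Module ℂ V] [AddCommGroup W] [Module ℂ W]
  [AddCommGroup H] [Module ℂ H]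

/-- The mode `v_n`, where `Y(v,x) = ∑ₙ v_n x^{-n-1}`. -/
def mode (𝒱 : VertexData V) (v : V) (n : ℤ) : Module.End ℂ V :=
  VertexOperator.ncoeff (𝒱.Y v) n

/-- The axioms of a vertex algebra: vacuum property, creation property, and the Jacobi identity
written in components (the Borcherds identity). All sums are finite because
`Y(u,x)v ∈ V((x))`. -/
structure IsVertexAlgebra (𝒱 : VertexData V) : Prop where
  vacuum : ∀ (v : V) (n : ℤ), 𝒱.mode 𝒱.vac n v = if n = -1 then v else 0
  creation_regular : ∀ (v : V) (n : ℤ), 0 ≤ n → 𝒱.mode v n 𝒱.vac = 0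
  creation : ∀ v : V, 𝒱.mode v (-1) 𝒱.vac = v
  jacobi : ∀ (u v w : V) (l m n : ℤ),
    ∑ᶠ i : ℕ, Ring.choose m i • 𝒱.mode (𝒱.mode u (l + i) v) (m + n - i) w =
      ∑ᶠ i : ℕ, ((-1) ^ i * Ring.choose l i : ℤ) •
        (𝒱.mode u (m + l - i) (𝒱.mode v (n + i) w)
          - Int.negOnePow l • 𝒱.mode v (n + l - i) (𝒱.mode u (m + i) w))

/-- A vertex algebra is commutative if all the modes of all the vertex operators commute. -/
def IsCommutative (𝒱 : VertexData V) : Prop :=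
  ∀ (u v : V) (m n : ℤ), Commute (𝒱.mode u m) (𝒱.mode v n)

/-- Homomorphisms: linear maps with `f(𝟏) = 𝟏` and `f(Y(u,x)v) = Y(f(u),x)f(v)`. -/
structure IsHom (𝒱 : VertexData V) (𝒲 : VertexData W) (f : V →ₗ[ℂ] W) : Prop where
  map_vac : f 𝒱.vac = 𝒲.vac
  map_mode : ∀ (u v : V) (n : ℤ), f (𝒱.mode u n v) = 𝒲.mode (f u) n (f v)

/-! ### Tensor products of vertex algebras -/

/-- The coefficient of `x^n` in a series in `V((x))`. -/
def lcoeff (f : HahnModule ℤ ℂ V) (n : ℤ) : V := ((HahnModule.of ℂ).symm f).coeff n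

lemma lcoeff_add (f g : HahnModule ℤ ℂ V) (n : ℤ) :
    lcoeff (f + g) n = lcoeff f n + lcoeff g n := by
  simp [lcoeff]

lemma lcoeff_smul (c : ℂ) (f : HahnModule ℤ ℂ V) (n : ℤ) :
    lcoeff (c • f) n = c • lcoeff f n := rfl

lemma exists_lcoeff_eq_zero (f : HahnModule ℤ ℂ V) : ∃ N : ℤ, ∀ n < N, lcoeff f n = 0 :=
  ⟨((HahnModule.of ℂ).symm f).order, fun _ hn => HahnSeries.coeff_eq_zero_of_lt_order hn⟩

lemma finite_support_tmul (f : HahnModule ℤ ℂ V) (g : HahnModule ℤ ℂ W) (n : ℤ) :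
    (Function.support fun i : ℤ => lcoeff f i ⊗ₜ[ℂ] lcoeff g (n - i)).Finite := by
  obtain ⟨N, hN⟩ := exists_lcoeff_eq_zero f
  obtain ⟨M, hM⟩ := exists_lcoeff_eq_zero g
  refine (Set.finite_Icc N (n - M)).subset fun i hi => ?_
  by_contra h
  apply hi
  rcases lt_or_ge i N with h1 | h1
  · simp [hN i h1]
  · have h2 : n - i < M := by
      by_contra h3
      exact h ⟨h1, by omega⟩
    simp [hM _ h2]

/-- The product `V((x)) × W((x)) → (V ⊗ W)((x))` with
`(∑ᵢ vᵢ xⁱ, ∑ⱼ wⱼ xʲ) ↦ ∑ₙ (∑_{i+j=n} vᵢ ⊗ wⱼ) xⁿ`. -/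
def laurentTmul : HahnModule ℤ ℂ V →ₗ[ℂ] HahnModule ℤ ℂ W →ₗ[ℂ] HahnModule ℤ ℂ (V ⊗[ℂ] W) :=
  LinearMap.mk₂ ℂ
    (fun f g => HahnModule.of ℂ
      { coeff := fun n => ∑ᶠ i : ℤ, lcoeff f i ⊗ₜ[ℂ] lcoeff g (n - i)
        isPWO_support' := by
          obtain ⟨N, hN⟩ := exists_lcoeff_eq_zero f
          obtain ⟨M, hM⟩ := exists_lcoeff_eq_zero g
          refine (BddBelow.isWF ⟨N + M, fun n hn => ?_⟩).isPWO
          by_contra h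
          apply hn
          refine finsum_eq_zero_of_forall_eq_zero fun i => ?_
          rcases lt_or_ge i N with h1 | h1
          · simp [hN i h1]
          · have h2 : n - i < M := by omega
            simp [hM _ h2] })
    (fun f f' g => by
      ext n
      simp only [lcoeff_add, TensorProduct.add_tmul]
      exact finsum_add_distrib (finite_support_tmul f g n) (finite_support_tmul f' g n))
    (fun c f g => by
      ext n
      simp only [lcoeff_smul, ← TensorProduct.smul_tmul']
      exact (smul_finsum' c (finite_support_tmul f g n)).symm)
    (fun f g g' => by
      ext n
      simp only [lcoeff_add, TensorProduct.tmul_add]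
      exact finsum_add_distrib (finite_support_tmul f g n) (finite_support_tmul f g' n))
    (fun c f g => by
      ext n
      simp only [lcoeff_smul, TensorProduct.tmul_smul]
      exact (smul_finsum' c (finite_support_tmul f g n)).symm)

/-- The tensor product: `Y(u ⊗ a, x)(v ⊗ b) = Y(u,x)v ⊗ Y(a,x)b`, with vacuum `𝟏 ⊗ 𝟏`. -/
def tensor (𝒱 : VertexData V) (𝒲 : VertexData W) : VertexData (V ⊗[ℂ] W) where
  Y := LinearMap.compRight ℂ (TensorProduct.lift laurentTmul) ∘ₗ
    TensorProduct.homTensorHomMap (RingHom.id ℂ) V W (HahnModule ℤ ℂ V) (HahnModule ℤ ℂ W) ∘ₗ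
      TensorProduct.map 𝒱.Y 𝒲.Y
  vac := 𝒱.vac ⊗ₜ[ℂ] 𝒲.vac

/-! ### The Borcherds construction -/

/-- The operator coefficients of `b ↦ (e^{x∂}a)b`. -/
def borcherdsCoeff {A : Type*} [CommRing A] [Algebra ℂ A] (d : Derivation ℂ A A) (a : A) :
    ℤ → Module.End ℂ A
  | Int.ofNat n => LinearMap.mulLeft ℂ ((n.factorial : ℂ)⁻¹ • (d : A →ₗ[ℂ] A)^[n] a)
  | Int.negSucc _ => 0

/-- The commutative vertex algebra attached to a commutative algebra `A` with a derivation `∂`: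
`Y(a,x)b = (e^{x∂}a)b`, with vacuum `1`. -/
def borcherds {A : Type*} [CommRing A] [Algebra ℂ A] (d : Derivation ℂ A A) : VertexData A where
  Y :=
    { toFun := fun a => VertexOperator.of_coeff (borcherdsCoeff d a) fun b => by
        refine ⟨0, fun n hn => ?_⟩
        by_contra h
        apply hn
        obtain ⟨k, rfl⟩ := Int.eq_negSucc_of_lt_zero (not_le.mp h)
        simp [borcherdsCoeff]
      map_add' := fun a a' => by
        ext b n
        cases n with
        | ofNat n =>
          simp [VertexOperator.of_coeff, borcherdsCoeff, iterate_map_add, add_mul]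
        | negSucc n => simp [VertexOperator.of_coeff, borcherdsCoeff]
      map_smul' := fun c a => by
        ext b n
        have h (n : ℕ) : (d : A →ₗ[ℂ] A)^[n] (c • a) = c • (d : A →ₗ[ℂ] A)^[n] a := by
          rw [← Module.End.pow_apply, map_smul, Module.End.pow_apply]
        cases n with
        | ofNat n =>
          change ((n.factorial : ℂ)⁻¹ • (d : A →ₗ[ℂ] A)^[n] (c • a)) * b =
            c • (((n.factorial : ℂ)⁻¹ • (d : A →ₗ[ℂ] A)^[n] a) * b)
          rw [h, smul_comm, smul_mul_assoc]
        | negSucc n =>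
          change (0 : A) = c • (0 : A)
          rw [smul_zero] }
  vac := 1

/-- The one-dimensional vertex algebra `ℂ`. -/
def trivial : VertexData ℂ := borcherds (0 : Derivation ℂ ℂ ℂ)

/-! ### Vertex bialgebras and comodule vertex algebras -/

/-- A vertex bialgebra: a vertex algebra with a coalgebra structure whose comultiplication and
counit are homomorphisms of vertex algebras. -/
structure IsVertexBialgebra [Coalgebra ℂ H] (ℋ : VertexData H) : Prop where
  isVertexAlgebra : ℋ.IsVertexAlgebra
  comul_isHom : IsHom ℋ (ℋ.tensor ℋ) Coalgebra.comul
  counit_isHom : IsHom ℋ trivial Coalgebra.counit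

/-- `ρ : V → V ⊗ H` makes the vertex algebra `V` a right comodule vertex algebra over the vertex
bialgebra `H`. -/
structure IsRightComoduleVertexAlgebra [Coalgebra ℂ H] (𝒱 : VertexData V) (ℋ : VertexData H)
    (ρ : V →ₗ[ℂ] V ⊗[ℂ] H) : Prop where
  isVertexAlgebra : 𝒱.IsVertexAlgebra
  isVertexBialgebra : ℋ.IsVertexBialgebra
  isHom : IsHom 𝒱 (𝒱.tensor ℋ) ρ
  coassoc : (TensorProduct.assoc ℂ V H H).toLinearMap ∘ₗ ρ.rTensor H ∘ₗ ρ =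
    (Coalgebra.comul (R := ℂ) (A := H)).lTensor V ∘ₗ ρ
  counit : (TensorProduct.rid ℂ V).toLinearMap ∘ₗ
    (Coalgebra.counit (R := ℂ) (A := H)).lTensor V ∘ₗ ρ = LinearMap.id

end VertexData

/-! ### Derivations of symmetric algebras -/

/-- The algebra homomorphism `s ↦ s + D(s)ε` into the dual numbers, where `D` is the derivation of
`S(M)` extending `f`. -/
def symDerivAux {M : Type*} [AddCommGroup M] [Module ℂ M] (f : M →ₗ[ℂ] SymmetricAlgebra ℂ M) :
    SymmetricAlgebra ℂ M →ₐ[ℂ] TrivSqZeroExt (SymmetricAlgebra ℂ M) (SymmetricAlgebra ℂ M) :=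
  SymmetricAlgebra.lift
    ((TrivSqZeroExt.inlAlgHom ℂ (SymmetricAlgebra ℂ M) (SymmetricAlgebra ℂ M)).toLinearMap ∘ₗ
        SymmetricAlgebra.ι ℂ M +
      (TrivSqZeroExt.inrHom (SymmetricAlgebra ℂ M) (SymmetricAlgebra ℂ M)).restrictScalars ℂ ∘ₗ f)

lemma symDerivAux_fst {M : Type*} [AddCommGroup M] [Module ℂ M]
    (f : M →ₗ[ℂ] SymmetricAlgebra ℂ M) (s : SymmetricAlgebra ℂ M) :
    (symDerivAux f s).fst = s := by
  have h : (TrivSqZeroExt.fstHom ℂ (SymmetricAlgebra ℂ M) (SymmetricAlgebra ℂ M)).comp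
      (symDerivAux f) = AlgHom.id ℂ _ := by
    ext m
    simp [symDerivAux]
  exact congr($h s)

/-- The derivation of the symmetric algebra `S(M)` extending a linear map `f : M → S(M)`. -/
def symDeriv {M : Type*} [AddCommGroup M] [Module ℂ M] (f : M →ₗ[ℂ] SymmetricAlgebra ℂ M) :
    Derivation ℂ (SymmetricAlgebra ℂ M) (SymmetricAlgebra ℂ M) :=
  Derivation.mk'
    ((TrivSqZeroExt.sndHom (SymmetricAlgebra ℂ M) (SymmetricAlgebra ℂ M)).restrictScalars ℂ ∘ₗ
      (symDerivAux f).toLinearMap)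
    (fun a b => by simp [symDerivAux_fst, mul_comm])

lemma symDeriv_ι {M : Type*} [AddCommGroup M] [Module ℂ M] (f : M →ₗ[ℂ] SymmetricAlgebra ℂ M)
    (m : M) : symDeriv f (SymmetricAlgebra.ι ℂ M m) = f m := by
  simp [symDeriv, symDerivAux]

/-! ### The spaces attached to a lattice -/

namespace LatticeVA

variable (L : Type*) [AddCommGroup L]

/-- `𝔥 = ℂ ⊗_ℤ L`. -/
abbrev Cartan : Type _ := ℂ ⊗[ℤ] L

/-- `𝔥̂⁻ = 𝔥 ⊗ t⁻¹ℂ[t⁻¹]`; the function `Finsupp.single n h` stands for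
`h(-n-1) = h ⊗ t^{-n-1}`, where `n = 0, 1, 2, …`. -/
abbrev HeisMinus : Type _ := ℕ →₀ Cartan L

/-- `S(𝔥̂⁻)`. -/
abbrev Fock : Type _ := SymmetricAlgebra ℂ (HeisMinus L)

/-- The underlying space of `V_L = S(𝔥̂⁻) ⊗ ℂ_ε[L]`, where `Finsupp.single α 1` is the basis element
`e_α` of the twisted group algebra. -/
abbrev VSpace : Type _ := Fock L ⊗[ℂ] (L →₀ ℂ)

/-- The bialgebra `B_L = S(𝔥̂⁻) ⊗ ℂ[L]`. -/
abbrev BSpace : Type _ := Fock L ⊗[ℂ] AddMonoidAlgebra ℂ L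

variable {L}

/-- The element `h(-n-1)` of `S(𝔥̂⁻)`. -/
def neg (h : Cartan L) (n : ℕ) : Fock L := SymmetricAlgebra.ι ℂ (HeisMinus L) (Finsupp.single n h)

/-- The image of `α ∈ L` in `𝔥`. -/
def toCartan (α : L) : Cartan L := (1 : ℂ) ⊗ₜ[ℤ] α

/-! #### The lattice vertex algebra -/

/-- The element `e_α` of `V_L`. -/
def eV (α : L) : VSpace L := (1 : Fock L) ⊗ₜ[ℂ] Finsupp.single α (1 : ℂ)

/-- The element `h = h(-1) ⊗ 1` of `V_L`. -/
def hV (h : Cartan L) : VSpace L := neg h 0 ⊗ₜ[ℂ] Finsupp.single (0 : L) (1 : ℂ)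

variable (B : LinearMap.BilinForm ℤ L)

/-- The action of `h(n+1)` on `S(𝔥̂⁻)`: the derivation with
`h'(-k-1) ↦ (n+1) δ_{n,k} ⟨h,h'⟩`. -/
def annih (h : Cartan L) (n : ℕ) : Derivation ℂ (Fock L) (Fock L) :=
  symDeriv ((Algebra.linearMap ℂ (Fock L)) ∘ₗ
    (((n : ℂ) + 1) • (B.baseChange ℂ h ∘ₗ Finsupp.lapply n)))

/-- The action of `h(0)` on `ℂ_ε[L]`: `e_β ↦ ⟨h,β⟩ e_β`. -/
def zeroMode (h : Cartan L) : Module.End ℂ (L →₀ ℂ) :=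
  Finsupp.lsum ℂ fun β => B.baseChange ℂ h (toCartan β) • Finsupp.lsingle β

/-- The action of `h(n)`, `n ∈ ℤ`, on `V_L = S(𝔥̂⁻) ⊗ ℂ_ε[L]`. -/
def heis (h : Cartan L) : ℤ → Module.End ℂ (VSpace L)
  | Int.ofNat 0 => (zeroMode B h).lTensor (Fock L)
  | Int.ofNat (n + 1) => ((annih B h n : Derivation ℂ (Fock L) (Fock L)) :
      Fock L →ₗ[ℂ] Fock L).rTensor (L →₀ ℂ)
  | Int.negSucc n => (LinearMap.mulLeft ℂ (neg h n)).rTensor (L →₀ ℂ)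

/-- The exponential of a power series with zero constant term; the coefficient of `zⁿ` in
`X(z)ᵏ` vanishes for `k > n`. -/
def expSeries {A : Type*} [Ring A] [Algebra ℂ A] (X : PowerSeries A) : PowerSeries A :=
  PowerSeries.mk fun n =>
    ∑ k ∈ Finset.range (n + 1), (k.factorial : ℂ)⁻¹ • PowerSeries.coeff n (X ^ k)

/-- `E⁻(-α,z) = exp(∑_{n ≥ 1} (α(-n)/n) zⁿ)`, as a power series in `z`. -/
def Eminus (α : L) : PowerSeries (Module.End ℂ (VSpace L)) :=
  expSeries (PowerSeries.mk fun n : ℕ =>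
    if n = 0 then 0 else (n : ℂ)⁻¹ • heis B (toCartan α) (-(n : ℤ)))

/-- `E⁺(-α,z) = exp(∑_{n ≥ 1} (-α(n)/n) z⁻ⁿ)`, as a power series in `z⁻¹`. -/
def Eplus (α : L) : PowerSeries (Module.End ℂ (VSpace L)) :=
  expSeries (PowerSeries.mk fun n : ℕ =>
    if n = 0 then 0 else -((n : ℂ)⁻¹ • heis B (toCartan α) (n : ℤ)))

/-- The characterization of the lattice vertex algebra structure on `V_L`: it is a vertex algebra
with vacuum `1 ⊗ e_0`, `Y(h,z) = ∑ₙ h(n) z^{-n-1}`, and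
`Y(e_α,z) = E⁻(-α,z) E⁺(-α,z) e_α z^α`. The last equation is tested on the vectors `u ⊗ e_β`, on
which `e_α z^α` takes the value `ε(α,β) z^{⟨α,β⟩} u ⊗ e_{α+β}`. -/
structure IsLatticeVertexAlgebra (ε : L → L → ℂˣ) (𝒱 : VertexData (VSpace L)) : Prop where
  isVertexAlgebra : 𝒱.IsVertexAlgebra
  vac_eq : 𝒱.vac = eV 0
  Y_h : ∀ (h : Cartan L) (n : ℤ), 𝒱.mode (hV h) n = heis B h n
  Y_e : ∀ (α β : L) (u : Fock L) (m : ℤ),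
    HVertexOperator.coeff (𝒱.Y (eV α)) m (u ⊗ₜ[ℂ] Finsupp.single β 1) =
      ∑ᶠ p : ℕ × ℕ, if B α β + (p.1 : ℤ) - (p.2 : ℤ) = m then
        PowerSeries.coeff p.1 (Eminus B α) (PowerSeries.coeff p.2 (Eplus B α)
          ((ε α β : ℂ) • (u ⊗ₜ[ℂ] Finsupp.single (α + β) (1 : ℂ)))) else 0

/-! #### The vertex bialgebra `B_L` -/

/-- The element `e^α` of `B_L`. -/
def eB (α : L) : BSpace L := (1 : Fock L) ⊗ₜ[ℂ] AddMonoidAlgebra.single α (1 : ℂ)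

/-- The element `h(-1)` of `B_L`. -/
def hB (h : Cartan L) : BSpace L := neg h 0 ⊗ₜ[ℂ] (1 : AddMonoidAlgebra ℂ L)

/-- The derivation of `S(𝔥̂⁻)` with `h(-n) ↦ n h(-n-1)` for `n ≥ 1`. -/
def fockDeriv : Derivation ℂ (Fock L) (Fock L) :=
  symDeriv (SymmetricAlgebra.ι ℂ (HeisMinus L) ∘ₗ
    Finsupp.lsum ℂ fun n : ℕ => ((n : ℂ) + 1) • Finsupp.lsingle (n + 1))

/-- The linear map `ℂ[L] → B_L`, `e^α ↦ α(-1) ⊗ e^α`. -/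
def gradMap : AddMonoidAlgebra ℂ L →ₗ[ℂ] BSpace L :=
  (Finsupp.lsum ℂ fun α : L => LinearMap.toSpanSingleton ℂ (BSpace L)
    (neg (toCartan α) 0 ⊗ₜ[ℂ] AddMonoidAlgebra.single α (1 : ℂ))) ∘ₗ
      (AddMonoidAlgebra.coeffLinearEquiv ℂ).toLinearMap

/-- The linear map underlying the derivation `∂` of `B_L`:
`u ⊗ e^α ↦ α(-1)u ⊗ e^α + ∂u ⊗ e^α`. -/
def bDerivLin : BSpace L →ₗ[ℂ] BSpace L :=
  LinearMap.mul' ℂ (BSpace L) ∘ₗ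
      TensorProduct.map (Algebra.TensorProduct.includeLeft (R := ℂ) (S := ℂ) (A := Fock L)
        (B := AddMonoidAlgebra ℂ L)).toLinearMap gradMap +
    ((fockDeriv : Derivation ℂ (Fock L) (Fock L)) : Fock L →ₗ[ℂ] Fock L).rTensor (AddMonoidAlgebra ℂ L)

lemma bDerivLin_single (u : Fock L) (α : L) (c : ℂ) :
    bDerivLin (u ⊗ₜ[ℂ] AddMonoidAlgebra.single α c) =
      (neg (toCartan α) 0 * u + fockDeriv u) ⊗ₜ[ℂ] AddMonoidAlgebra.single α c := by
  simp [bDerivLin, gradMap, TensorProduct.add_tmul, mul_comm u, ← TensorProduct.tmul_smul]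

lemma neg_toCartan_add (α β : L) (n : ℕ) :
    neg (toCartan (α + β)) n = neg (toCartan α) n + neg (toCartan β) n := by
  simp [neg, toCartan, TensorProduct.tmul_add]

/-- The derivation `∂` of `B_L` with `h(-n) ↦ n h(-n-1)` for `n ≥ 1` and
`u ⊗ e^α ↦ α(-1)u ⊗ e^α + ∂u ⊗ e^α`. -/
def bDeriv : Derivation ℂ (BSpace L) (BSpace L) :=
  Derivation.mk' bDerivLin fun a b => by
    induction a using TensorProduct.induction_on with
    | zero => simp
    | add x y hx hy => simp only [add_mul, map_add, hx, hy, smul_eq_mul, mul_add]; ring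
    | tmul u f =>
    induction b using TensorProduct.induction_on with
    | zero => simp
    | add x y hx hy => simp only [add_mul, map_add, hx, hy, smul_eq_mul, mul_add]; ring
    | tmul v g =>
    induction f using AddMonoidAlgebra.induction_linear with
    | zero => simp
    | add x y hx hy =>
      simp only [add_mul, map_add, hx, hy, smul_eq_mul, mul_add, TensorProduct.tmul_add]; ring
    | single α c =>
    induction g using AddMonoidAlgebra.induction_linear with
    | zero => simp
    | add x y hx hy =>
      simp only [add_mul, map_add, hx, hy, smul_eq_mul, mul_add, TensorProduct.tmul_add]; ring
    | single β d =>
      simp only [Algebra.TensorProduct.tmul_mul_tmul, AddMonoidAlgebra.single_mul_single,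
        bDerivLin_single, smul_eq_mul, neg_toCartan_add, Derivation.leibniz]
      rw [add_comm β α, mul_comm d c, ← TensorProduct.add_tmul]
      congr 1
      ring

variable (L) in
/-- The vertex bialgebra `B_L`: `Y(a,x)b = (e^{x∂}a)b`, together with the coalgebra structure of the
bialgebra `S(𝔥̂⁻) ⊗ ℂ[L]`. -/
def vertexB : VertexData (BSpace L) := VertexData.borcherds bDeriv

end LatticeVA
end

noncomputable section

namespace VertexOperator

/-! ### Binomial expansions of two-variable distributions -/

/-! Vertex algebras are built here from generating fields. By `exists_isVertexAlgebra`, mutually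
local, translation covariant, creative fields that generate `V` from the vacuum extend to a vertex
algebra. Their iterated `n`-th products stay local (Dong's lemma), such a field is determined by its
value at the vacuum (Goddard's argument), and the Jacobi identity follows from locality and
associativity because both of its sides obey the same recurrence. This theorem is applied to tensor
products, to the Borcherds construction and to `V_L`.

For `V_L` the main tool is `heis_eMode`: `[h(m), (e_α)_n] = ⟨h,α⟩ (e_α)_{n+m}`. It reduces
statements about all vectors to the vectors `e_γ`, since the `h(-n)` generate `V_L` from these. On
`e_γ`, `Y(e_α,x)Y(e_β,y)` is `(x - y)^{⟨α,β⟩}` times an expression that is symmetric up to the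
cocycle. The sign from exchanging `x` and `y` is exactly the one in the commutator condition on `ε`,
and locality follows. The structure is unique because associativity determines the modes of `h(-n)v`
from those of `h` and `v`.

For `B_L`, comultiplication and counit are algebra maps compatible with `∂`, hence compatible with
`e^{x∂}`.

The coaction is the comultiplication of `B_L` read through the linear isomorphism `B_L ≅ V_L`, so
the comodule axioms are those of the coalgebra `B_L`. Only the homomorphism property involves the
vertex operators. It passes from two vectors to all their `l`-th products, so it need only be
checked for the modes of `h` and `e_α`. For `h` it is a direct comparison. For `e_α`, commutators
with the `h(m)` reduce it to the vectors `e_γ`. There the leading mode is explicit, and translation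
covariance determines each lower mode from the one above it (`coaction_eMode_eV`). The coaction is
unique because the `h(-n)` generate `V_L` from the `e_α`. -/

/-- The coefficient of `x^{l-i} y^i` in `(x - y)^l`. -/
def signedChoose (l : ℤ) (i : ℕ) : ℤ := (-1) ^ i * Ring.choose l i

@[simp] lemma signedChoose_zero_right (l : ℤ) : signedChoose l 0 = 1 := by simp [signedChoose]

lemma signedChoose_zero_succ (i : ℕ) : signedChoose 0 (i + 1) = 0 := by
  simp [signedChoose, Ring.choose_zero_succ]

lemma signedChoose_one_right (l : ℤ) : signedChoose l 1 = -l := by simp [signedChoose]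

lemma signedChoose_succ_succ (l : ℤ) (i : ℕ) :
    signedChoose (l + 1) (i + 1) = signedChoose l (i + 1) - signedChoose l i := by
  simp only [signedChoose, Ring.choose_succ_succ, pow_succ]
  ring

/-- The differential equation of `(x - y)^l` in `y`, coefficient by coefficient. It produces the
telescoping in `expand_deriv` and the closed form `sum_signedChoose`. -/
lemma succ_mul_signedChoose_succ (l : ℤ) (i : ℕ) :
    (i + 1 : ℤ) * signedChoose l (i + 1) = -(l - i) * signedChoose l i := by
  have h := Ring.choose_smul_choose l (Nat.le_succ i)
  simp only [Nat.succ_eq_add_one, Nat.choose_succ_self_right, nsmul_eq_mul, Nat.cast_add,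
    Nat.cast_one, Nat.add_sub_cancel_left, Ring.choose_one_right] at h
  simp only [signedChoose, pow_succ]
  linear_combination (-(-1) ^ i) * h

/-- The geometric series: with these coefficients the `(-1)`-st product is the normally ordered
product. -/
lemma signedChoose_neg_one (i : ℕ) : signedChoose (-1) i = 1 := by
  induction i with
  | zero => simp
  | succ i ih =>
    have h := succ_mul_signedChoose_succ (-1) i
    rw [ih] at h
    have h' : (i + 1 : ℤ) * (signedChoose (-1) (i + 1) - 1) = 0 := by linear_combination h
    rcases mul_eq_zero.mp h' with h' | h'
    · omega
    · linarith

section Expand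

variable {V W : Type*} [AddCommGroup V] [AddCommGroup W]

/-- The coefficients `f m n` of `x^{-m-1} y^{-n-1}` vanish for large `n`, uniformly in `m`. -/
def IsTruncated (f : ℤ → ℤ → V) : Prop := ∃ N : ℤ, ∀ m n, N ≤ n → f m n = 0

/-- The coefficients of `(x - y)^l f(x, y)`, where `(x - y)^l` is expanded in nonnegative powers
of `y`. -/
def expand (l : ℤ) (f : ℤ → ℤ → V) (m n : ℤ) : V :=
  ∑ᶠ i : ℕ, signedChoose l i • f (m + l - i) (n + i)

/-- Any sufficiently large `K` may be used, so that several expansions can be compared over matching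
ranges. -/
lemma expand_eq_sum_range {f : ℤ → ℤ → V} {n : ℤ} {K : ℕ}
    (hf : ∀ m k, n + K ≤ k → f m k = 0) (l m : ℤ) :
    expand l f m n = ∑ i ∈ Finset.range K, signedChoose l i • f (m + l - i) (n + i) := by
  refine finsum_eq_sum_of_support_subset _ fun i hi => ?_
  by_contra h
  simp only [Finset.coe_range, Set.mem_Iio, not_lt] at h
  exact hi (by simp only [hf _ _ (show n + (K : ℤ) ≤ n + i by omega), smul_zero])

lemma IsTruncated.exists_bound {f : ℤ → ℤ → V} (hf : IsTruncated f) (n : ℤ) :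
    ∃ K : ℕ, ∀ m k, n + K ≤ k → f m k = 0 := by
  obtain ⟨N, hN⟩ := hf
  exact ⟨(N - n).toNat, fun m k hk => hN m k (by omega)⟩

lemma IsTruncated.add {f g : ℤ → ℤ → V} (hf : IsTruncated f) (hg : IsTruncated g) :
    IsTruncated fun m n => f m n + g m n := by
  obtain ⟨N, hN⟩ := hf
  obtain ⟨M, hM⟩ := hg
  exact ⟨max N M, fun m n h => by
    simp only [hN m n (le_trans (le_max_left _ _) h), hM m n (le_trans (le_max_right _ _) h),
      add_zero]⟩

lemma IsTruncated.map {F : Type*} [FunLike F V W] [AddMonoidHomClass F V W] {f : ℤ → ℤ → V}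
    (hf : IsTruncated f) (φ : F) : IsTruncated fun m n => φ (f m n) := by
  obtain ⟨N, hN⟩ := hf
  exact ⟨N, fun m n h => by simp only [hN m n h, map_zero]⟩

lemma IsTruncated.shift {f : ℤ → ℤ → V} (hf : IsTruncated f) (a b : ℤ) :
    IsTruncated fun m n => f (m + a) (n + b) := by
  obtain ⟨N, hN⟩ := hf
  exact ⟨N - b, fun m n h => hN _ _ (by omega)⟩

lemma IsTruncated.finite_support {f : ℤ → ℤ → V} (hf : IsTruncated f) (l m n : ℤ) :
    (Function.support fun i : ℕ => signedChoose l i • f (m + l - i) (n + i)).Finite := by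
  obtain ⟨K, hK⟩ := hf.exists_bound n
  refine (Finset.range K).finite_toSet.subset fun i hi => ?_
  by_contra h
  simp only [Finset.coe_range, Set.mem_Iio, not_lt] at h
  exact hi (by simp only [hK _ _ (show n + (K : ℤ) ≤ n + i by omega), smul_zero])

lemma expand_add {f g : ℤ → ℤ → V} (hf : IsTruncated f) (hg : IsTruncated g) (l m n : ℤ) :
    expand l (fun m n => f m n + g m n) m n = expand l f m n + expand l g m n := by
  simp only [expand, smul_add]
  exact finsum_add_distrib (hf.finite_support l m n) (hg.finite_support l m n)

lemma map_expand {F : Type*} [FunLike F V W] [AddMonoidHomClass F V W] {f : ℤ → ℤ → V}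
    (hf : IsTruncated f) (φ : F) (l m n : ℤ) :
    φ (expand l f m n) = expand l (fun m n => φ (f m n)) m n := by
  have h := AddMonoidHom.map_finsum (AddMonoidHomClass.toAddMonoidHom φ)
    (hf.finite_support l m n)
  simpa [expand] using h

lemma expand_neg {f : ℤ → ℤ → V} (hf : IsTruncated f) (l m n : ℤ) :
    expand l (fun m n => -f m n) m n = -expand l f m n :=
  (map_expand hf (-AddMonoidHom.id V) l m n).symm

lemma expand_sub {f g : ℤ → ℤ → V} (hf : IsTruncated f) (hg : IsTruncated g) (l m n : ℤ) :
    expand l (fun m n => f m n - g m n) m n = expand l f m n - expand l g m n := by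
  simp only [sub_eq_add_neg]
  rw [← expand_neg hg]
  exact expand_add hf (hg.map (-AddMonoidHom.id V)) l m n

lemma expand_zero (l m n : ℤ) : expand l (fun _ _ => (0 : V)) m n = 0 := by simp [expand]

lemma expand_zero_left (f : ℤ → ℤ → V) (m n : ℤ) : expand 0 f m n = f m n := by
  rw [expand, finsum_eq_single _ 0]
  · simp
  · intro i hi
    obtain ⟨j, rfl⟩ := Nat.exists_eq_succ_of_ne_zero hi
    rw [Nat.succ_eq_add_one, signedChoose_zero_succ, zero_smul]

/-- Multiplication by `x - y`. -/
lemma expand_succ {f : ℤ → ℤ → V} (hf : IsTruncated f) (l m n : ℤ) :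
    expand (l + 1) f m n = expand l f (m + 1) n - expand l f m (n + 1) := by
  obtain ⟨K, hK⟩ := hf.exists_bound n
  -- The expansion at `n + 1` starts one step higher, so it needs only `K` terms. These are matched
  -- with the terms `i + 1` of the other two sums, whose `i = 0` terms are split off.
  rw [expand_eq_sum_range (K := K + 1) (fun m k hk => hK m k (by push_cast at hk; omega)),
    expand_eq_sum_range (K := K + 1) (fun m k hk => hK m k (by push_cast at hk; omega)),
    expand_eq_sum_range (K := K) (fun m k hk => hK m k (by omega)),
    Finset.sum_range_succ', Finset.sum_range_succ' _ K, add_sub_right_comm (Finset.sum _ _),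
    ← Finset.sum_sub_distrib]
  congr 1
  · refine Finset.sum_congr rfl fun i _ => ?_
    rw [signedChoose_succ_succ, sub_smul]
    congr 3 <;> push_cast <;> ring_nf
  · simp only [signedChoose_zero_right]
    congr 2
    ring

/-- The operator `∂_x + ∂_y` commutes with the multiplication by `(x - y)^l`. -/
lemma expand_deriv {f : ℤ → ℤ → V} (hf : IsTruncated f) (l m n : ℤ) :
    expand l (fun m n => m • f (m - 1) n + n • f m (n - 1)) m n =
      m • expand l f (m - 1) n + n • expand l f m (n - 1) := by
  obtain ⟨K, hK⟩ := hf.exists_bound (n - 1)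
  rw [expand_eq_sum_range (K := K + 1) (fun m k hk => by
      rw [hK _ _ (by push_cast at hk; omega), hK _ _ (by push_cast at hk; omega)]; simp),
    expand_eq_sum_range (K := K + 1) (fun m k hk => hK m k (by push_cast at hk; omega)),
    expand_eq_sum_range (K := K + 1) (fun m k hk => hK m k (by push_cast at hk; omega))]
  -- The error in each summand is `g i - g (i + 1)` with `g i = i c_i f(m + l - i, n - 1 + i)`. It
  -- telescopes: `g` vanishes at `0`, and at `K + 1` by truncation.
  have key : ∀ i : ℕ, signedChoose l i •
        ((m + l - i) • f (m + l - i - 1) (n + i) + (n + i) • f (m + l - i) (n + i - 1)) =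
      m • (signedChoose l i • f (m - 1 + l - i) (n + i)) +
        n • (signedChoose l i • f (m + l - i) (n - 1 + i)) +
        (((i : ℤ) * signedChoose l i) • f (m + l - i) (n - 1 + i) -
          (((i + 1 : ℕ) : ℤ) * signedChoose l (i + 1)) •
            f (m + l - (i + 1 : ℕ)) (n - 1 + (i + 1 : ℕ))) := by
    intro i
    push_cast
    rw [succ_mul_signedChoose_succ, show m + l - (i : ℤ) - 1 = m - 1 + l - i by ring,
      show n + (i : ℤ) - 1 = n - 1 + i by ring, show m + l - ((i : ℤ) + 1) = m - 1 + l - i by ring,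
      show n - 1 + ((i : ℤ) + 1) = n + i by ring]
    module
  simp only [key]
  rw [Finset.sum_add_distrib, Finset.sum_add_distrib, Finset.sum_range_sub'
    (fun i : ℕ => ((i : ℤ) * signedChoose l i) • f (m + l - i) (n - 1 + i)), Finset.smul_sum,
    Finset.smul_sum, hK _ _ (show n - 1 + (K : ℤ) ≤ n - 1 + ((K + 1 : ℕ) : ℤ) by push_cast; omega)]
  simp

/-! ### Distributions in three variables -/

variable (V) in
/-- Multiplication by `x - y` on distributions in three variables. -/
def diffXY : Module.End ℤ (ℤ → ℤ → ℤ → V) where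
  toFun F m n k := F (m + 1) n k - F m (n + 1) k
  map_add' F G := by funext m n k; simp only [Pi.add_apply]; abel
  map_smul' c F := by funext m n k; simp [smul_sub]

variable (V) in
/-- Multiplication by `x - z` on distributions in three variables. -/
def diffXZ : Module.End ℤ (ℤ → ℤ → ℤ → V) where
  toFun F m n k := F (m + 1) n k - F m n (k + 1)
  map_add' F G := by funext m n k; simp only [Pi.add_apply]; abel
  map_smul' c F := by funext m n k; simp [smul_sub]

variable (V) in
/-- Multiplication by `y - z` on distributions in three variables. -/
def diffYZ : Module.End ℤ (ℤ → ℤ → ℤ → V) where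
  toFun F m n k := F m (n + 1) k - F m n (k + 1)
  map_add' F G := by funext m n k; simp only [Pi.add_apply]; abel
  map_smul' c F := by funext m n k; simp [smul_sub]

lemma diffYZ_eq : (diffYZ V) = diffXZ V + -diffXY V := by
  ext F m n k
  simp [diffXY, diffYZ, diffXZ]

lemma commute_diffXZ_diffXY :
    Commute (diffXZ V) (diffXY V) := by
  ext F m n k
  simp only [diffXY, diffXZ, Module.End.mul_apply, LinearMap.coe_mk, AddHom.coe_mk]
  abel

lemma commute_diffXZ_diffYZ :
    Commute (diffXZ V) (diffYZ V) := by
  ext F m n k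
  simp only [diffYZ, diffXZ, Module.End.mul_apply, LinearMap.coe_mk, AddHom.coe_mk]
  abel

/-- If `(x - y)^K F = 0` and `(x - z)^N (y - z)^N F = 0`, then a power of `y - z` kills `F`. -/
lemma diffYZ_pow_eq_zero {F : ℤ → ℤ → ℤ → V} {K N : ℕ} (h1 : (diffXY V ^ K) F = 0)
    (h2 : (diffXZ V ^ N) ((diffYZ V ^ N) F) = 0) : (diffYZ V ^ (K + N + N)) F = 0 := by
  have hc : Commute (diffXZ V) (-diffXY V) :=
    commute_diffXZ_diffXY.neg_right
  have hc' : Commute (diffYZ V) (-diffXY V) := by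
    rw [diffYZ_eq]
    exact hc.add_left (Commute.refl _)
  rw [pow_add, Module.End.mul_apply, diffYZ_eq, hc.add_pow, ← diffYZ_eq, LinearMap.sum_apply]
  refine Finset.sum_eq_zero fun i _ => ?_
  rw [← nsmul_eq_mul', LinearMap.smul_apply]
  -- Here `(y - z)^{K+N}` has been expanded as `((x - z) - (x - y))^{K+N}`. A term with at least `N`
  -- factors `x - z` is killed by `h2`. Any other term has at least `K` factors `x - y` and is
  -- killed by `h1`.
  rcases le_or_gt N i with hi | hi
  · obtain ⟨j, rfl⟩ := Nat.exists_eq_add_of_le hi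
    rw [(hc.pow_pow _ _).eq, add_comm N j, pow_add, Module.End.mul_apply, Module.End.mul_apply, h2]
    simp
  · obtain ⟨j, hj⟩ := Nat.exists_eq_add_of_le (show K ≤ K + N - i by omega)
    have h3 : ((-diffXY V : Module.End ℤ (ℤ → ℤ → ℤ → V)) ^ K) F = 0 := by
      rw [neg_pow, Module.End.mul_apply, h1, map_zero]
    rw [hj, add_comm K j, pow_add, Module.End.mul_apply, Module.End.mul_apply,
      ← Module.End.mul_apply _ (diffYZ V ^ N) F, (hc'.pow_pow N K).symm.eq,
      Module.End.mul_apply, h3]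
    simp

/-- Meant for families in which `F l` carries the factor `(x - y)^l` and `D` multiplies by that same
difference. -/
lemma pow_apply_of_succ {X : Type*} [AddCommGroup X] (D : Module.End ℤ X) (F : ℤ → X)
    (h : ∀ l, D (F l) = F (l + 1)) (l : ℤ) (K : ℕ) : (D ^ K) (F l) = F (l + K) := by
  induction K with
  | zero => simp
  | succ K ih => rw [pow_succ', Module.End.mul_apply, ih, h]; push_cast; ring_nf

/-- Applying an expansion in the first two of three variables. -/
def expand₃ (l : ℤ) (F : ℤ → ℤ → ℤ → V) (m n k : ℤ) : V := expand l (fun m n => F m n k) m n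

/-- Multiplication by `x - z` is a finite combination of shifts, so it passes through the expansion
of `(x - y)^l`. Truncation is part of the conclusion so that the statement can be iterated. -/
lemma diffXZ_expand₃ {F : ℤ → ℤ → ℤ → V} (hF : ∀ k, IsTruncated fun m n => F m n k) (l : ℤ) :
    (∀ k, IsTruncated fun m n => diffXZ V F m n k) ∧
      diffXZ V (expand₃ l F) = expand₃ l (diffXZ V F) := by
  have h1 (k) : IsTruncated fun m n => F (m + 1) n k := by simpa using (hF k).shift 1 0
  refine ⟨fun k => ?_, ?_⟩
  · simpa [diffXZ, sub_eq_add_neg] using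
      (h1 k).add ((hF (k + 1)).map (-AddMonoidHom.id V))
  · funext m n k
    refine Eq.trans ?_ (expand_sub (h1 k) (hF (k + 1)) l m n).symm
    simp only [diffXZ, expand₃, LinearMap.coe_mk, AddHom.coe_mk, expand]
    congr 1
    refine finsum_congr fun i => ?_
    ring_nf

lemma diffYZ_expand₃ {F : ℤ → ℤ → ℤ → V} (hF : ∀ k, IsTruncated fun m n => F m n k) (l : ℤ) :
    (∀ k, IsTruncated fun m n => diffYZ V F m n k) ∧
      diffYZ V (expand₃ l F) = expand₃ l (diffYZ V F) := by
  have h1 (k) : IsTruncated fun m n => F m (n + 1) k := by simpa using (hF k).shift 0 1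
  refine ⟨fun k => ?_, ?_⟩
  · simpa [diffYZ, sub_eq_add_neg] using
      (h1 k).add ((hF (k + 1)).map (-AddMonoidHom.id V))
  · funext m n k
    refine Eq.trans ?_ (expand_sub (h1 k) (hF (k + 1)) l m n).symm
    simp only [diffYZ, expand₃, LinearMap.coe_mk, AddHom.coe_mk, expand]
    congr 1
    refine finsum_congr fun i => ?_
    ring_nf

lemma diffXZ_pow_diffYZ_pow_expand₃ {F : ℤ → ℤ → ℤ → V}
    (hF : ∀ k, IsTruncated fun m n => F m n k) (l : ℤ) (M N : ℕ) :
    (∀ k, IsTruncated fun m n => (diffXZ V ^ M) ((diffYZ V ^ N) F) m n k) ∧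
      (diffXZ V ^ M) ((diffYZ V ^ N) (expand₃ l F)) =
        expand₃ l ((diffXZ V ^ M) ((diffYZ V ^ N) F)) := by
  induction M with
  | zero =>
    induction N with
    | zero => simpa using hF
    | succ N ih =>
      simp only [pow_zero, Module.End.one_apply] at ih ⊢
      rw [pow_succ', Module.End.mul_apply, Module.End.mul_apply, ih.2]
      exact diffYZ_expand₃ ih.1 l
  | succ M ih =>
    rw [pow_succ', Module.End.mul_apply, Module.End.mul_apply, ih.2]
    exact diffXZ_expand₃ ih.1 l

variable (V) in
/-- Exchanging the first two of three variables. -/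
def swapXY : (ℤ → ℤ → ℤ → V) →ₗ[ℤ] (ℤ → ℤ → ℤ → V) where
  toFun F m n k := F n m k
  map_add' _ _ := rfl
  map_smul' _ _ := rfl

lemma diffXZ_pow_swapXY (F : ℤ → ℤ → ℤ → V) (N : ℕ) :
    (diffXZ V ^ N) (swapXY V F) = swapXY V ((diffYZ V ^ N) F) := by
  induction N with
  | zero => rfl
  | succ N ih => rw [pow_succ', pow_succ', Module.End.mul_apply, Module.End.mul_apply, ih]; rfl

lemma diffYZ_pow_swapXY (F : ℤ → ℤ → ℤ → V) (N : ℕ) :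
    (diffYZ V ^ N) (swapXY V F) = swapXY V ((diffXZ V ^ N) F) := by
  induction N with
  | zero => rfl
  | succ N ih => rw [pow_succ', pow_succ', Module.End.mul_apply, Module.End.mul_apply, ih]; rfl

end Expand

/-! ### Products of vertex operators -/

variable {V : Type*} [AddCommGroup V] [Module ℂ V]

lemma exists_ncoeff_eq_zero (A : VertexOperator ℂ V) (v : V) :
    ∃ N : ℤ, ∀ n, N ≤ n → ncoeff A n v = 0 := by
  obtain ⟨N, hN⟩ := VertexData.exists_lcoeff_eq_zero (A v)
  exact ⟨-N, fun n hn => hN (-n - 1) (by omega)⟩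

lemma ncoeff_injective : Function.Injective (ncoeff : VertexOperator ℂ V → ℤ → Module.End ℂ V) := by
  intro A B h
  apply HVertexOperator.coeff_inj
  funext n
  simpa using congrFun h (-n - 1)

/-- The vertex operator with given modes. -/
def ofModes (f : ℤ → Module.End ℂ V) (hf : ∀ v, ∃ N : ℤ, ∀ n, N ≤ n → f n v = 0) :
    VertexOperator ℂ V :=
  of_coeff (fun n => f (-n - 1)) fun v => by
    obtain ⟨N, hN⟩ := hf v
    refine ⟨-N, fun n hn => ?_⟩
    by_contra h
    exact hn (hN _ (by omega))

@[simp] lemma ncoeff_ofModes (f : ℤ → Module.End ℂ V)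
    (hf : ∀ v, ∃ N : ℤ, ∀ n, N ≤ n → f n v = 0) (n : ℤ) : ncoeff (ofModes f hf) n = f n := by
  rw [ofModes, ncoeff_of_coeff]
  congr 1
  ring

/-- The coefficients of `(x - y)^l A(x) B(y) w`, expanded in nonnegative powers of `y`. -/
def orderedProd (A B : VertexOperator ℂ V) (l m n : ℤ) (w : V) : V :=
  expand l (fun m n => ncoeff A m (ncoeff B n w)) m n

lemma isTruncated_comp (A B : VertexOperator ℂ V) (w : V) :
    IsTruncated fun m n => ncoeff A m (ncoeff B n w) := by
  obtain ⟨N, hN⟩ := exists_ncoeff_eq_zero B w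
  exact ⟨N, fun m n h => by simp only [hN n h, map_zero]⟩

/-- The coefficients of `(x - y)^l A(x) B(y) w - (-y + x)^l B(y) A(x) w`. -/
def borcherdsProd (A B : VertexOperator ℂ V) (l m n : ℤ) (w : V) : V :=
  orderedProd A B l m n w - Int.negOnePow l • orderedProd B A l n m w

lemma orderedProd_succ (A B : VertexOperator ℂ V) (l m n : ℤ) (w : V) :
    orderedProd A B (l + 1) m n w = orderedProd A B l (m + 1) n w - orderedProd A B l m (n + 1) w :=
  expand_succ (isTruncated_comp A B w) l m n

lemma borcherdsProd_succ (A B : VertexOperator ℂ V) (l m n : ℤ) (w : V) :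
    borcherdsProd A B (l + 1) m n w =
      borcherdsProd A B l (m + 1) n w - borcherdsProd A B l m (n + 1) w := by
  simp only [borcherdsProd, orderedProd_succ, Int.negOnePow_succ, smul_sub, Units.neg_smul]
  abel

lemma orderedProd_zero (A B : VertexOperator ℂ V) (m n : ℤ) (w : V) :
    orderedProd A B 0 m n w = ncoeff A m (ncoeff B n w) :=
  expand_zero_left _ _ _

lemma borcherdsProd_zero (A B : VertexOperator ℂ V) (m n : ℤ) (w : V) :
    borcherdsProd A B 0 m n w = ncoeff A m (ncoeff B n w) - ncoeff B n (ncoeff A m w) := by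
  simp [borcherdsProd, orderedProd_zero]

lemma borcherdsProd_swap (A B : VertexOperator ℂ V) (l m n : ℤ) (w : V) :
    borcherdsProd B A l n m w = -(Int.negOnePow l • borcherdsProd A B l m n w) := by
  simp only [borcherdsProd, smul_sub, smul_smul, Int.units_mul_self, one_smul]
  abel

lemma orderedProd_map_add (A B : VertexOperator ℂ V) (l m n : ℤ) (v w : V) :
    orderedProd A B l m n (v + w) = orderedProd A B l m n v + orderedProd A B l m n w := by
  simp only [orderedProd, map_add]
  exact expand_add (isTruncated_comp A B v) (isTruncated_comp A B w) l m n

lemma orderedProd_map_smul (A B : VertexOperator ℂ V) (l m n : ℤ) (c : ℂ) (w : V) :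
    orderedProd A B l m n (c • w) = c • orderedProd A B l m n w := by
  simp only [orderedProd, map_smul]
  exact (map_expand (isTruncated_comp A B w) (LinearMap.lsmul ℂ V c) l m n).symm

lemma orderedProd_add_left (A A' B : VertexOperator ℂ V) (l m n : ℤ) (w : V) :
    orderedProd (A + A') B l m n w = orderedProd A B l m n w + orderedProd A' B l m n w := by
  simp only [orderedProd, map_add, Pi.add_apply, LinearMap.add_apply]
  exact expand_add (isTruncated_comp A B w) (isTruncated_comp A' B w) l m n

lemma orderedProd_add_right (A B B' : VertexOperator ℂ V) (l m n : ℤ) (w : V) :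
    orderedProd A (B + B') l m n w = orderedProd A B l m n w + orderedProd A B' l m n w := by
  simp only [orderedProd, map_add, Pi.add_apply, LinearMap.add_apply]
  exact expand_add (isTruncated_comp A B w) (isTruncated_comp A B' w) l m n

lemma orderedProd_smul_left (c : ℂ) (A B : VertexOperator ℂ V) (l m n : ℤ) (w : V) :
    orderedProd (c • A) B l m n w = c • orderedProd A B l m n w := by
  simp only [orderedProd, map_smul, Pi.smul_apply, LinearMap.smul_apply]
  exact (map_expand (isTruncated_comp A B w) (LinearMap.lsmul ℂ V c) l m n).symm

lemma orderedProd_smul_right (c : ℂ) (A B : VertexOperator ℂ V) (l m n : ℤ) (w : V) :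
    orderedProd A (c • B) l m n w = c • orderedProd A B l m n w := by
  simp only [orderedProd, map_smul, Pi.smul_apply, LinearMap.smul_apply]
  exact (map_expand (isTruncated_comp A B w) (LinearMap.lsmul ℂ V c) l m n).symm

lemma borcherdsProd_add_left (A A' B : VertexOperator ℂ V) (l m n : ℤ) (w : V) :
    borcherdsProd (A + A') B l m n w = borcherdsProd A B l m n w + borcherdsProd A' B l m n w := by
  simp only [borcherdsProd, orderedProd_add_left, orderedProd_add_right, smul_add]
  abel

lemma borcherdsProd_smul_left (c : ℂ) (A B : VertexOperator ℂ V) (l m n : ℤ) (w : V) :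
    borcherdsProd (c • A) B l m n w = c • borcherdsProd A B l m n w := by
  simp only [borcherdsProd, orderedProd_smul_left, orderedProd_smul_right, smul_sub,
    smul_comm c (Int.negOnePow l)]

/-- The `l`-th product `A(y)_l B(y) = Res_x ((x - y)^l A(x) B(y) - (-y + x)^l B(y) A(x))`. -/
def nprod (A B : VertexOperator ℂ V) (l : ℤ) : VertexOperator ℂ V :=
  ofModes
    (fun n =>
      { toFun := fun w => borcherdsProd A B l 0 n w
        map_add' := fun v w => by
          simp only [borcherdsProd, orderedProd_map_add, smul_add]
          abel
        map_smul' := fun c w => by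
          simp only [borcherdsProd, orderedProd_map_smul, smul_sub, RingHom.id_apply,
            smul_comm c (Int.negOnePow l)] })
    (fun w => by
      obtain ⟨N, hN⟩ := exists_ncoeff_eq_zero B w
      obtain ⟨K, hK⟩ := (isTruncated_comp B A w).exists_bound 0
      choose M hM using fun i : ℕ => exists_ncoeff_eq_zero B (ncoeff A (0 + i) w)
      obtain ⟨M', hM'⟩ := ((Finset.range K).image M).exists_le
      -- The second product consists of `B_{n+l-i} A_i w` with `0 ≤ i < K`. For `n ≥ M' + K - l` all
      -- these indices are at least the common bound `M'`. The first product vanishes once `n ≥ N`.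
      refine ⟨max N (M' + K - l), fun n hn => ?_⟩
      change borcherdsProd A B l 0 n w = 0
      rw [borcherdsProd, orderedProd, orderedProd,
        expand_eq_sum_range (K := 0) (fun m k hk => by
          rw [hN k (by push_cast at hk; omega), map_zero]),
        expand_eq_sum_range (K := K) hK, Finset.range_zero, Finset.sum_empty,
        Finset.sum_eq_zero fun i hi => ?_]
      · simp
      · have h1 := hM' (M i) (Finset.mem_image_of_mem _ hi)
        have h2 := Finset.mem_range.mp hi
        rw [hM i _ (by omega), smul_zero])

lemma ncoeff_nprod (A B : VertexOperator ℂ V) (l n : ℤ) (w : V) :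
    ncoeff (nprod A B l) n w = borcherdsProd A B l 0 n w := by
  rw [nprod, ncoeff_ofModes]
  rfl

/-- The identity vertex operator. -/
def one : VertexOperator ℂ V :=
  ofModes (fun n => if n = -1 then LinearMap.id else 0) fun _ =>
    ⟨0, fun n hn => by rw [if_neg (by omega), LinearMap.zero_apply]⟩

lemma ncoeff_one (n : ℤ) (v : V) :
    ncoeff (one : VertexOperator ℂ V) n v = if n = -1 then v else 0 := by
  rw [one, ncoeff_ofModes]
  split_ifs <;> rfl

/-! ### Locality -/

/-- Two vertex operators are local if `(x - y)^N [A(x), B(y)] = 0` for some `N`. -/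
def IsLocal (A B : VertexOperator ℂ V) : Prop :=
  ∃ N : ℕ, ∀ (m n : ℤ) (w : V), borcherdsProd A B N m n w = 0

lemma IsLocal.exists_forall_le {A B : VertexOperator ℂ V} (h : IsLocal A B) :
    ∃ N : ℕ, ∀ (l : ℤ), (N : ℤ) ≤ l → ∀ (m n : ℤ) (w : V), borcherdsProd A B l m n w = 0 := by
  obtain ⟨N, hN⟩ := h
  refine ⟨N, fun l hl => ?_⟩
  induction l, hl using Int.leInduction with
  | base => exact hN
  | succ l hl ih =>
    intro m n w
    rw [borcherdsProd_succ, ih, ih, sub_zero]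

lemma IsLocal.symm {A B : VertexOperator ℂ V} (h : IsLocal A B) : IsLocal B A := by
  obtain ⟨N, hN⟩ := h
  exact ⟨N, fun m n w => by rw [borcherdsProd_swap, hN, smul_zero, neg_zero]⟩

lemma IsLocal.of_commute {A B : VertexOperator ℂ V}
    (h : ∀ m n w, ncoeff A m (ncoeff B n w) = ncoeff B n (ncoeff A m w)) : IsLocal A B :=
  ⟨0, fun m n w => by rw [Nat.cast_zero, borcherdsProd_zero, h, sub_self]⟩

lemma isLocal_one_left (A : VertexOperator ℂ V) : IsLocal one A :=
  .of_commute fun m n w => by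
    rw [ncoeff_one, ncoeff_one]
    split_ifs <;> simp

lemma IsLocal.add {A A' B : VertexOperator ℂ V} (h : IsLocal A B) (h' : IsLocal A' B) :
    IsLocal (A + A') B := by
  obtain ⟨N, hN⟩ := h.exists_forall_le
  obtain ⟨M, hM⟩ := h'.exists_forall_le
  exact ⟨max N M, fun m n w => by
    rw [borcherdsProd_add_left, hN _ (by simp), hM _ (by simp), add_zero]⟩

lemma IsLocal.smul {A B : VertexOperator ℂ V} (c : ℂ) (h : IsLocal A B) : IsLocal (c • A) B := by
  obtain ⟨N, hN⟩ := h
  exact ⟨N, fun m n w => by rw [borcherdsProd_smul_left, hN, smul_zero]⟩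

/-! ### Dong's lemma -/

section Dong

/-- The coefficients of `(x - y)^l [A(x) B(y), C(z)] w`. -/
def orderedComm (A B C : VertexOperator ℂ V) (l : ℤ) (w : V) (m n k : ℤ) : V :=
  orderedProd A B l m n (ncoeff C k w) - ncoeff C k (orderedProd A B l m n w)

/-- Write `[A(x)B(y), C(z)] = A(x)[B(y), C(z)] + [A(x), C(z)]B(y)`. The first term (`G`) is killed
by `(y - z)^N`, the second (`H`) by `(x - z)^N`, and both factors commute with the expansion of `(x
- y)^l`. -/
lemma diff_orderedComm_eq_zero {A B C : VertexOperator ℂ V} {N : ℕ}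
    (hA : ∀ m n w, borcherdsProd A C N m n w = 0) (hB : ∀ m n w, borcherdsProd B C N m n w = 0)
    (l : ℤ) (w : V) : (diffXZ V ^ N) ((diffYZ V ^ N) (orderedComm A B C l w)) = 0 := by
  let G (j : ℤ) (m n k : ℤ) : V := ncoeff A m (borcherdsProd B C j n k w)
  let H (j : ℤ) (m n k : ℤ) : V := borcherdsProd A C j m k (ncoeff B n w)
  have hG (j : ℤ) : diffYZ V (G j) = G (j + 1) := by
    funext m n k
    simp [diffYZ, G, borcherdsProd_succ]
  have hH (j : ℤ) : diffXZ V (H j) = H (j + 1) := by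
    funext m n k
    simp [diffXZ, H, borcherdsProd_succ]
  have hG' : (diffYZ V ^ N) (G 0) = 0 := by
    rw [pow_apply_of_succ _ G hG]
    funext m n k
    simp [G, hB]
  have hH' : (diffXZ V ^ N) (H 0) = 0 := by
    rw [pow_apply_of_succ _ H hH]
    funext m n k
    simp [H, hA]
  have h1 (k : ℤ) := isTruncated_comp A B (ncoeff C k w)
  have h2 (k : ℤ) := (isTruncated_comp A B w).map (ncoeff C k)
  have h3 : orderedComm A B C l w = expand₃ l (G 0 + H 0) := by
    funext m n k
    rw [orderedComm, orderedProd, orderedProd, map_expand (isTruncated_comp A B w),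
      ← expand_sub (h1 k) (h2 k)]
    simp only [expand₃, G, H, Pi.add_apply, borcherdsProd_zero, map_sub]
    congr 1
    funext m n
    abel
  have h4 (k : ℤ) : IsTruncated fun m n => (G 0 + H 0) m n k := by
    have h := (h1 k).add ((h2 k).map (-AddMonoidHom.id V))
    convert h using 3
    simp only [G, H, Pi.add_apply, borcherdsProd_zero, map_sub, AddMonoidHom.neg_apply,
      AddMonoidHom.id_apply]
    abel
  rw [h3, (diffXZ_pow_diffYZ_pow_expand₃ h4 l N N).2, map_add, hG', zero_add,
    ← Module.End.mul_apply, (commute_diffXZ_diffYZ.pow_pow N N).eq, Module.End.mul_apply, hH',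
    map_zero]
  funext m n k
  exact expand_zero l m n

/-- Dong's lemma. -/
theorem IsLocal.nprod {A B C : VertexOperator ℂ V} (hAB : IsLocal A B) (hAC : IsLocal A C)
    (hBC : IsLocal B C) (l : ℤ) : IsLocal (nprod A B l) C := by
  obtain ⟨N₁, h₁⟩ := hAB.exists_forall_le
  obtain ⟨N₂, h₂⟩ := hAC.exists_forall_le
  obtain ⟨N₃, h₃⟩ := hBC.exists_forall_le
  set N := max N₂ N₃
  -- Chosen so that `l + K ≥ N₁`: multiplying by `(x - y)^K` brings the exponent into the range
  -- where `A` and `B` are local.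
  set K := ((N₁ : ℤ) - l).toNat
  have hA : ∀ m n w, borcherdsProd A C N m n w = 0 := h₂ N (by simp [N])
  have hB : ∀ m n w, borcherdsProd B C N m n w = 0 := h₃ N (by simp [N])
  refine ⟨K + N + N, fun n k w => ?_⟩
  -- The commutator with `C(z)` of `(x - y)^j A(x)B(y) - (-y + x)^j B(y)A(x)`, before the residue in
  -- `x` is taken.
  let Q (j : ℤ) (m n k : ℤ) : V :=
    borcherdsProd A B j m n (ncoeff C k w) - ncoeff C k (borcherdsProd A B j m n w)
  have hQ (j : ℤ) : diffXY V (Q j) = Q (j + 1) := by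
    funext m n k
    simp only [diffXY, Q, borcherdsProd_succ, map_sub, LinearMap.coe_mk, AddHom.coe_mk]
    abel
  have hQ₁ : (diffXY V ^ K) (Q l) = 0 := by
    rw [pow_apply_of_succ _ Q hQ]
    funext m n k
    simp only [Q, h₁ (l + K) (by omega), map_zero, sub_zero, Pi.zero_apply]
  have hQ₂ : (diffXZ V ^ N) ((diffYZ V ^ N) (Q l)) = 0 := by
    have h : Q l = orderedComm A B C l w -
        ((Int.negOnePow l : ℤˣ) : ℤ) • swapXY V (orderedComm B A C l w) := by
      funext m n k
      simp only [Q, borcherdsProd, orderedComm, swapXY, Pi.sub_apply, Pi.smul_apply,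
        LinearMap.coe_mk, AddHom.coe_mk, Units.smul_def, map_sub, map_zsmul, smul_sub]
      abel
    rw [h, map_sub, map_sub, diff_orderedComm_eq_zero hA hB, map_smul, map_smul,
      diffYZ_pow_swapXY, diffXZ_pow_swapXY, ← Module.End.mul_apply (diffYZ V ^ N),
      ← (commute_diffXZ_diffYZ.pow_pow N N).eq, Module.End.mul_apply,
      diff_orderedComm_eq_zero hB hA]
    simp
  -- The residue in `x`, that is `m = 0`, commutes with multiplication by `y - z`.
  have hQ₃ : ∀ (j : ℕ) (n k : ℤ),
      (diffYZ V ^ j) (Q l) 0 n k = borcherdsProd (VertexOperator.nprod A B l) C j n k w := by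
    intro j
    induction j with
    | zero =>
      intro n k
      rw [Nat.cast_zero, borcherdsProd_zero, ncoeff_nprod, ncoeff_nprod]
      rfl
    | succ j ih =>
      intro n k
      rw [pow_succ', Module.End.mul_apply, Nat.cast_succ, borcherdsProd_succ, ← ih, ← ih]
      rfl
  rw [← hQ₃, diffYZ_pow_eq_zero hQ₁ hQ₂]
  rfl

end Dong

end VertexOperator

namespace VertexOperator

/-! ### The reconstruction theorem -/

variable {V : Type*} [AddCommGroup V] [Module ℂ V]

/-- The vertex operators obtained from the identity by sums, multiples and `n`-th products with
elements of `S` on the left. -/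
inductive Generated (S : Set (VertexOperator ℂ V)) : VertexOperator ℂ V → Prop
  | one : Generated S one
  | nprod (A B : VertexOperator ℂ V) (l : ℤ) :
      A ∈ S → Generated S B → Generated S (nprod A B l)
  | add (A B : VertexOperator ℂ V) : Generated S A → Generated S B → Generated S (A + B)
  | smul (c : ℂ) (A : VertexOperator ℂ V) : Generated S A → Generated S (c • A)

/-- The vertex operator is translation covariant: `[T, A(x)] = A'(x)`. -/
def IsCovariant (T : Module.End ℂ V) (A : VertexOperator ℂ V) : Prop :=
  ∀ (n : ℤ) (w : V), T (ncoeff A n w) = ncoeff A n (T w) - n • ncoeff A (n - 1) w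

/-- `A(x)vac` has no negative powers of `x`. -/
def IsCreative (vac : V) (A : VertexOperator ℂ V) : Prop :=
  ∀ n : ℤ, 0 ≤ n → ncoeff A n vac = 0

/-- Dong's lemma along the generation of `A`. This case has to come before `Generated.isLocal`,
whose product step needs each element of `S` to be local to every generated operator. -/
lemma Generated.isLocal_of_mem {S : Set (VertexOperator ℂ V)}
    (hS : ∀ A ∈ S, ∀ B ∈ S, IsLocal A B) {A C : VertexOperator ℂ V} (hA : Generated S A)
    (hC : C ∈ S) : IsLocal A C := by
  induction hA generalizing C with
  | one => exact isLocal_one_left C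
  | nprod A B l hA _ ih => exact (ih hA).symm.nprod (hS A hA C hC) (ih hC) l
  | add A B _ _ hA hB => exact (hA hC).add (hB hC)
  | smul c A _ hA => exact (hA hC).smul c

lemma Generated.isLocal {S : Set (VertexOperator ℂ V)} (hS : ∀ A ∈ S, ∀ B ∈ S, IsLocal A B)
    {A B : VertexOperator ℂ V} (hA : Generated S A) (hB : Generated S B) : IsLocal A B := by
  induction hA with
  | one => exact isLocal_one_left B
  | nprod A A' l hA hA' ih =>
    exact (hA'.isLocal_of_mem hS hA).symm.nprod (hB.isLocal_of_mem hS hA).symm ih l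
  | add A B _ _ hA hB => exact hA.add hB
  | smul c A _ hA => exact hA.smul c

/-- Commuting with `T` acts on `A(x)B(y)` as `∂_x + ∂_y`, which annihilates `x - y` and so passes
through the factor `(x - y)^l`. -/
lemma map_orderedProd_of_isCovariant {T : Module.End ℂ V} {A B : VertexOperator ℂ V}
    (hA : IsCovariant T A) (hB : IsCovariant T B) (l m n : ℤ) (w : V) :
    T (orderedProd A B l m n w) = orderedProd A B l m n (T w) -
      (m • orderedProd A B l (m - 1) n w + n • orderedProd A B l m (n - 1) w) := by
  have h := isTruncated_comp A B w
  have h1 : IsTruncated fun m n : ℤ => m • ncoeff A (m - 1) (ncoeff B n w) +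
      n • ncoeff A m (ncoeff B (n - 1) w) := by
    obtain ⟨N, hN⟩ := exists_ncoeff_eq_zero B w
    exact ⟨N + 1, fun m n h => by simp [hN n (by omega), hN (n - 1) (by omega)]⟩
  rw [orderedProd, map_expand h, orderedProd, orderedProd, orderedProd, ← expand_deriv h,
    ← expand_sub (isTruncated_comp A B (T w)) h1]
  congr 1
  funext m n
  rw [hA, hB, map_sub, map_zsmul]
  abel

/-- At `m = 0` the coefficient of the `x`-derivative is zero, so only the `y`-derivative survives
the residue. -/
lemma IsCovariant.nprod {T : Module.End ℂ V} {A B : VertexOperator ℂ V}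
    (hA : IsCovariant T A) (hB : IsCovariant T B) (l : ℤ) : IsCovariant T (nprod A B l) := by
  intro n w
  simp only [ncoeff_nprod, borcherdsProd, map_sub, Units.smul_def, map_zsmul,
    map_orderedProd_of_isCovariant hA hB, map_orderedProd_of_isCovariant hB hA, zero_smul,
    zero_add, add_zero, smul_sub]
  rw [smul_comm n]
  abel

/-- The state of the `l`-th product is `A_l` applied to the state of `B`. Creativity of `B` leaves
only the term `i = 0` of the first product, and creativity of `A` annihilates the second. -/
lemma borcherdsProd_apply_vac {vac : V} {A B : VertexOperator ℂ V} (hA : IsCreative vac A)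
    (hB : IsCreative vac B) (l : ℤ) :
    borcherdsProd A B l 0 (-1) vac = ncoeff A l (ncoeff B (-1) vac) := by
  rw [borcherdsProd, orderedProd, orderedProd,
    expand_eq_sum_range (K := 1) (fun m k hk => by rw [hB k (by push_cast at hk; omega), map_zero]),
    expand_eq_sum_range (K := 0) (fun m k hk => by rw [hA k (by push_cast at hk; omega), map_zero])]
  simp

lemma IsCreative.nprod {vac : V} {A B : VertexOperator ℂ V} (hA : IsCreative vac A)
    (hB : IsCreative vac B) (l : ℤ) : IsCreative vac (nprod A B l) := by
  intro n hn
  rw [ncoeff_nprod, borcherdsProd, orderedProd, orderedProd,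
    expand_eq_sum_range (K := 0) (fun m k hk => by rw [hB k (by push_cast at hk; omega), map_zero]),
    expand_eq_sum_range (K := 0) (fun m k hk => by rw [hA k (by push_cast at hk; omega), map_zero])]
  simp

lemma IsCovariant.add {T : Module.End ℂ V} {A B : VertexOperator ℂ V}
    (hA : IsCovariant T A) (hB : IsCovariant T B) : IsCovariant T (A + B) := by
  intro n w
  simp only [map_add, Pi.add_apply, LinearMap.add_apply, hA n w, hB n w, smul_add]
  abel

lemma IsCovariant.smul {T : Module.End ℂ V} {A : VertexOperator ℂ V} (c : ℂ)
    (hA : IsCovariant T A) : IsCovariant T (c • A) := by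
  intro n w
  simp only [map_smul, Pi.smul_apply, LinearMap.smul_apply, hA n w, smul_sub, smul_comm n c]

lemma IsCreative.add {vac : V} {A B : VertexOperator ℂ V} (hA : IsCreative vac A)
    (hB : IsCreative vac B) : IsCreative vac (A + B) :=
  fun n hn => by simp [hA n hn, hB n hn]

lemma IsCreative.smul {vac : V} {A : VertexOperator ℂ V} (c : ℂ) (hA : IsCreative vac A) :
    IsCreative vac (c • A) :=
  fun n hn => by simp [hA n hn]

lemma Generated.isCovariant {S : Set (VertexOperator ℂ V)} {T : Module.End ℂ V}
    (hS : ∀ A ∈ S, IsCovariant T A) {A : VertexOperator ℂ V} (hA : Generated S A) :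
    IsCovariant T A := by
  induction hA with
  | one =>
    intro n w
    rw [ncoeff_one, ncoeff_one, ncoeff_one]
    rcases eq_or_ne n 0 with rfl | hn
    · simp
    · rw [if_neg (show ¬ n - 1 = -1 by omega)]
      split_ifs <;> simp
  | nprod A B l hA _ hB => exact (hS A hA).nprod hB l
  | add A B _ _ hA hB => exact hA.add hB
  | smul c A _ hA => exact hA.smul c

lemma Generated.isCreative {S : Set (VertexOperator ℂ V)} {vac : V}
    (hS : ∀ A ∈ S, IsCreative vac A) {A : VertexOperator ℂ V} (hA : Generated S A) :
    IsCreative vac A := by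
  induction hA with
  | one => exact fun n hn => by rw [ncoeff_one, if_neg (by omega)]
  | nprod A B l hA _ hB => exact (hS A hA).nprod hB l
  | add A B _ _ hA hB => exact hA.add hB
  | smul c A _ hA => exact hA.smul c

/-- A covariant vertex operator `A` with `A(x)vac ∈ xV[[x]]` kills the vacuum. -/
lemma ncoeff_vac_eq_zero {vac : V} {T : Module.End ℂ V} (hT : T vac = 0) {A : VertexOperator ℂ V}
    (hA : IsCovariant T A) (hA' : IsCreative vac A) (h : ncoeff A (-1) vac = 0) (n : ℤ) :
    ncoeff A n vac = 0 := by
  rcases le_or_gt 0 n with hn | hn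
  · exact hA' n hn
  · have key : ∀ k : ℕ, ncoeff A (-1 - k) vac = 0 := by
      intro k
      induction k with
      | zero => simpa using h
      | succ k ih =>
        -- Since `T vac = 0`, covariance gives `T(A_j vac) = -j A_{j-1} vac`. With `j = -1 - k ≠ 0`,
        -- vanishing passes from `j` to `j - 1`.
        have h1 := hA (-1 - k) vac
        rw [ih, hT, map_zero, map_zero, zero_sub, eq_comm, neg_eq_zero,
          ← Int.cast_smul_eq_zsmul ℂ, smul_eq_zero_iff_right (by norm_cast; omega)] at h1
        rw [← h1]
        congr 2
        push_cast
        ring_nf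
    obtain ⟨k, rfl⟩ : ∃ k : ℕ, n = -1 - k := ⟨(-1 - n).toNat, by omega⟩
    exact key k

/-- Goddard's uniqueness argument. -/
lemma ncoeff_ncoeff_vac_eq_zero {vac : V} {A B : VertexOperator ℂ V} (hAB : IsLocal A B)
    (hB : IsCreative vac B) (h : ∀ n, ncoeff A n vac = 0) (n : ℤ) :
    ncoeff A n (ncoeff B (-1) vac) = 0 := by
  obtain ⟨N, hN⟩ := hAB
  -- With first index `n - N` the only surviving term of the locality relation is `A_n B_{-1} vac`.
  have h1 := hN (n - N) (-1) vac
  rw [borcherdsProd, orderedProd, orderedProd,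
    expand_eq_sum_range (K := 1) (fun m k hk => by rw [hB k (by push_cast at hk; omega), map_zero]),
    expand_eq_sum_range (K := 0) (fun m k hk => by rw [h k, map_zero])] at h1
  simpa using h1

end VertexOperator

namespace VertexData

open VertexOperator

variable {V : Type*} [AddCommGroup V] [Module ℂ V]

lemma mode_add_left (𝒱 : VertexData V) (u v : V) (n : ℤ) :
    𝒱.mode (u + v) n = 𝒱.mode u n + 𝒱.mode v n := by simp [mode]

lemma mode_smul_left (𝒱 : VertexData V) (c : ℂ) (v : V) (n : ℤ) :
    𝒱.mode (c • v) n = c • 𝒱.mode v n := by simp [mode]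

@[simp] lemma mode_zero_left (𝒱 : VertexData V) (n : ℤ) : 𝒱.mode 0 n = 0 := by simp [mode]

lemma ext_mode {𝒱 𝒲 : VertexData V} (h : ∀ v n, 𝒱.mode v n = 𝒲.mode v n)
    (h' : 𝒱.vac = 𝒲.vac) : 𝒱 = 𝒲 :=
  VertexData.ext (LinearMap.ext fun v => ncoeff_injective (funext (h v))) h'

/-- The right hand side of the Jacobi identity. -/
lemma finsum_jacobi_eq (𝒱 : VertexData V) (u v w : V) (l m n : ℤ) :
    ∑ᶠ i : ℕ, ((-1) ^ i * Ring.choose l i : ℤ) •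
        (𝒱.mode u (m + l - i) (𝒱.mode v (n + i) w)
          - Int.negOnePow l • 𝒱.mode v (n + l - i) (𝒱.mode u (m + i) w)) =
      borcherdsProd (𝒱.Y u) (𝒱.Y v) l m n w := by
  have h1 := (isTruncated_comp (𝒱.Y u) (𝒱.Y v) w).finite_support l m n
  have h2 := ((isTruncated_comp (𝒱.Y v) (𝒱.Y u) w).map
    (DistribSMul.toAddMonoidHom V (Int.negOnePow l))).finite_support l n m
  rw [borcherdsProd, orderedProd, orderedProd, ← DistribSMul.toAddMonoidHom_apply,
    map_expand (isTruncated_comp (𝒱.Y v) (𝒱.Y u) w)]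
  rw [expand, expand, ← finsum_sub_distrib h1 h2]
  simp only [smul_sub]
  rfl

/-- The left hand side of the Jacobi identity satisfies the same recurrence as the right hand
side. -/
lemma finsum_choose_mode_succ (𝒱 : VertexData V) (u v w : V) (l m n : ℤ) :
    ∑ᶠ i : ℕ, Ring.choose (m + 1) i • 𝒱.mode (𝒱.mode u (l + i) v) (m + 1 + n - i) w =
      ∑ᶠ i : ℕ, Ring.choose m i • 𝒱.mode (𝒱.mode u (l + i) v) (m + (n + 1) - i) w +
      ∑ᶠ i : ℕ, Ring.choose m i • 𝒱.mode (𝒱.mode u (l + 1 + i) v) (m + n - i) w := by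
  obtain ⟨N, hN⟩ := exists_ncoeff_eq_zero (𝒱.Y u) v
  set K := (N - l).toNat
  have h0 (k : ℤ) (hk : N ≤ k) : 𝒱.mode u k v = 0 := hN k hk
  have key (f : ℕ → ℤ) (g : ℕ → ℤ) (k : ℤ) (hk : l ≤ k) (M : ℕ) (hM : K ≤ M) :
      ∑ᶠ i : ℕ, f i • 𝒱.mode (𝒱.mode u (k + i) v) (g i) w =
        ∑ i ∈ Finset.range M, f i • 𝒱.mode (𝒱.mode u (k + i) v) (g i) w := by
    refine finsum_eq_sum_of_support_subset _ fun i hi => ?_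
    by_contra h
    simp only [Finset.coe_range, Set.mem_Iio, not_lt] at h
    exact hi (by simp [h0 (k + i) (by omega)])
  rw [key _ _ l le_rfl (K + 1) (by omega), key _ _ l le_rfl (K + 1) (by omega),
    key _ _ (l + 1) (by omega) K (by omega), Finset.sum_range_succ', Finset.sum_range_succ' _ K,
    add_right_comm (Finset.sum _ _), ← Finset.sum_add_distrib]
  congr 1
  · refine Finset.sum_congr rfl fun i _ => ?_
    rw [Ring.choose_succ_succ, add_smul, add_comm]
    congr 3 <;> push_cast <;> ring_nf
  · simp only [Ring.choose_zero_right]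
    congr 3
    push_cast
    ring

/-- The Jacobi identity follows from locality and from the associativity formula. -/
theorem jacobi_of_isLocal {𝒱 : VertexData V} {u v : V} (hloc : IsLocal (𝒱.Y u) (𝒱.Y v))
    (hassoc : ∀ (l n : ℤ) (w : V),
      𝒱.mode (𝒱.mode u l v) n w = borcherdsProd (𝒱.Y u) (𝒱.Y v) l 0 n w) (w : V) (l m n : ℤ) :
    ∑ᶠ i : ℕ, Ring.choose m i • 𝒱.mode (𝒱.mode u (l + i) v) (m + n - i) w =
      borcherdsProd (𝒱.Y u) (𝒱.Y v) l m n w := by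
  obtain ⟨N, hN⟩ := hloc.exists_forall_le
  obtain ⟨M, hM⟩ := exists_ncoeff_eq_zero (𝒱.Y u) v
  -- Descending induction on `l`. At the top both sides vanish, the right by locality and the left
  -- because `u_{l+i} v = 0`. For a fixed lower `l`, associativity is the case `m = 0`, and the
  -- common recurrence moves `m` in both directions.
  suffices h : ∀ l ≤ max (N : ℤ) M, ∀ m n : ℤ,
      ∑ᶠ i : ℕ, Ring.choose m i • 𝒱.mode (𝒱.mode u (l + i) v) (m + n - i) w =
      borcherdsProd (𝒱.Y u) (𝒱.Y v) l m n w by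
    rcases le_total l (max (N : ℤ) M) with hl | hl
    · exact h l hl m n
    · rw [hN l (le_trans (le_max_left _ _) hl)]
      refine finsum_eq_zero_of_forall_eq_zero fun i => ?_
      rw [show 𝒱.mode u (l + i) v = 0 from
        hM _ (by have := le_trans (le_max_right (N : ℤ) M) hl; omega)]
      simp
  intro l hl
  induction l, hl using Int.leInductionDown with
  | base =>
    intro m n
    rw [hN _ (le_max_left _ _)]
    refine finsum_eq_zero_of_forall_eq_zero fun i => ?_
    rw [show 𝒱.mode u (max (N : ℤ) M + i) v = 0 from
      hM _ (by have := le_max_right (N : ℤ) M; omega)]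
    simp
  | pred l hl ih =>
    intro m
    have hrec (m n : ℤ) := finsum_choose_mode_succ 𝒱 u v w (l - 1) m n
    have hrec' (m n : ℤ) := borcherdsProd_succ (𝒱.Y u) (𝒱.Y v) (l - 1) m n w
    simp only [sub_add_cancel] at hrec hrec'
    induction m using Int.induction_on with
    | zero =>
      intro n
      rw [finsum_eq_single _ 0, ← hassoc]
      · simp
      · intro i hi
        obtain ⟨j, rfl⟩ := Nat.exists_eq_succ_of_ne_zero hi
        rw [Nat.succ_eq_add_one, Ring.choose_zero_succ, zero_smul]
    | succ m ihm =>
      intro n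
      rw [hrec, ihm, ih, hrec']
      abel
    | pred m ihm =>
      intro n
      have h1 := hrec (-m - 1) (n - 1)
      have h2 := hrec' (-m - 1) (n - 1)
      simp only [sub_add_cancel] at h1 h2
      rw [ihm, ih, h2] at h1
      rw [← sub_eq_iff_eq_add] at h1
      rw [← h1]
      abel

/-- The reconstruction theorem: mutually local, translation covariant and creative vertex operators
which generate `V` from the vacuum are part of a vertex algebra structure. -/
theorem exists_isVertexAlgebra (vac : V) (T : Module.End ℂ V) (hT : T vac = 0)
    (S : Set (VertexOperator ℂ V)) (hloc : ∀ A ∈ S, ∀ B ∈ S, IsLocal A B)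
    (hcov : ∀ A ∈ S, IsCovariant T A) (hcre : ∀ A ∈ S, IsCreative vac A)
    (hgen : ∀ p : Submodule ℂ V, vac ∈ p →
      (∀ A ∈ S, ∀ (n : ℤ), ∀ v ∈ p, ncoeff A n v ∈ p) → p = ⊤) :
    ∃ 𝒱 : VertexData V, 𝒱.IsVertexAlgebra ∧ 𝒱.vac = vac ∧
      ∀ A ∈ S, 𝒱.Y (ncoeff A (-1) vac) = A := by
  let F : Submodule ℂ (VertexOperator ℂ V) :=
    { carrier := {A | Generated S A}
      add_mem' := fun hA hB => .add _ _ hA hB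
      zero_mem' := by simpa using Generated.smul (S := S) 0 _ .one
      smul_mem' := fun c _ hA => .smul c _ hA }
  -- The field-to-state map, whose inverse will be `Y`.
  let ev : F →ₗ[ℂ] V :=
    { toFun := fun A => ncoeff A.1 (-1) vac
      map_add' := fun A B => by simp
      map_smul' := fun c A => by simp }
  have hsurj : Function.Surjective ev := by
    rw [← LinearMap.range_eq_top]
    refine hgen _ ⟨⟨one, .one⟩, ?_⟩ ?_
    · exact (ncoeff_one (-1) vac).trans (if_pos rfl)
    · rintro A hA n _ ⟨B, rfl⟩
      refine ⟨⟨nprod A B.1 n, .nprod _ _ _ hA B.2⟩, ?_⟩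
      change ncoeff (nprod A B.1 n) (-1) vac = _
      rw [ncoeff_nprod, borcherdsProd_apply_vac (hcre A hA) (B.2.isCreative hcre)]
      rfl
  have huniq (A : VertexOperator ℂ V) (h1 : IsCovariant T A) (h2 : IsCreative vac A)
      (h3 : ∀ B, Generated S B → IsLocal A B) (h4 : ncoeff A (-1) vac = 0) : A = 0 := by
    have h := ncoeff_vac_eq_zero hT h1 h2 h4
    refine ncoeff_injective ?_
    funext n
    ext v
    obtain ⟨B, rfl⟩ := hsurj v
    refine (ncoeff_ncoeff_vac_eq_zero (h3 B.1 B.2) (B.2.isCreative hcre) h n).trans ?_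
    simp
  have hinj : Function.Injective ev := by
    rw [injective_iff_map_eq_zero]
    intro A hA
    exact Subtype.ext (huniq A (A.2.isCovariant hcov) (A.2.isCreative hcre)
      (fun B hB => A.2.isLocal hloc hB) hA)
  let e := LinearEquiv.ofBijective ev ⟨hinj, hsurj⟩
  let 𝒱 : VertexData V := ⟨F.subtype ∘ₗ e.symm.toLinearMap, vac⟩
  have hG (v : V) : Generated S (𝒱.Y v) := (e.symm v).2
  have hcr (v : V) : ncoeff (𝒱.Y v) (-1) vac = v := e.apply_symm_apply v
  -- A field local to all generated ones is the field of its own state. Applied to `n`-th products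
  -- this becomes associativity.
  have hY (A : VertexOperator ℂ V) (h1 : IsCovariant T A) (h2 : IsCreative vac A)
      (h3 : ∀ B, Generated S B → IsLocal A B) : 𝒱.Y (ncoeff A (-1) vac) = A := by
    set B := 𝒱.Y (ncoeff A (-1) vac) with hB
    have hBG : Generated S B := hG _
    rw [← sub_eq_zero, sub_eq_add_neg, ← neg_one_smul ℂ A]
    refine huniq _ ?_ ?_ (fun C hC => (hBG.isLocal hloc hC).add ((h3 C hC).smul _)) ?_
    · exact (hBG.isCovariant hcov).add (h1.smul _)
    · exact (hBG.isCreative hcre).add (h2.smul _)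
    · simp [hB, hcr]
  have hvac : 𝒱.Y vac = one := by
    have hone : Generated S one := .one
    have h := hY one (hone.isCovariant hcov) (hone.isCreative hcre) fun B hB => hone.isLocal hloc hB
    rwa [ncoeff_one, if_pos rfl] at h
  refine ⟨𝒱, ⟨?_, ?_, hcr, ?_⟩, rfl, fun A hA => hY A (hcov A hA) (hcre A hA) fun B hB =>
    (hB.isLocal_of_mem hloc hA).symm⟩
  · intro v n
    rw [mode, show 𝒱.Y 𝒱.vac = one from hvac, ncoeff_one]
  · exact fun v n hn => (hG v).isCreative hcre n hn
  · intro u v w l m n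
    rw [finsum_jacobi_eq]
    refine jacobi_of_isLocal ((hG u).isLocal hloc (hG v)) (fun l n w => ?_) w l m n
    have h := hY _ (((hG u).isCovariant hcov).nprod ((hG v).isCovariant hcov) l)
      (((hG u).isCreative hcre).nprod ((hG v).isCreative hcre) l) fun B hB =>
        ((hG u).isLocal hloc (hG v)).nprod ((hG u).isLocal hloc hB) ((hG v).isLocal hloc hB) l
    rw [ncoeff_nprod, borcherdsProd_apply_vac ((hG u).isCreative hcre)
      ((hG v).isCreative hcre), hcr] at h
    rw [mode, mode, h, ncoeff_nprod]

end VertexData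

/-- The two halves correspond to the two terms of a normally ordered product. -/
lemma finsum_int_eq_add {M : Type*} [AddCommMonoid M] {f : ℤ → M}
    (hf : (Function.support f).Finite) :
    ∑ᶠ j, f j = ∑ᶠ i : ℕ, f i + ∑ᶠ i : ℕ, f (-1 - i) := by
  have h1 : Set.range (fun i : ℕ => (i : ℤ)) ∪ Set.range (fun i : ℕ => (-1 - i : ℤ)) =
      Set.univ := by
    ext j
    simp only [Set.mem_union, Set.mem_range, Set.mem_univ, iff_true]
    rcases le_or_gt 0 j with h | h
    · exact Or.inl ⟨j.toNat, by omega⟩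
    · exact Or.inr ⟨(-1 - j).toNat, by omega⟩
  rw [← finsum_mem_univ, ← h1, finsum_mem_union' _ (hf.inter_of_right _) (hf.inter_of_right _),
    finsum_mem_range fun a b h => by simpa using h, finsum_mem_range fun a b h => by simpa using h]
  rw [Set.disjoint_left]
  rintro _ ⟨i, rfl⟩ ⟨j, hj⟩
  simp only at hj
  omega

namespace VertexData

open VertexOperator

variable {V W : Type*} [AddCommGroup V] [Module ℂ V] [AddCommGroup W] [Module ℂ W]

/-! ### Consequences of the axioms -/

/-- Associativity is the Jacobi identity at `m = 0`, where only `i = 0` remains on the left. -/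
lemma IsVertexAlgebra.mode_mode {𝒱 : VertexData V} (h𝒱 : 𝒱.IsVertexAlgebra) (u v w : V) (l n : ℤ) :
    𝒱.mode (𝒱.mode u l v) n w = borcherdsProd (𝒱.Y u) (𝒱.Y v) l 0 n w := by
  rw [← finsum_jacobi_eq, ← h𝒱.jacobi, finsum_eq_single _ 0]
  · simp
  · intro i hi
    obtain ⟨j, rfl⟩ := Nat.exists_eq_succ_of_ne_zero hi
    rw [Nat.succ_eq_add_one, Ring.choose_zero_succ, zero_smul]

/-- For an exponent `l` beyond the pole order of `Y(u,x)v`, the left side of the Jacobi identity is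
zero. -/
lemma IsVertexAlgebra.isLocal {𝒱 : VertexData V} (h𝒱 : 𝒱.IsVertexAlgebra) (u v : V) :
    IsLocal (𝒱.Y u) (𝒱.Y v) := by
  obtain ⟨N, hN⟩ := exists_ncoeff_eq_zero (𝒱.Y u) v
  refine ⟨N.toNat, fun m n w => ?_⟩
  rw [← finsum_jacobi_eq, ← h𝒱.jacobi]
  refine finsum_eq_zero_of_forall_eq_zero fun i => ?_
  rw [show 𝒱.mode u (N.toNat + i) v = 0 from hN _ (by omega)]
  simp

/-- The translation operator `v ↦ v_{-2}𝟏`. -/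
def translation (𝒱 : VertexData V) : Module.End ℂ V where
  toFun v := 𝒱.mode v (-2) 𝒱.vac
  map_add' u v := by rw [mode_add_left, LinearMap.add_apply]
  map_smul' c v := by rw [mode_smul_left, LinearMap.smul_apply, RingHom.id_apply]

/-- Associativity applied to `(u_n v)_{-2} 𝟏`: only `u_n v_{-2} 𝟏` and `-n u_{n-1} v_{-1} 𝟏`
survive, the other terms being killed by creation. -/
lemma IsVertexAlgebra.isCovariant {𝒱 : VertexData V} (h𝒱 : 𝒱.IsVertexAlgebra) (u : V) :
    IsCovariant 𝒱.translation (𝒱.Y u) := by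
  intro n v
  change 𝒱.mode (𝒱.mode u n v) (-2) 𝒱.vac =
    𝒱.mode u n (𝒱.mode v (-2) 𝒱.vac) - n • 𝒱.mode u (n - 1) v
  rw [h𝒱.mode_mode, borcherdsProd, orderedProd, orderedProd,
    expand_eq_sum_range (K := 2) (fun m k hk => by
      rw [show ncoeff (𝒱.Y v) k 𝒱.vac = 0 from
        h𝒱.creation_regular v k (by push_cast at hk; omega), map_zero]),
    expand_eq_sum_range (K := 0) (fun m k hk => by
      rw [show ncoeff (𝒱.Y u) k 𝒱.vac = 0 from
        h𝒱.creation_regular u k (by push_cast at hk; omega), map_zero])]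
  have h := h𝒱.creation v
  rw [mode] at h
  simp [Finset.sum_range_succ, signedChoose_one_right, h, mode, sub_eq_add_neg]

lemma IsVertexAlgebra.translation_vac {𝒱 : VertexData V} (h𝒱 : 𝒱.IsVertexAlgebra) :
    𝒱.translation 𝒱.vac = 0 := by
  change 𝒱.mode 𝒱.vac (-2) 𝒱.vac = 0
  rw [h𝒱.vacuum, if_neg (by decide)]

/-- Compatibility with the vertex operators is inherited by modes. -/
lemma IsVertexAlgebra.map_mode_mode {𝒱 : VertexData V} {𝒲 : VertexData W}
    (h𝒱 : 𝒱.IsVertexAlgebra) (h𝒲 : 𝒲.IsVertexAlgebra) (f : V →ₗ[ℂ] W) {u v : V}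
    (hu : ∀ n w, f (𝒱.mode u n w) = 𝒲.mode (f u) n (f w))
    (hv : ∀ n w, f (𝒱.mode v n w) = 𝒲.mode (f v) n (f w)) (l n : ℤ) (w : V) :
    f (𝒱.mode (𝒱.mode u l v) n w) = 𝒲.mode (f (𝒱.mode u l v)) n (f w) := by
  rw [hu, h𝒱.mode_mode, h𝒲.mode_mode, borcherdsProd, borcherdsProd, map_sub, Units.smul_def,
    map_zsmul, orderedProd, orderedProd, map_expand (isTruncated_comp _ _ w),
    map_expand (isTruncated_comp _ _ w)]
  have hu' (n w) : f (ncoeff (𝒱.Y u) n w) = ncoeff (𝒲.Y (f u)) n (f w) := hu n w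
  have hv' (n w) : f (ncoeff (𝒱.Y v) n w) = ncoeff (𝒲.Y (f v)) n (f w) := hv n w
  simp only [hu', hv']
  rfl

/-! ### Tensor products -/

lemma tensor_mode_tmul (𝒱 : VertexData V) (𝒲 : VertexData W) (u v : V) (a b : W) (n : ℤ) :
    (𝒱.tensor 𝒲).mode (u ⊗ₜ a) n (v ⊗ₜ b) =
      ∑ᶠ j : ℤ, 𝒱.mode u j v ⊗ₜ[ℂ] 𝒲.mode a (n - 1 - j) b := by
  have h : (𝒱.tensor 𝒲).mode (u ⊗ₜ a) n (v ⊗ₜ b) =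
      ∑ᶠ i : ℤ, lcoeff (𝒱.Y u v) i ⊗ₜ[ℂ] lcoeff (𝒲.Y a b) (-n - 1 - i) := rfl
  -- The substitution `i = -1 - j` passes from exponents of `x` to mode indices.
  rw [h, ← finsum_comp_equiv (Equiv.subLeft (-1 : ℤ))]
  refine finsum_congr fun j => ?_
  simp only [Equiv.subLeft_apply]
  change _ = lcoeff (𝒱.Y u v) (-j - 1) ⊗ₜ[ℂ] lcoeff (𝒲.Y a b) (-(n - 1 - j) - 1)
  congr 2 <;> ring

/-- The vertex operator `A(x) ⊗ 1`. -/
def opRTensor (W : Type*) [AddCommGroup W] [Module ℂ W] (A : VertexOperator ℂ V) :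
    VertexOperator ℂ (V ⊗[ℂ] W) :=
  ofModes (fun n => (ncoeff A n).rTensor W) fun x => by
    induction x using TensorProduct.induction_on with
    | zero => exact ⟨0, fun n _ => map_zero _⟩
    | tmul v w =>
      obtain ⟨N, hN⟩ := exists_ncoeff_eq_zero A v
      exact ⟨N, fun n hn => by rw [LinearMap.rTensor_tmul, hN n hn, TensorProduct.zero_tmul]⟩
    | add x y hx hy =>
      obtain ⟨N, hN⟩ := hx
      obtain ⟨M, hM⟩ := hy
      exact ⟨max N M, fun n hn => by
        rw [map_add, hN n (le_trans (le_max_left _ _) hn), hM n (le_trans (le_max_right _ _) hn),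
          add_zero]⟩

/-- The vertex operator `1 ⊗ A(x)`. -/
def opLTensor (V : Type*) [AddCommGroup V] [Module ℂ V] (A : VertexOperator ℂ W) :
    VertexOperator ℂ (V ⊗[ℂ] W) :=
  ofModes (fun n => (ncoeff A n).lTensor V) fun x => by
    induction x using TensorProduct.induction_on with
    | zero => exact ⟨0, fun n _ => map_zero _⟩
    | tmul v w =>
      obtain ⟨N, hN⟩ := exists_ncoeff_eq_zero A w
      exact ⟨N, fun n hn => by rw [LinearMap.lTensor_tmul, hN n hn, TensorProduct.tmul_zero]⟩
    | add x y hx hy =>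
      obtain ⟨N, hN⟩ := hx
      obtain ⟨M, hM⟩ := hy
      exact ⟨max N M, fun n hn => by
        rw [map_add, hN n (le_trans (le_max_left _ _) hn), hM n (le_trans (le_max_right _ _) hn),
          add_zero]⟩

@[simp] lemma ncoeff_opRTensor_tmul (A : VertexOperator ℂ V) (n : ℤ) (v : V) (w : W) :
    ncoeff (opRTensor W A) n (v ⊗ₜ w) = ncoeff A n v ⊗ₜ w := by simp [opRTensor]

@[simp] lemma ncoeff_opLTensor_tmul (A : VertexOperator ℂ W) (n : ℤ) (v : V) (w : W) :
    ncoeff (opLTensor V A) n (v ⊗ₜ w) = v ⊗ₜ ncoeff A n w := by simp [opLTensor]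

lemma borcherdsProd_map_add (A B : VertexOperator ℂ V) (l m n : ℤ) (v w : V) :
    borcherdsProd A B l m n (v + w) = borcherdsProd A B l m n v + borcherdsProd A B l m n w := by
  simp only [borcherdsProd, orderedProd_map_add, smul_add]
  abel

lemma borcherdsProd_map_zero (A B : VertexOperator ℂ V) (l m n : ℤ) :
    borcherdsProd A B l m n 0 = 0 := by
  simpa using borcherdsProd_map_add A B l m n 0 0

lemma isLocal_opRTensor {A B : VertexOperator ℂ V} (h : IsLocal A B) :
    IsLocal (opRTensor W A) (opRTensor W B) := by
  obtain ⟨N, hN⟩ := h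
  refine ⟨N, fun m n x => ?_⟩
  induction x using TensorProduct.induction_on with
  | zero => exact borcherdsProd_map_zero _ _ _ _ _
  | add x y hx hy => rw [borcherdsProd_map_add, hx, hy, add_zero]
  | tmul v w =>
    have key (A B : VertexOperator ℂ V) (m n : ℤ) :
        orderedProd (opRTensor W A) (opRTensor W B) N m n (v ⊗ₜ w) =
          orderedProd A B N m n v ⊗ₜ[ℂ] w := by
      have h := map_expand (isTruncated_comp A B v) ((TensorProduct.mk ℂ V W).flip w) N m n
      simp only [LinearMap.flip_apply, TensorProduct.mk_apply] at h
      simp [orderedProd, h]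
    rw [borcherdsProd, key, key, Units.smul_def, TensorProduct.smul_tmul', ← Units.smul_def,
      ← TensorProduct.sub_tmul]
    exact (congrArg (· ⊗ₜ[ℂ] w) (hN m n v)).trans (TensorProduct.zero_tmul V w)

lemma isLocal_opLTensor {A B : VertexOperator ℂ W} (h : IsLocal A B) :
    IsLocal (opLTensor V A) (opLTensor V B) := by
  obtain ⟨N, hN⟩ := h
  refine ⟨N, fun m n x => ?_⟩
  induction x using TensorProduct.induction_on with
  | zero => exact borcherdsProd_map_zero _ _ _ _ _
  | add x y hx hy => rw [borcherdsProd_map_add, hx, hy, add_zero]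
  | tmul v w =>
    have key (A B : VertexOperator ℂ W) (m n : ℤ) :
        orderedProd (opLTensor V A) (opLTensor V B) N m n (v ⊗ₜ w) =
          v ⊗ₜ[ℂ] orderedProd A B N m n w := by
      have h := map_expand (isTruncated_comp A B w) (TensorProduct.mk ℂ V W v) N m n
      simp only [TensorProduct.mk_apply] at h
      simp [orderedProd, h]
    rw [borcherdsProd, key, key, Units.smul_def, ← TensorProduct.tmul_smul, ← Units.smul_def,
      ← TensorProduct.tmul_sub]
    exact (congrArg (v ⊗ₜ[ℂ] ·) (hN m n w)).trans (TensorProduct.tmul_zero W v)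

lemma isLocal_opRTensor_opLTensor (A : VertexOperator ℂ V) (B : VertexOperator ℂ W) :
    IsLocal (opRTensor W A) (opLTensor V B) :=
  .of_commute fun m n x => by
    induction x using TensorProduct.induction_on with
    | zero => simp
    | add x y hx hy => simp only [map_add, hx, hy]
    | tmul v w => simp

/-- The tensor product of two vertex algebras is a vertex algebra. -/
theorem IsVertexAlgebra.tensor {𝒱 : VertexData V} {𝒲 : VertexData W} (h𝒱 : 𝒱.IsVertexAlgebra)
    (h𝒲 : 𝒲.IsVertexAlgebra) : (𝒱.tensor 𝒲).IsVertexAlgebra := by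
  let S : Set (VertexOperator ℂ (V ⊗[ℂ] W)) :=
    Set.range (fun v => opRTensor W (𝒱.Y v)) ∪ Set.range (fun w => opLTensor V (𝒲.Y w))
  let T : Module.End ℂ (V ⊗[ℂ] W) := 𝒱.translation.rTensor W + 𝒲.translation.lTensor V
  have hT (v : V) (w : W) : T (v ⊗ₜ w) = 𝒱.translation v ⊗ₜ w + v ⊗ₜ 𝒲.translation w := rfl
  obtain ⟨𝒰, h𝒰, hvac, hY⟩ := exists_isVertexAlgebra (𝒱.vac ⊗ₜ[ℂ] 𝒲.vac) T
    (by rw [hT, h𝒱.translation_vac, h𝒲.translation_vac]; simp) S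
    (by
      rintro _ (⟨u, rfl⟩ | ⟨a, rfl⟩) _ (⟨v, rfl⟩ | ⟨b, rfl⟩)
      · exact isLocal_opRTensor (h𝒱.isLocal u v)
      · exact isLocal_opRTensor_opLTensor _ _
      · exact (isLocal_opRTensor_opLTensor _ _).symm
      · exact isLocal_opLTensor (h𝒲.isLocal a b))
    (by
      rintro _ (⟨u, rfl⟩ | ⟨a, rfl⟩) n x
      · induction x using TensorProduct.induction_on with
        | zero => simp
        | add x y hx hy => simp only [map_add, hx, hy, smul_add]; abel
        | tmul v w =>
          simp only [ncoeff_opRTensor_tmul, hT, h𝒱.isCovariant u n v, map_add,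
            TensorProduct.sub_tmul, TensorProduct.smul_tmul']
          abel
      · induction x using TensorProduct.induction_on with
        | zero => simp
        | add x y hx hy => simp only [map_add, hx, hy, smul_add]; abel
        | tmul v w =>
          simp only [ncoeff_opLTensor_tmul, hT, h𝒲.isCovariant a n w, map_add,
            TensorProduct.tmul_sub, TensorProduct.tmul_smul]
          abel)
    (by
      rintro _ (⟨u, rfl⟩ | ⟨a, rfl⟩) n hn
      · have h : ncoeff (𝒱.Y u) n 𝒱.vac = 0 := h𝒱.creation_regular u n hn
        simp [h]
      · have h : ncoeff (𝒲.Y a) n 𝒲.vac = 0 := h𝒲.creation_regular a n hn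
        simp [h])
    (by
      intro p hp h
      rw [eq_top_iff, ← TensorProduct.span_tmul_eq_top, Submodule.span_le]
      rintro _ ⟨v, w, rfl⟩
      have h1 := h _ (Or.inl ⟨v, rfl⟩) (-1) _ (h _ (Or.inr ⟨w, rfl⟩) (-1) _ hp)
      simp only [ncoeff_opRTensor_tmul, ncoeff_opLTensor_tmul] at h1
      rwa [show ncoeff (𝒱.Y v) (-1) 𝒱.vac = v from h𝒱.creation v,
        show ncoeff (𝒲.Y w) (-1) 𝒲.vac = w from h𝒲.creation w] at h1)
  have h1 (v : V) : 𝒰.Y (v ⊗ₜ 𝒲.vac) = opRTensor W (𝒱.Y v) := by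
    have h := hY _ (Or.inl ⟨v, rfl⟩)
    simp only [ncoeff_opRTensor_tmul] at h
    rwa [show ncoeff (𝒱.Y v) (-1) 𝒱.vac = v from h𝒱.creation v] at h
  have h2 (w : W) : 𝒰.Y (𝒱.vac ⊗ₜ w) = opLTensor V (𝒲.Y w) := by
    have h := hY _ (Or.inr ⟨w, rfl⟩)
    simp only [ncoeff_opLTensor_tmul] at h
    rwa [show ncoeff (𝒲.Y w) (-1) 𝒲.vac = w from h𝒲.creation w] at h
  have h3 (v : V) (w : W) : 𝒰.mode (v ⊗ₜ 𝒲.vac) (-1) (𝒱.vac ⊗ₜ w) = v ⊗ₜ w := by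
    rw [mode, h1, ncoeff_opRTensor_tmul, show ncoeff (𝒱.Y v) (-1) 𝒱.vac = v from h𝒱.creation v]
  -- In the reconstructed `𝒰` the vector `v ⊗ w` is the `(-1)`-st product of `v ⊗ 𝟏` and `𝟏 ⊗ w`.
  -- Its field is therefore the normally ordered product of two commuting fields, and the two halves
  -- of that product add up to the sum in `tensor_mode_tmul`.
  suffices h : 𝒱.tensor 𝒲 = 𝒰 from h ▸ h𝒰
  refine ext_mode (fun x n => ?_) hvac.symm
  induction x using TensorProduct.induction_on with
  | zero => simp
  | add x y hx hy => rw [mode_add_left, mode_add_left, hx, hy]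
  | tmul v w =>
    ext x y
    simp only [TensorProduct.AlgebraTensorModule.curry_apply, LinearMap.restrictScalars_self,
      TensorProduct.curry_apply]
    have hfin : (Function.support fun j : ℤ =>
        𝒱.mode v j x ⊗ₜ[ℂ] 𝒲.mode w (n - 1 - j) y).Finite := by
      obtain ⟨N, hN⟩ := exists_ncoeff_eq_zero (𝒱.Y v) x
      obtain ⟨M, hM⟩ := exists_ncoeff_eq_zero (𝒲.Y w) y
      refine (Set.finite_Icc (n - 1 - M) N).subset fun j hj => ?_
      by_contra h
      rw [Set.mem_Icc, not_and_or] at h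
      apply hj
      rcases h with h | h
      · simp [mode, hM (n - 1 - j) (by omega)]
      · simp [mode, hN j (by omega)]
    rw [tensor_mode_tmul, finsum_int_eq_add hfin, ← h3 v w, h𝒰.mode_mode, h1, h2, borcherdsProd,
      orderedProd, orderedProd, expand, expand]
    simp only [signedChoose_neg_one, one_smul, ncoeff_opRTensor_tmul, ncoeff_opLTensor_tmul,
      Int.negOnePow_neg, Int.negOnePow_one, Units.neg_smul, sub_neg_eq_add]
    rw [add_comm]
    congr 1
    · refine finsum_congr fun i => ?_
      simp only [mode]
      ring_nf
    · refine finsum_congr fun i => ?_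
      simp only [mode]
      ring_nf

/-! ### The Borcherds construction -/

section Borcherds

variable {A : Type*} [CommRing A] [Algebra ℂ A]

lemma borcherds_mode_natCast (d : Derivation ℂ A A) (a b : A) (k : ℕ) :
    (borcherds d).mode a (-1 - k) b = ((k.factorial : ℂ)⁻¹ • (d : A →ₗ[ℂ] A)^[k] a) * b := by
  have h : (borcherds d).mode a (-1 - k) = borcherdsCoeff d a (-(-1 - k) - 1) := rfl
  rw [h, show -(-1 - (k : ℤ)) - 1 = Int.ofNat k by simp]
  rfl

lemma borcherds_mode_of_nonneg (d : Derivation ℂ A A) (a b : A) {n : ℤ} (hn : 0 ≤ n) :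
    (borcherds d).mode a n b = 0 := by
  have h : (borcherds d).mode a n = borcherdsCoeff d a (-n - 1) := rfl
  obtain ⟨k, hk⟩ := Int.eq_negSucc_of_lt_zero (show -n - 1 < 0 by omega)
  rw [h, hk]
  rfl

lemma borcherds_mode_mul (d : Derivation ℂ A A) (a b c : A) (n : ℤ) :
    (borcherds d).mode a n (b * c) = (borcherds d).mode a n b * c := by
  rcases le_or_gt 0 n with h | h
  · simp [borcherds_mode_of_nonneg d a _ h]
  · obtain ⟨k, rfl⟩ : ∃ k : ℕ, n = -1 - k := ⟨(-1 - n).toNat, by omega⟩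
    rw [borcherds_mode_natCast, borcherds_mode_natCast, mul_assoc]

theorem borcherds_isCommutative (d : Derivation ℂ A A) : (borcherds d).IsCommutative := by
  intro a b m n
  ext c
  simp only [Module.End.mul_apply]
  have h (a c : A) (n : ℤ) : (borcherds d).mode a n c = (borcherds d).mode a n 1 * c := by
    rw [← borcherds_mode_mul, one_mul]
  rw [h a (_ : A), h b c, h b ((borcherds d).mode a m c), h a c, mul_left_comm]

/-- Reconstruction from all the fields at once. They commute, hence are local; the Leibniz rule is
covariance for `T = ∂`; and `a_{-1} 1 = a` identifies the reconstructed fields with the given ones.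
-/
theorem borcherds_isVertexAlgebra (d : Derivation ℂ A A) : (borcherds d).IsVertexAlgebra := by
  have hcr (a : A) : ncoeff ((borcherds d).Y a) (-1) 1 = a := by
    have h := borcherds_mode_natCast d a 1 0
    rwa [Nat.cast_zero, sub_zero, Nat.factorial_zero, Nat.cast_one, inv_one, one_smul, mul_one,
      Function.iterate_zero_apply] at h
  obtain ⟨𝒰, h𝒰, hvac, hY⟩ := exists_isVertexAlgebra (1 : A) (d : A →ₗ[ℂ] A)
    (by simp) (Set.range (borcherds d).Y)
    (by
      rintro _ ⟨a, rfl⟩ _ ⟨b, rfl⟩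
      exact .of_commute fun m n w => congr($(borcherds_isCommutative d a b m n) w))
    (by
      rintro _ ⟨a, rfl⟩ n b
      change d ((borcherds d).mode a n b) =
        (borcherds d).mode a n (d b) - n • (borcherds d).mode a (n - 1) b
      rcases le_or_gt 0 n with h | h
      · rw [borcherds_mode_of_nonneg d a _ h, borcherds_mode_of_nonneg d a _ h]
        rcases eq_or_lt_of_le h with rfl | h
        · simp
        · rw [borcherds_mode_of_nonneg d a _ (show 0 ≤ n - 1 by omega)]
          simp
      · obtain ⟨k, rfl⟩ : ∃ k : ℕ, n = -1 - k := ⟨(-1 - n).toNat, by omega⟩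
        rw [borcherds_mode_natCast, borcherds_mode_natCast,
          show (-1 - k - 1 : ℤ) = -1 - (k + 1 : ℕ) by push_cast; ring, borcherds_mode_natCast,
          Derivation.leibniz, Derivation.map_smul, Function.iterate_succ_apply',
          ← Int.cast_smul_eq_zsmul ℂ, smul_mul_assoc, smul_mul_assoc, smul_smul]
        have h1 : ((-1 - k : ℤ) : ℂ) * (((k + 1).factorial : ℂ))⁻¹ = -((k.factorial : ℂ))⁻¹ := by
          have h2 : (k.factorial : ℂ) ≠ 0 := by exact_mod_cast k.factorial_ne_zero
          have h3 : (k + 1 : ℂ) ≠ 0 := by exact_mod_cast k.succ_ne_zero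
          rw [Nat.factorial_succ]
          push_cast
          field_simp
          ring
        rw [h1]
        simp only [smul_eq_mul, neg_smul, sub_neg_eq_add, smul_mul_assoc, mul_smul_comm]
        rw [mul_comm b]
        rfl)
    (by
      rintro _ ⟨a, rfl⟩ n hn
      exact borcherds_mode_of_nonneg d a 1 hn)
    (by
      intro p hp h
      rw [eq_top_iff]
      intro a _
      have := h _ ⟨a, rfl⟩ (-1) 1 hp
      rwa [hcr] at this)
  suffices h : borcherds d = 𝒰 from h ▸ h𝒰
  refine ext_mode (fun a n => ?_) hvac.symm
  have h := hY _ ⟨a, rfl⟩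
  rw [hcr] at h
  rw [mode, mode, h]

end Borcherds

end VertexData

namespace VertexData

open VertexOperator

/-! ### Functoriality of the Borcherds construction -/

section Borcherds

variable {A A' : Type*} [CommRing A] [Algebra ℂ A] [CommRing A'] [Algebra ℂ A']

/-- An algebra map that intertwines the derivations intertwines `e^{x∂}`. -/
lemma borcherds_isHom {d : Derivation ℂ A A} {d' : Derivation ℂ A' A'} (f : A →ₐ[ℂ] A')
    (h : ∀ a, f (d a) = d' (f a)) : IsHom (borcherds d) (borcherds d') f.toLinearMap where
  map_vac := map_one f
  map_mode a b n := by
    rcases le_or_gt 0 n with hn | hn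
    · rw [borcherds_mode_of_nonneg d a b hn, borcherds_mode_of_nonneg d' _ _ hn, map_zero]
    · obtain ⟨k, rfl⟩ : ∃ k : ℕ, n = -1 - k := ⟨(-1 - n).toNat, by omega⟩
      have hk : f ((d : A →ₗ[ℂ] A)^[k] a) = (d' : A' →ₗ[ℂ] A')^[k] (f a) :=
        (Function.Semiconj.iterate_right (f := f) h k) a
      rw [borcherds_mode_natCast, borcherds_mode_natCast, AlgHom.toLinearMap_apply,
        AlgHom.toLinearMap_apply, AlgHom.toLinearMap_apply, map_mul, map_smul, hk]

/-- The derivation `d ⊗ 1 + 1 ⊗ d'` of `A ⊗ A'`. -/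
def tensorDeriv (d : Derivation ℂ A A) (d' : Derivation ℂ A' A') :
    Derivation ℂ (A ⊗[ℂ] A') (A ⊗[ℂ] A') :=
  Derivation.mk' ((d : A →ₗ[ℂ] A).rTensor A' + (d' : A' →ₗ[ℂ] A').lTensor A) fun x y => by
    induction x using TensorProduct.induction_on with
    | zero => simp
    | add x x' hx hx' => simp only [add_mul, map_add, hx, hx', smul_eq_mul, mul_add]; ring
    | tmul a a' =>
      induction y using TensorProduct.induction_on with
      | zero => simp
      | add y y' hy hy' => simp only [add_mul, map_add, hy, hy', smul_eq_mul, mul_add]; ring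
      | tmul b b' =>
        simp only [LinearMap.add_apply, Algebra.TensorProduct.tmul_mul_tmul,
          LinearMap.rTensor_tmul, LinearMap.lTensor_tmul, Derivation.coeFn_coe,
          Derivation.leibniz, smul_eq_mul, mul_add, TensorProduct.add_tmul,
          TensorProduct.tmul_add]
        rw [mul_comm b a, mul_comm b, mul_comm b' a', mul_comm b']
        abel

lemma tensorDeriv_tmul (d : Derivation ℂ A A) (d' : Derivation ℂ A' A') (a : A) (b : A') :
    tensorDeriv d d' (a ⊗ₜ b) = d a ⊗ₜ b + a ⊗ₜ d' b := rfl

/-- The coefficient of `x^k` in `e^{x(d ⊗ 1 + 1 ⊗ d')} = e^{xd} ⊗ e^{xd'}`, valid because the two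
summands commute. -/
lemma tensorDeriv_iterate_tmul (d : Derivation ℂ A A) (d' : Derivation ℂ A' A') (a : A) (b : A')
    (k : ℕ) :
    ((k.factorial : ℂ)⁻¹ • (tensorDeriv d d' : A ⊗[ℂ] A' →ₗ[ℂ] A ⊗[ℂ] A')^[k] (a ⊗ₜ b)) =
      ∑ i ∈ Finset.range (k + 1), ((i.factorial : ℂ)⁻¹ • (d : A →ₗ[ℂ] A)^[i] a) ⊗ₜ[ℂ]
        (((k - i).factorial : ℂ)⁻¹ • (d' : A' →ₗ[ℂ] A')^[k - i] b) := by
  have hc : Commute ((d : A →ₗ[ℂ] A).rTensor A' : Module.End ℂ (A ⊗[ℂ] A'))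
      ((d' : A' →ₗ[ℂ] A').lTensor A) := by
    ext x y
    rfl
  have hr (i : ℕ) (x : A) (y : A') :
      (((d : A →ₗ[ℂ] A).rTensor A' : Module.End ℂ (A ⊗[ℂ] A')) ^ i) (x ⊗ₜ y) =
        ((d : A →ₗ[ℂ] A)^[i] x) ⊗ₜ y := by
    induction i with
    | zero => rfl
    | succ i ih => rw [pow_succ', Module.End.mul_apply, ih, Function.iterate_succ_apply']; rfl
  have hl (i : ℕ) (x : A) (y : A') :
      (((d' : A' →ₗ[ℂ] A').lTensor A : Module.End ℂ (A ⊗[ℂ] A')) ^ i) (x ⊗ₜ y) =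
        x ⊗ₜ ((d' : A' →ₗ[ℂ] A')^[i] y) := by
    induction i with
    | zero => rfl
    | succ i ih => rw [pow_succ', Module.End.mul_apply, ih, Function.iterate_succ_apply']; rfl
  rw [← Module.End.pow_apply]
  change (k.factorial : ℂ)⁻¹ • (((d : A →ₗ[ℂ] A).rTensor A' + (d' : A' →ₗ[ℂ] A').lTensor A :
    Module.End ℂ (A ⊗[ℂ] A')) ^ k) (a ⊗ₜ b) = _
  rw [hc.add_pow, LinearMap.sum_apply, Finset.smul_sum]
  refine Finset.sum_congr rfl fun i hi => ?_
  have hi' : i ≤ k := Nat.lt_succ_iff.mp (Finset.mem_range.mp hi)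
  rw [← nsmul_eq_mul', LinearMap.smul_apply, Module.End.mul_apply, hl, hr,
    TensorProduct.smul_tmul_smul, ← Nat.cast_smul_eq_nsmul ℂ, smul_smul]
  congr 1
  rw [Nat.choose_eq_factorial_div_factorial hi',
    Nat.cast_div (Nat.factorial_mul_factorial_dvd_factorial hi')]
  · have h1 : (k.factorial : ℂ) ≠ 0 := by exact_mod_cast k.factorial_ne_zero
    have h2 : (i.factorial : ℂ) ≠ 0 := by exact_mod_cast i.factorial_ne_zero
    have h3 : ((k - i).factorial : ℂ) ≠ 0 := by exact_mod_cast (k - i).factorial_ne_zero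
    push_cast
    field_simp
  · exact_mod_cast mul_ne_zero i.factorial_ne_zero (k - i).factorial_ne_zero

/-- The tensor product of two commutative vertex algebras. -/
lemma borcherds_tensor (d : Derivation ℂ A A) (d' : Derivation ℂ A' A') :
    (borcherds d).tensor (borcherds d') = borcherds (tensorDeriv d d') := by
  refine ext_mode (fun x n => ?_) rfl
  induction x using TensorProduct.induction_on with
  | zero => simp
  | add x y hx hy => rw [mode_add_left, mode_add_left, hx, hy]
  | tmul a a' =>
    ext b b'
    simp only [TensorProduct.AlgebraTensorModule.curry_apply, LinearMap.restrictScalars_self,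
      TensorProduct.curry_apply, tensor_mode_tmul]
    rcases le_or_gt 0 n with hn | hn
    · rw [borcherds_mode_of_nonneg _ _ _ hn]
      refine finsum_eq_zero_of_forall_eq_zero fun j => ?_
      rcases le_or_gt 0 j with hj | hj
      · rw [borcherds_mode_of_nonneg _ _ _ hj, TensorProduct.zero_tmul]
      · rw [borcherds_mode_of_nonneg _ _ _ (show 0 ≤ n - 1 - j by omega), TensorProduct.tmul_zero]
    · obtain ⟨k, rfl⟩ : ∃ k : ℕ, n = -1 - k := ⟨(-1 - n).toNat, by omega⟩
      rw [borcherds_mode_natCast, tensorDeriv_iterate_tmul, Finset.sum_mul,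
        -- After `j = -1 - i` only `0 ≤ i ≤ k` contributes: outside this range one of the two
        -- factors has a nonnegative mode index.
        ← finsum_comp_equiv (Equiv.subLeft (-1 : ℤ)), finsum_int_eq_add,
        finsum_eq_sum_of_support_subset
          (s := Finset.range (k + 1))]
      · rw [finsum_eq_zero_of_forall_eq_zero, add_zero]
        · refine Finset.sum_congr rfl fun i hi => ?_
          have hi' : i ≤ k := Nat.lt_succ_iff.mp (Finset.mem_range.mp hi)
          simp only [Equiv.subLeft_apply]
          rw [borcherds_mode_natCast,
            show (-1 - k - 1 - (-1 - i) : ℤ) = -1 - ((k - i : ℕ) : ℤ) by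
              push_cast [Nat.cast_sub hi']; ring, borcherds_mode_natCast,
            Algebra.TensorProduct.tmul_mul_tmul]
        · intro i
          simp only [Equiv.subLeft_apply]
          rw [borcherds_mode_of_nonneg _ _ _ (by omega), TensorProduct.zero_tmul]
      · intro i hi
        by_contra h
        simp only [Finset.coe_range, Set.mem_Iio, not_lt] at h
        apply hi
        simp only [Equiv.subLeft_apply]
        rw [borcherds_mode_of_nonneg _ a' _ (by omega), TensorProduct.tmul_zero]
      · refine (Set.finite_Icc (0 : ℤ) k).subset fun i hi => ?_
        by_contra h
        rw [Set.mem_Icc, not_and_or] at h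
        apply hi
        simp only [Equiv.subLeft_apply]
        rcases h with h | h
        · rw [borcherds_mode_of_nonneg _ a _ (by omega), TensorProduct.zero_tmul]
        · rw [borcherds_mode_of_nonneg _ a' _ (by omega), TensorProduct.tmul_zero]

end Borcherds

end VertexData

namespace LatticeVA

open VertexData

variable {L : Type*} [AddCommGroup L]

/-! ### The vertex bialgebra `B_L` -/

/-- Induction on elements of `S(𝔥̂⁻)` by multiplication by the `h(-n-1)`. -/
lemma fock_induction {p : Fock L → Prop} (zero : p 0) (one : p 1)
    (add : ∀ u v, p u → p v → p (u + v)) (smul : ∀ (c : ℂ) u, p u → p (c • u))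
    (neg_mul : ∀ (h : Cartan L) (n : ℕ) u, p u → p (neg h n * u)) (u : Fock L) : p u := by
  have ι_mul (x : HeisMinus L) (v : Fock L) (hv : p v) :
      p (SymmetricAlgebra.ι ℂ (HeisMinus L) x * v) := by
    induction x using Finsupp.induction_linear with
    | zero => simpa using zero
    | add x y hx hy => rw [map_add, add_mul]; exact add _ _ hx hy
    | single n h => exact neg_mul h n v hv
  suffices h : ∀ v, p v → p (u * v) by simpa using h 1 one
  induction u using SymmetricAlgebra.induction with
  | algebraMap c => intro v hv; rw [← Algebra.smul_def]; exact smul c v hv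
  | ι x => exact ι_mul x
  | mul a b ha hb => intro v hv; rw [mul_assoc]; exact ha _ (hb v hv)
  | add a b ha hb => intro v hv; rw [add_mul]; exact add _ _ (ha v hv) (hb v hv)

lemma fockDeriv_neg (h : Cartan L) (n : ℕ) :
    fockDeriv (neg h n) = ((n : ℂ) + 1) • neg h (n + 1) := by
  rw [fockDeriv, neg, symDeriv_ι]
  simp [neg, ← map_smul]

lemma neg_zero_left (n : ℕ) : neg (0 : Cartan L) n = 0 := by simp [neg]

lemma bDeriv_tmul_single (u : Fock L) (α : L) (c : ℂ) :
    bDeriv (u ⊗ₜ[ℂ] AddMonoidAlgebra.single α c) =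
      (neg (toCartan α) 0 * u + fockDeriv u) ⊗ₜ[ℂ] AddMonoidAlgebra.single α c :=
  bDerivLin_single u α c

lemma bDeriv_neg (h : Cartan L) (n : ℕ) :
    bDeriv (neg h n ⊗ₜ[ℂ] (1 : AddMonoidAlgebra ℂ L)) =
      ((n : ℂ) + 1) • (neg h (n + 1) ⊗ₜ[ℂ] (1 : AddMonoidAlgebra ℂ L)) := by
  rw [AddMonoidAlgebra.one_def, bDeriv_tmul_single, fockDeriv_neg, toCartan,
    TensorProduct.tmul_zero, neg_zero_left, zero_mul, zero_add, TensorProduct.smul_tmul']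

lemma bDeriv_eB (α : L) :
    bDeriv (eB α) = (neg (toCartan α) 0 ⊗ₜ[ℂ] (1 : AddMonoidAlgebra ℂ L)) * eB α := by
  rw [eB, bDeriv_tmul_single, Algebra.TensorProduct.tmul_mul_tmul]
  simp [fockDeriv]

/-- Induction on elements of `B_L` by multiplication by the `h(-n-1)`. -/
lemma bSpace_induction {p : BSpace L → Prop} (zero : p 0) (eB : ∀ α, p (eB α))
    (add : ∀ u v, p u → p v → p (u + v)) (smul : ∀ (c : ℂ) u, p u → p (c • u))
    (neg_mul : ∀ (h : Cartan L) (n : ℕ) x, p x → p ((neg h n ⊗ₜ[ℂ] 1) * x)) (x : BSpace L) :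
    p x := by
  induction x using TensorProduct.induction_on with
  | zero => exact zero
  | add x y hx hy => exact add x y hx hy
  | tmul u f =>
    induction f using AddMonoidAlgebra.induction_linear with
    | zero => simpa using zero
    | add f g hf hg => rw [TensorProduct.tmul_add]; exact add _ _ hf hg
    | single α c =>
      induction u using fock_induction with
      | zero => simpa using zero
      | one =>
        have h := smul c _ (eB α)
        rwa [LatticeVA.eB, ← TensorProduct.tmul_smul, AddMonoidAlgebra.smul_single, smul_eq_mul,
          mul_one] at h
      | add u v hu hv => rw [TensorProduct.add_tmul]; exact add _ _ hu hv
      | smul a u hu => rw [← TensorProduct.smul_tmul']; exact smul _ _ hu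
      | neg_mul h n u hu =>
        have h := neg_mul h n _ hu
        rwa [Algebra.TensorProduct.tmul_mul_tmul, one_mul] at h

lemma comul_neg (h : Cartan L) (n : ℕ) :
    Coalgebra.comul (R := ℂ) (neg h n ⊗ₜ[ℂ] (1 : AddMonoidAlgebra ℂ L)) =
      (neg h n ⊗ₜ[ℂ] (1 : AddMonoidAlgebra ℂ L)) ⊗ₜ[ℂ] (1 : BSpace L) +
        (1 : BSpace L) ⊗ₜ[ℂ] (neg h n ⊗ₜ[ℂ] (1 : AddMonoidAlgebra ℂ L)) := by
  rw [TensorProduct.comul_tmul, neg, SymmetricAlgebra.comul_ι, Bialgebra.comul_one,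
    Algebra.TensorProduct.one_def, TensorProduct.add_tmul, map_add]
  rfl

lemma comul_eB (α : L) : Coalgebra.comul (R := ℂ) (eB α) = eB α ⊗ₜ[ℂ] eB α := by
  rw [eB, TensorProduct.comul_tmul, Bialgebra.comul_one, AddMonoidAlgebra.comul_single,
    Algebra.TensorProduct.one_def, CommSemiring.comul_apply, TensorProduct.map_tmul]
  rfl

lemma counit_neg (h : Cartan L) (n : ℕ) :
    Coalgebra.counit (R := ℂ) (neg h n ⊗ₜ[ℂ] (1 : AddMonoidAlgebra ℂ L)) = 0 := by
  rw [TensorProduct.counit_tmul, neg, SymmetricAlgebra.counit_ι, smul_zero]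

/-- By the Leibniz rule it is enough to look at generators: the `h(-n)` are primitive, and `∂e^α =
α(-1)e^α` with `e^α` group-like. With `borcherds_isHom` this makes the comultiplication a
homomorphism of vertex algebras. -/
lemma comul_bDeriv (x : BSpace L) :
    Coalgebra.comul (R := ℂ) (bDeriv x) = tensorDeriv bDeriv bDeriv (Coalgebra.comul x) := by
  induction x using bSpace_induction with
  | zero => simp
  | eB α =>
    rw [bDeriv_eB, Bialgebra.comul_mul, comul_neg, comul_eB, tensorDeriv_tmul, bDeriv_eB,
      add_mul, Algebra.TensorProduct.tmul_mul_tmul, Algebra.TensorProduct.tmul_mul_tmul, one_mul]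
  | add x y hx hy => simp only [map_add, hx, hy]
  | smul c x hx => simp only [Derivation.map_smul, map_smul, hx]
  | neg_mul h n x hx =>
    simp only [Derivation.leibniz, Bialgebra.comul_mul, map_add, smul_eq_mul, hx, bDeriv_neg,
      map_smul, comul_neg, tensorDeriv_tmul, Derivation.map_one_eq_zero,
      TensorProduct.tmul_zero, TensorProduct.zero_tmul, add_zero, zero_add,
      TensorProduct.tmul_smul, ← TensorProduct.smul_tmul', smul_add]

lemma counit_bDeriv (x : BSpace L) : Coalgebra.counit (R := ℂ) (bDeriv x) = 0 := by
  induction x using bSpace_induction with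
  | zero => simp
  | eB α => rw [bDeriv_eB, Bialgebra.counit_mul, counit_neg, zero_mul]
  | add x y hx hy => simp only [map_add, hx, hy, add_zero]
  | smul c x hx => simp only [Derivation.map_smul, map_smul, hx, smul_zero]
  | neg_mul h n x hx =>
    simp only [Derivation.leibniz, Bialgebra.counit_mul, map_add, smul_eq_mul, hx, bDeriv_neg,
      map_smul, counit_neg, mul_zero, add_zero]

theorem vertexB_isVertexBialgebra : (vertexB L).IsVertexBialgebra where
  isVertexAlgebra := borcherds_isVertexAlgebra (bDeriv (L := L))
  comul_isHom := by
    unfold vertexB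
    rw [borcherds_tensor]
    exact borcherds_isHom (A := BSpace L) (A' := BSpace L ⊗[ℂ] BSpace L)
      (Bialgebra.comulAlgHom ℂ (BSpace L)) (comul_bDeriv (L := L))
  counit_isHom := borcherds_isHom (A := BSpace L) (Bialgebra.counitAlgHom ℂ (BSpace L))
    (counit_bDeriv (L := L))

end LatticeVA

namespace LatticeVA

/-! ### Exponential sequences -/

section ExpSeq

variable {R : Type*} [Ring R] [Algebra ℂ R]

/-- `E` is the sequence of coefficients of `exp(∑_{k ≥ 0} X k z^{k+1} / (k+1))`, expressed by the
differential equation satisfied by the exponential. -/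
structure IsExpSeq (X : ℕ → R) (E : ℤ → R) : Prop where
  zero : E 0 = 1
  of_neg : ∀ n < 0, E n = 0
  -- Every `K ≥ n` is admissible because terms with `k ≥ n` involve `E` at a negative index.
  -- Recurrences for different `n` can thus be summed over one range.
  recurrence : ∀ (n : ℤ) (K : ℕ), n ≤ K →
    (n : ℂ) • E n = ∑ k ∈ Finset.range K, X k * E (n - 1 - k)

lemma coeff_pow_eq_zero {S : Type*} [Ring S] {F : PowerSeries S}
    (h0 : PowerSeries.coeff 0 F = 0) {j k : ℕ}
    (hk : k < j) : PowerSeries.coeff k (F ^ j) = 0 := by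
  induction j generalizing k with
  | zero => omega
  | succ j ih =>
    rw [pow_succ', PowerSeries.coeff_mul]
    refine Finset.sum_eq_zero fun p hp => ?_
    rw [Finset.HasAntidiagonal.mem_antidiagonal] at hp
    rcases Nat.eq_zero_or_pos p.1 with h | h
    · rw [h, h0, zero_mul]
    · rw [ih (by omega), mul_zero]

/-- The Euler operator `z d/dz`. -/
def euler (F : PowerSeries R) : PowerSeries R :=
  PowerSeries.mk fun n => (n : ℂ) • PowerSeries.coeff n F

lemma euler_mul (F G : PowerSeries R) : euler (F * G) = euler F * G + F * euler G := by
  ext n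
  simp only [euler, PowerSeries.coeff_mk, map_add, PowerSeries.coeff_mul, Finset.smul_sum,
    ← Finset.sum_add_distrib]
  refine Finset.sum_congr rfl fun p hp => ?_
  rw [Finset.HasAntidiagonal.mem_antidiagonal] at hp
  rw [← hp, smul_mul_assoc, mul_smul_comm, ← add_smul]
  push_cast
  rfl

lemma euler_pow_succ {F : PowerSeries R} (hF : Commute F (euler F)) (j : ℕ) :
    euler (F ^ (j + 1)) = ((j : ℂ) + 1) • (euler F * F ^ j) := by
  induction j with
  | zero => simp
  | succ j ih =>
    rw [pow_succ', euler_mul, ih, mul_smul_comm, ← mul_assoc, hF.eq, mul_assoc, ← pow_succ']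
    push_cast
    module

/-- This is `z (exp F)' = z F' exp F`, which holds since the coefficients of `F` commute with each
other. -/
lemma isExpSeq_expSeries {F : PowerSeries R} (h0 : PowerSeries.coeff 0 F = 0)
    (hF : ∀ i j, Commute (PowerSeries.coeff i F) (PowerSeries.coeff j F)) {X : ℕ → R}
    (hX : ∀ k : ℕ, X k = ((k : ℂ) + 1) • PowerSeries.coeff (k + 1) F) :
    IsExpSeq X fun n => if 0 ≤ n then PowerSeries.coeff n.toNat (expSeries F) else 0 := by
  have hF' : Commute F (euler F) := by
    ext n
    rw [PowerSeries.coeff_mul, PowerSeries.coeff_mul, ← Finset.Nat.sum_antidiagonal_swap]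
    refine Finset.sum_congr rfl fun p _ => ?_
    simp only [euler, PowerSeries.coeff_mk, Prod.fst_swap, Prod.snd_swap, mul_smul_comm,
      smul_mul_assoc, (hF p.2 p.1).eq]
  -- `F^j` starts in degree at least `j`, so the exponential sum may be cut off at any bound beyond
  -- `n`. A common bound is needed to compare different coefficients.
  have hext (n N : ℕ) (h : n < N) : PowerSeries.coeff n (expSeries F) =
      ∑ j ∈ Finset.range N, (j.factorial : ℂ)⁻¹ • PowerSeries.coeff n (F ^ j) := by
    rw [expSeries, PowerSeries.coeff_mk]
    refine Finset.sum_subset (Finset.range_mono h) fun j _ hj => ?_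
    rw [coeff_pow_eq_zero h0 (by simpa using hj), smul_zero]
  have hrec (n : ℕ) : ((n : ℂ) + 1) • PowerSeries.coeff (n + 1) (expSeries F) =
      ∑ k ∈ Finset.range (n + 1), X k * PowerSeries.coeff (n - k) (expSeries F) := by
    have h1 (j : ℕ) : ((n : ℂ) + 1) • (((j + 1).factorial : ℂ)⁻¹ •
        PowerSeries.coeff (n + 1) (F ^ (j + 1))) =
        ∑ k ∈ Finset.range (n + 1), X k * ((j.factorial : ℂ)⁻¹ •
          PowerSeries.coeff (n - k) (F ^ j)) := by
      have h2 : ((n : ℂ) + 1) • PowerSeries.coeff (n + 1) (F ^ (j + 1)) =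
          ((j : ℂ) + 1) • ∑ k ∈ Finset.range (n + 1),
            X k * PowerSeries.coeff (n - k) (F ^ j) := by
        have h := congrArg (PowerSeries.coeff (n + 1)) (euler_pow_succ hF' j)
        rw [euler, PowerSeries.coeff_mk, Nat.cast_succ, PowerSeries.coeff_smul,
          PowerSeries.coeff_mul, Finset.Nat.sum_antidiagonal_succ,
          Finset.Nat.sum_antidiagonal_eq_sum_range_succ_mk] at h
        rw [h]
        simp [euler, hX]
      have h3 : ((j : ℂ) + 1) ≠ 0 := by exact_mod_cast j.succ_ne_zero
      rw [smul_comm, h2, Nat.factorial_succ, smul_smul, Finset.smul_sum]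
      refine Finset.sum_congr rfl fun k _ => ?_
      rw [mul_smul_comm]
      congr 1
      push_cast
      field_simp
    rw [hext (n + 1) (n + 2) (by omega), Finset.sum_range_succ', smul_add, Finset.smul_sum,
      Finset.sum_congr rfl fun j _ => h1 j, Finset.sum_comm]
    simp only [pow_zero, PowerSeries.coeff_one, if_neg (Nat.succ_ne_zero n), smul_zero, add_zero]
    refine Finset.sum_congr rfl fun k hk => ?_
    rw [← Finset.mul_sum, hext (n - k) (n + 1) (by omega)]
  refine ⟨?_, fun n hn => if_neg (by omega), fun n K hK => ?_⟩
  · simp [hext 0 1 one_pos]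
  · rcases le_or_gt n 0 with hn | hn
    · rw [Finset.sum_eq_zero fun k _ => by rw [if_neg (by omega), mul_zero]]
      rcases eq_or_lt_of_le hn with rfl | hn
      · simp
      · rw [if_neg (by omega), smul_zero]
    · obtain ⟨m, rfl⟩ : ∃ m : ℕ, n = m + 1 := ⟨(n - 1).toNat, by omega⟩
      rw [if_pos (by omega), show ((m : ℤ) + 1).toNat = m + 1 by omega]
      push_cast
      rw [hrec]
      refine (Finset.sum_congr rfl fun k hk => ?_).trans
        (Finset.sum_subset (Finset.range_mono (show m + 1 ≤ K by omega)) fun k _ hk => ?_)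
      · have hk' := Finset.mem_range.mp hk
        rw [if_pos (by omega), show ((m : ℤ) + 1 - 1 - k).toNat = m - k by omega]
      · have hk' : ¬ k < m + 1 := fun h => hk (Finset.mem_range.mpr h)
        rw [if_neg (by omega), mul_zero]

namespace IsExpSeq

variable {X : ℕ → R} {E : ℤ → R}

/-- The commutator of `H` with the exponent is the scalar `c z^{j+1}`: the factor `j + 1` cancels
the denominator in the exponent. Hence `[H, E(z)] = c z^{j+1} E(z)`. -/
lemma commutator (hE : IsExpSeq X E) {H : R} {j : ℕ} {c : ℂ}
    (hX : ∀ k, H * X k = X k * H + if k = j then (((j : ℂ) + 1) * c) • 1 else 0) (n : ℤ) :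
    H * E n = E n * H + c • E (n - (j + 1)) := by
  rcases lt_or_ge n 0 with hn | hn
  · rw [hE.of_neg n hn, hE.of_neg _ (by omega)]
    simp
  obtain ⟨n, rfl⟩ := Int.eq_ofNat_of_zero_le hn
  induction n using Nat.strong_induction_on with
  | _ n ih =>
    rcases Nat.eq_zero_or_pos n with rfl | hpos
    · rw [Nat.cast_zero, hE.zero, hE.of_neg _ (by omega)]
      simp
    have ih' (k : ℕ) : H * E (n - 1 - k) = E (n - 1 - k) * H + c • E (n - 1 - k - (j + 1)) := by
      rcases lt_or_ge (n - 1 - k : ℤ) 0 with h | h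
      · rw [hE.of_neg _ h, hE.of_neg _ (by omega)]
        simp
      · obtain ⟨m, hm⟩ := Int.eq_ofNat_of_zero_le h
        rw [hm]
        exact ih m (by omega) (by omega)
    have hn0 : ((n : ℤ) : ℂ) ≠ 0 := by exact_mod_cast hpos.ne'
    refine smul_right_injective R hn0 ?_
    have h1 := hE.recurrence n (n + j + 1) (by push_cast; omega)
    have h2 := hE.recurrence (n - (j + 1)) (n + j + 1) (by push_cast; omega)
    -- After summation the middle terms give `n - (j + 1)` copies of `c E(n - (j + 1))`, and the
    -- term `k = j` supplies the missing `j + 1`.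
    have h3 : ∀ k : ℕ, H * (X k * E (n - 1 - k)) = X k * E (n - 1 - k) * H +
        c • (X k * E (n - (j + 1) - 1 - k)) +
          if k = j then (((j : ℂ) + 1) * c) • E (n - 1 - k) else 0 := by
      intro k
      rw [← mul_assoc, hX, add_mul, mul_assoc, ih', mul_add, mul_smul_comm,
        show (n - 1 - k - (j + 1) : ℤ) = n - (j + 1) - 1 - k by ring]
      split_ifs <;> simp [mul_assoc]
    simp only [smul_add]
    rw [← mul_smul_comm, ← smul_mul_assoc, h1, Finset.mul_sum, Finset.sum_congr rfl fun k _ => h3 k,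
      Finset.sum_add_distrib, Finset.sum_add_distrib, ← Finset.sum_mul, ← Finset.smul_sum, ← h2,
      Finset.sum_ite_eq' , if_pos (by simp), show (n - 1 - j : ℤ) = n - (j + 1) by ring, add_assoc,
      smul_smul, ← add_smul, smul_smul]
    congr 2
    push_cast
    ring

lemma commute (hE : IsExpSeq X E) {H : R} (hX : ∀ k, Commute H (X k)) (n : ℤ) :
    Commute H (E n) := by
  have h := hE.commutator (H := H) (j := 0) (c := 0) (fun k => by simp [(hX k).eq]) n
  simpa [Commute, SemiconjBy] using h

/-- The derivative of the exponential. -/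
lemma derivation (hE : IsExpSeq X E) (hX : ∀ k, Commute (X 0) (X k)) {T : R}
    (hT : ∀ k : ℕ, T * X k = X k * T + ((k : ℂ) + 1) • X (k + 1)) (n : ℤ) :
    T * E n = E n * T - X 0 * E n + ((n : ℂ) + 1) • E (n + 1) := by
  rcases lt_or_ge n 0 with hn | hn
  · rw [hE.of_neg n hn]
    rcases eq_or_ne n (-1) with rfl | h
    · simp
    · rw [hE.of_neg _ (by omega)]
      simp
  obtain ⟨n, rfl⟩ := Int.eq_ofNat_of_zero_le hn
  induction n using Nat.strong_induction_on with
  | _ n ih =>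
    rcases Nat.eq_zero_or_pos n with rfl | hpos
    · have h := hE.recurrence 1 1 (by simp)
      simp only [Int.cast_one, one_smul, Finset.sum_range_one, Nat.cast_zero, sub_self,
        hE.zero, mul_one] at h
      simp [hE.zero, h]
    have ih' (k : ℕ) : T * E (n - 1 - k) =
        E (n - 1 - k) * T - X 0 * E (n - 1 - k) + ((n : ℂ) - k) • E (n - k) := by
      rcases lt_or_ge (n - 1 - k : ℤ) 0 with h | h
      · rw [hE.of_neg _ h]
        rcases eq_or_ne n k with rfl | h
        · simp
        · rw [hE.of_neg _ (by omega)]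
          simp
      · obtain ⟨m, hm⟩ := Int.eq_ofNat_of_zero_le h
        have h1 : (n : ℂ) - k = ((m : ℤ) : ℂ) + 1 := by rw [← hm]; push_cast; ring
        rw [hm, h1, show (n - k : ℤ) = (m : ℤ) + 1 by omega]
        exact ih m (by omega) (by omega)
    have hn0 : ((n : ℤ) : ℂ) ≠ 0 := by exact_mod_cast hpos.ne'
    refine smul_right_injective R hn0 ?_
    have h1 := hE.recurrence n (n + 1) (by push_cast; omega)
    have h2 := hE.recurrence (n + 1) (n + 2) (by push_cast; omega)
    -- The last bracket is `g (k + 1) - g k` with `g k = k X_k E(n - k)`, which vanishes at `k = 0`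
    -- and at `k = n + 1`.
    have h3 : ∀ k : ℕ, T * (X k * E (n - 1 - k)) = X k * E (n - 1 - k) * T -
        X 0 * (X k * E (n - 1 - k)) + ((n : ℂ) • (X k * E (n + 1 - 1 - k)) +
          ((((k + 1 : ℕ) : ℂ) • (X (k + 1) * E (n - (k + 1 : ℕ)))) -
            ((k : ℂ) • (X k * E (n - k))))) := by
      intro k
      rw [← mul_assoc, hT, add_mul, mul_assoc, ih', mul_add, mul_sub, mul_smul_comm,
        show (n + 1 - 1 - k : ℤ) = n - k by ring, smul_mul_assoc, ← mul_assoc (X k) (X 0),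
        ← (hX k).eq, show (n - (k + 1 : ℕ) : ℤ) = n - 1 - k by push_cast; ring]
      push_cast
      simp only [sub_smul, mul_assoc]
      abel
    simp only [smul_add, smul_sub]
    rw [← mul_smul_comm, ← smul_mul_assoc, ← mul_smul_comm, h1, Finset.mul_sum,
      Finset.sum_congr rfl fun k _ => h3 k, Finset.sum_add_distrib, Finset.sum_sub_distrib,
      ← Finset.sum_mul, ← Finset.mul_sum, Finset.sum_add_distrib, ← Finset.smul_sum,
      Finset.sum_range_sub (fun k : ℕ => (k : ℂ) • (X k * E (n - k)))]
    rw [Finset.sum_range_succ, hE.of_neg (n + 1 - 1 - (n + 1 : ℕ)) (by push_cast; omega), mul_zero,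
      add_zero] at h2
    push_cast at h2 ⊢
    rw [← h2, hE.of_neg (n - (n + 1)) (by omega)]
    simp

end IsExpSeq

end ExpSeq

end LatticeVA

namespace LatticeVA

open VertexData VertexOperator

variable {L : Type*} [AddCommGroup L] (B : LinearMap.BilinForm ℤ L)

/-! ### The Heisenberg operators -/

lemma heis_zero_tmul (h : Cartan L) (u : Fock L) (β : L) (c : ℂ) :
    heis B h 0 (u ⊗ₜ[ℂ] Finsupp.single β c) =
      B.baseChange ℂ h (toCartan β) • (u ⊗ₜ[ℂ] Finsupp.single β c) := by
  change u ⊗ₜ[ℂ] (zeroMode B h (Finsupp.single β c)) = _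
  rw [zeroMode, Finsupp.lsum_single, LinearMap.smul_apply, TensorProduct.tmul_smul]
  rfl

lemma heis_pos_tmul (h : Cartan L) (n : ℕ) (u : Fock L) (f : L →₀ ℂ) :
    heis B h (n + 1) (u ⊗ₜ[ℂ] f) = annih B h n u ⊗ₜ[ℂ] f := rfl

lemma heis_neg_tmul (h : Cartan L) (n : ℕ) (u : Fock L) (f : L →₀ ℂ) :
    heis B h (-(n + 1)) (u ⊗ₜ[ℂ] f) = (neg h n * u) ⊗ₜ[ℂ] f := by
  rw [← Int.negSucc_eq]
  rfl

lemma annih_neg (h h' : Cartan L) (n k : ℕ) :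
    annih B h n (neg h' k) =
      algebraMap ℂ (Fock L) (if k = n then ((n : ℂ) + 1) * B.baseChange ℂ h h' else 0) := by
  rw [annih, neg, symDeriv_ι]
  simp only [LinearMap.comp_apply, LinearMap.smul_apply, Finsupp.lapply_apply,
    Finsupp.single_apply, Algebra.linearMap_apply, smul_eq_mul]
  split_ifs <;> simp

lemma annih_neg_mul (h h' : Cartan L) (n k : ℕ) (u : Fock L) :
    annih B h n (neg h' k * u) = neg h' k * annih B h n u +
      (if k = n then ((n : ℂ) + 1) * B.baseChange ℂ h h' else 0) • u := by
  rw [Derivation.leibniz, annih_neg, smul_eq_mul, smul_eq_mul, mul_comm u, Algebra.smul_def]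

lemma annih_comm (h h' : Cartan L) (n k : ℕ) (u : Fock L) :
    annih B h n (annih B h' k u) = annih B h' k (annih B h n u) := by
  induction u using fock_induction with
  | zero => simp
  | one => simp
  | add u v hu hv => simp only [map_add, hu, hv]
  | smul c u hu => simp only [Derivation.map_smul, hu]
  | neg_mul h'' j u hu =>
    simp only [annih_neg_mul, map_add, Derivation.map_smul, hu]
    abel

variable {B}

/-- Vectors of `V_L` are sums of vectors `u ⊗ e_β`. -/
lemma vSpace_induction_tmul {p : VSpace L → Prop} (zero : p 0)
    (add : ∀ v w, p v → p w → p (v + w)) (tmul : ∀ u β, p (u ⊗ₜ[ℂ] Finsupp.single β (1 : ℂ)))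
    (v : VSpace L) : p v := by
  induction v using TensorProduct.induction_on with
  | zero => exact zero
  | add x y hx hy => exact add x y hx hy
  | tmul u f =>
    induction f using Finsupp.induction_linear with
    | zero => simpa using zero
    | add f g hf hg => rw [TensorProduct.tmul_add]; exact add _ _ hf hg
    | single α c =>
      have h := tmul (c • u) α
      rwa [TensorProduct.smul_tmul, Finsupp.smul_single, smul_eq_mul, mul_one] at h

/-- Induction on elements of `V_L`, starting from the `e_α` and using the operators `h(-n-1)`. -/
lemma vSpace_induction {p : VSpace L → Prop} (zero : p 0) (eV : ∀ α, p (eV α))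
    (add : ∀ v w, p v → p w → p (v + w)) (smul : ∀ (c : ℂ) v, p v → p (c • v))
    (heis : ∀ (h : Cartan L) (n : ℕ) v, p v → p (heis B h (-(n + 1)) v)) (v : VSpace L) :
    p v := by
  induction v using vSpace_induction_tmul with
  | zero => exact zero
  | add x y hx hy => exact add x y hx hy
  | tmul u α =>
    induction u using fock_induction with
    | zero => simpa using zero
    | one => exact eV α
    | add u v hu hv => rw [TensorProduct.add_tmul]; exact add _ _ hu hv
    | smul a u hu => rw [← TensorProduct.smul_tmul']; exact smul _ _ hu
    | neg_mul h n u hu =>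
      have h := heis h n _ hu
      rwa [heis_neg_tmul] at h

lemma int_cases (m : ℤ) : (∃ k : ℕ, m = k + 1) ∨ m = 0 ∨ ∃ k : ℕ, m = -(k + 1) := by
  rcases lt_trichotomy m 0 with h | h | h
  · exact Or.inr (Or.inr ⟨(-m - 1).toNat, by omega⟩)
  · exact Or.inr (Or.inl h)
  · exact Or.inl ⟨(m - 1).toNat, by omega⟩

/-- The commutation relations of the Heisenberg algebra. -/
theorem heis_commutator (hsymm : B.IsSymm) (h h' : Cartan L) (m n : ℤ) (v : VSpace L) :
    heis B h m (heis B h' n v) = heis B h' n (heis B h m v) +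
      (if m + n = 0 then (m : ℂ) * B.baseChange ℂ h h' else 0) • v := by
  induction v using vSpace_induction_tmul with
  | zero => simp
  | add v w hv hw => simp only [map_add, hv, hw, smul_add]; abel
  | tmul u β =>
    have hs : B.baseChange ℂ h' h = B.baseChange ℂ h h' := 
      (LinearMap.BilinForm.IsSymm.baseChange ℂ (B₂ := B) ⟨fun x y => hsymm.eq x y⟩).eq h' h
    rcases int_cases m with ⟨j, rfl⟩ | rfl | ⟨j, rfl⟩ <;>
      rcases int_cases n with ⟨k, rfl⟩ | rfl | ⟨k, rfl⟩
    · rw [if_neg (by omega), zero_smul, add_zero]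
      simp only [heis_pos_tmul, annih_comm B h h']
    · rw [if_neg (by omega), zero_smul, add_zero]
      simp only [heis_pos_tmul, heis_zero_tmul, map_smul]
    · simp only [heis_pos_tmul, heis_neg_tmul, annih_neg_mul, TensorProduct.add_tmul,
        ← TensorProduct.smul_tmul']
      congr 2
      by_cases hjk : k = j
      · subst hjk; simp
      · rw [if_neg hjk, if_neg (by omega)]
    · rw [if_neg (by omega), zero_smul, add_zero]
      simp only [heis_pos_tmul, heis_zero_tmul, map_smul]
    · simp only [heis_zero_tmul, map_smul, add_zero, Int.cast_zero, zero_mul, if_true, zero_smul]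
      rw [smul_comm]
    · rw [if_neg (by omega), zero_smul, add_zero]
      simp only [heis_neg_tmul, heis_zero_tmul, map_smul]
    · simp only [heis_pos_tmul, heis_neg_tmul, annih_neg_mul, TensorProduct.add_tmul,
        ← TensorProduct.smul_tmul', hs]
      rw [add_assoc, ← add_smul]
      by_cases hjk : j = k
      · subst hjk
        rw [if_pos rfl, if_pos (by ring)]
        push_cast
        rw [show ((j : ℂ) + 1) * B.baseChange ℂ h h' + -((j : ℂ) + 1) * B.baseChange ℂ h h' = 0 by
          ring, zero_smul, add_zero]
      · rw [if_neg hjk, if_neg (by omega)]; simp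
    · rw [if_neg (by omega), zero_smul, add_zero]
      simp only [heis_neg_tmul, heis_zero_tmul, map_smul]
    · rw [if_neg (by omega), zero_smul, add_zero]
      simp only [heis_neg_tmul, mul_left_comm]

lemma heis_eV_pos (h : Cartan L) {n : ℤ} (hn : 0 < n) (γ : L) : heis B h n (eV γ) = 0 := by
  obtain ⟨k, rfl⟩ : ∃ k : ℕ, n = k + 1 := ⟨(n - 1).toNat, by omega⟩
  rw [eV, heis_pos_tmul]
  simp

lemma heis_zero_eV (h : Cartan L) (γ : L) :
    heis B h 0 (eV γ) = B.baseChange ℂ h (toCartan γ) • eV γ := heis_zero_tmul B h 1 γ 1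

lemma baseChange_toCartan (α β : L) :
    B.baseChange ℂ (toCartan α) (toCartan β) = (B α β : ℂ) := by
  simp [toCartan, LinearMap.BilinForm.baseChange_tmul]

lemma heis_toCartan_add_neg (α β : L) (n : ℕ) (v : VSpace L) :
    heis B (toCartan (α + β)) (-(n + 1)) v =
      heis B (toCartan α) (-(n + 1)) v + heis B (toCartan β) (-(n + 1)) v := by
  induction v using vSpace_induction_tmul with
  | zero => simp
  | add v w hv hw => simp only [map_add, hv, hw]; abel
  | tmul u γ => simp only [heis_neg_tmul, neg_toCartan_add, add_mul, TensorProduct.add_tmul]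

/-! ### The translation operator -/

variable (L) in
/-- The identification of the spaces underlying `B_L` and `V_L`. -/
def bEquivV : BSpace L ≃ₗ[ℂ] VSpace L :=
  TensorProduct.congr (LinearEquiv.refl ℂ (Fock L)) (AddMonoidAlgebra.coeffLinearEquiv ℂ)

lemma bEquivV_tmul_single (u : Fock L) (α : L) (c : ℂ) :
    bEquivV L (u ⊗ₜ AddMonoidAlgebra.single α c) = u ⊗ₜ Finsupp.single α c := by
  simp [bEquivV]

lemma bEquivV_eB (α : L) : bEquivV L (eB α) = eV α := bEquivV_tmul_single 1 α 1

lemma bEquivV_neg_mul (h : Cartan L) (n : ℕ) (x : BSpace L) :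
    bEquivV L ((neg h n ⊗ₜ[ℂ] 1) * x) = heis B h (-(n + 1)) (bEquivV L x) := by
  induction x using TensorProduct.induction_on with
  | zero => simp
  | add x y hx hy => simp only [mul_add, map_add, hx, hy]
  | tmul u f =>
    rw [Algebra.TensorProduct.tmul_mul_tmul, one_mul]
    simp only [bEquivV, TensorProduct.congr_tmul, LinearEquiv.refl_apply, heis_neg_tmul]

variable (L) in
/-- The translation operator of `V_L`. -/
def transV : Module.End ℂ (VSpace L) :=
  (bEquivV L).toLinearMap ∘ₗ (bDeriv : Derivation ℂ (BSpace L) (BSpace L)).toLinearMap ∘ₗ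
    (bEquivV L).symm.toLinearMap

lemma transV_bEquivV (x : BSpace L) : transV L (bEquivV L x) = bEquivV L (bDeriv x) := by
  simp [transV]

lemma transV_eV (γ : L) : transV L (eV γ) = heis B (toCartan γ) (-1) (eV γ) := by
  rw [← bEquivV_eB, transV_bEquivV, bDeriv_eB, bEquivV_neg_mul (B := B)]
  simp

lemma transV_heis_neg (h : Cartan L) (n : ℕ) (v : VSpace L) :
    transV L (heis B h (-(n + 1)) v) = heis B h (-(n + 1)) (transV L v) +
      ((n : ℂ) + 1) • heis B h (-(n + 1) - 1) v := by
  obtain ⟨x, rfl⟩ := (bEquivV L).surjective v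
  rw [← bEquivV_neg_mul, transV_bEquivV, transV_bEquivV, ← bEquivV_neg_mul, Derivation.leibniz,
    bDeriv_neg, map_add, smul_eq_mul, smul_eq_mul, mul_smul_comm, map_smul, mul_comm x,
    bEquivV_neg_mul (B := B) h (n + 1)]
  congr 4

lemma transV_heis_of_nonneg (hsymm : B.IsSymm) (h : Cartan L) {n : ℤ} (hn : 0 ≤ n)
    (v : VSpace L) :
    transV L (heis B h n v) = heis B h n (transV L v) - n • heis B h (n - 1) v := by
  induction v using vSpace_induction (B := B) with
  | zero => simp
  | add v w hv hw => simp only [map_add, hv, hw, smul_add]; abel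
  | smul c v hv => simp only [map_smul, hv, smul_sub, smul_comm n c]
  | eV γ =>
    rw [transV_eV (B := B), heis_commutator hsymm]
    rcases eq_or_ne n 0 with rfl | h0
    · simp [heis_zero_eV, transV_eV (B := B)]
    rw [heis_eV_pos h (by omega), map_zero, map_zero, zero_add]
    rcases eq_or_ne n 1 with rfl | h1
    · simp [heis_zero_eV]
    · rw [heis_eV_pos h (by omega : 0 < n - 1), if_neg (by omega)]
      simp
  | heis h' k v hv =>
    rw [heis_commutator hsymm, map_add, map_smul, transV_heis_neg, transV_heis_neg, hv, map_add,
      map_smul, map_sub, map_zsmul, heis_commutator hsymm h h' n _ (transV L v),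
      heis_commutator hsymm h h' n _ v, heis_commutator hsymm h h' (n - 1) _ v,
      ← Int.cast_smul_eq_zsmul ℂ, ← Int.cast_smul_eq_zsmul ℂ]
    -- Two central terms occur only at `n = k + 2`, where they cancel: `(k + 1) n = n (n - 1)`. The
    -- central term present at `n = k + 1` is the same on both sides.
    by_cases hk : n = k + 1 + 1
    · subst hk
      rw [if_neg (show ¬ (k : ℤ) + 1 + 1 + -(k + 1) = 0 by omega),
        if_pos (show (k : ℤ) + 1 + 1 + (-(k + 1) - 1) = 0 by ring),
        if_pos (show (k : ℤ) + 1 + 1 - 1 + -(k + 1) = 0 by ring)]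
      push_cast
      module
    · rw [if_neg (show ¬ n + (-(k + 1) - 1) = 0 by omega),
        if_neg (show ¬ n - 1 + -(k + 1 : ℤ) = 0 by omega)]
      module

lemma transV_heis (hsymm : B.IsSymm) (h : Cartan L) (n : ℤ) (v : VSpace L) :
    transV L (heis B h n v) = heis B h n (transV L v) - n • heis B h (n - 1) v := by
  rcases le_or_gt 0 n with hn | hn
  · exact transV_heis_of_nonneg hsymm h hn v
  · obtain ⟨k, rfl⟩ : ∃ k : ℕ, n = -(k + 1) := ⟨(-n - 1).toNat, by omega⟩
    rw [transV_heis_neg, ← Int.cast_smul_eq_zsmul ℂ]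
    push_cast
    module

end LatticeVA

namespace LatticeVA

open VertexData VertexOperator

variable {L : Type*} [AddCommGroup L] {B : LinearMap.BilinForm ℤ L}

/-! ### The exponentials -/

variable (B) in
/-- The coefficient of `zⁿ` in `E⁻(-α,z)`, for `n ∈ ℤ`. -/
def creE (α : L) (n : ℤ) : Module.End ℂ (VSpace L) :=
  if 0 ≤ n then PowerSeries.coeff n.toNat (Eminus B α) else 0

variable (B) in
/-- The coefficient of `z⁻ⁿ` in `E⁺(-α,z)`, for `n ∈ ℤ`. -/
def annE (α : L) (n : ℤ) : Module.End ℂ (VSpace L) :=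
  if 0 ≤ n then PowerSeries.coeff n.toNat (Eplus B α) else 0

lemma heis_commute (hsymm : B.IsSymm) (h h' : Cartan L) {m n : ℤ} (hmn : m + n ≠ 0) :
    Commute (heis B h m) (heis B h' n) := by
  refine LinearMap.ext fun v => ?_
  simp [heis_commutator hsymm h h' m n, hmn]

lemma commute_neg_right {a b : Module.End ℂ (VSpace L)} (h : Commute a b) : Commute a (-b) := by
  refine LinearMap.ext fun v => ?_
  have hv : a (b v) = b (a v) := congr($h.eq v)
  simp only [Module.End.mul_apply, LinearMap.neg_apply, map_neg, hv]

lemma isExpSeq_creE (hsymm : B.IsSymm) (α : L) :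
    IsExpSeq (fun k : ℕ => heis B (toCartan α) (-(k + 1))) (creE B α) := by
  refine isExpSeq_expSeries (by simp) (fun i j => ?_) (fun k => ?_)
  · rcases i with _ | i
    · simp
    rcases j with _ | j
    · simp
    simp only [PowerSeries.coeff_mk, Nat.add_eq_zero_iff, one_ne_zero, and_false, if_false]
    exact ((heis_commute hsymm _ _ (by omega)).smul_left _).smul_right _
  · have h : (k : ℂ) + 1 ≠ 0 := by exact_mod_cast Nat.succ_ne_zero k
    rw [PowerSeries.coeff_mk, if_neg (by omega), smul_smul]
    push_cast
    rw [mul_inv_cancel₀ h, one_smul]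

lemma isExpSeq_annE (hsymm : B.IsSymm) (α : L) :
    IsExpSeq (fun k : ℕ => -heis B (toCartan α) (k + 1)) (annE B α) := by
  refine isExpSeq_expSeries (by simp) (fun i j => ?_) (fun k => ?_)
  · rcases i with _ | i
    · simp
    rcases j with _ | j
    · simp
    simp only [PowerSeries.coeff_mk, Nat.add_eq_zero_iff, one_ne_zero, and_false, if_false]
    have h : Commute (heis B (toCartan α) ((i + 1 : ℕ) : ℤ))
      (heis B (toCartan α) ((j + 1 : ℕ) : ℤ)) := heis_commute hsymm _ _ (by omega)
    exact commute_neg_right (commute_neg_right ((h.smul_left _).smul_right _).symm).symm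
  · have h : (k : ℂ) + 1 ≠ 0 := by exact_mod_cast Nat.succ_ne_zero k
    rw [PowerSeries.coeff_mk, if_neg (by omega)]
    refine LinearMap.ext fun v => ?_
    simp only [LinearMap.smul_apply, LinearMap.neg_apply, smul_neg, smul_smul]
    push_cast
    rw [mul_inv_cancel₀ h, one_smul]

/-- `[h(j+1), α(-j-1)] = (j+1)⟨h,α⟩` is the only nonzero commutator with the exponent, so `h(j+1)`
multiplies `E⁻(-α,z)` by `⟨h,α⟩ z^{j+1}`. -/
lemma heis_pos_creE (hsymm : B.IsSymm) (h : Cartan L) (α : L) (j : ℕ) (n : ℤ) (v : VSpace L) :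
    heis B h (j + 1) (creE B α n v) = creE B α n (heis B h (j + 1) v) +
      B.baseChange ℂ h (toCartan α) • creE B α (n - (j + 1)) v := by
  refine congr($((isExpSeq_creE hsymm α).commutator (H := heis B h (j + 1)) (j := j)
    (c := B.baseChange ℂ h (toCartan α)) (fun k => ?_) n) v)
  refine LinearMap.ext fun v => ?_
  simp only [Module.End.mul_apply, LinearMap.add_apply, heis_commutator hsymm h]
  by_cases hk : k = j
  · subst hk; simp
  · rw [if_neg hk, if_neg (by omega)]; simp

/-- The mirror image of `heis_pos_creE`: the sign of `[h(-j-1), α(j+1)]` cancels the sign in the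
exponent of `E⁺(-α,z)`. -/
lemma heis_neg_annE (hsymm : B.IsSymm) (h : Cartan L) (α : L) (j : ℕ) (n : ℤ) (v : VSpace L) :
    heis B h (-(j + 1)) (annE B α n v) = annE B α n (heis B h (-(j + 1)) v) +
      B.baseChange ℂ h (toCartan α) • annE B α (n - (j + 1)) v := by
  refine congr($((isExpSeq_annE hsymm α).commutator (H := heis B h (-(j + 1))) (j := j)
    (c := B.baseChange ℂ h (toCartan α)) (fun k => ?_) n) v)
  refine LinearMap.ext fun v => ?_
  simp only [Module.End.mul_apply, LinearMap.add_apply, LinearMap.neg_apply, map_neg,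
    heis_commutator hsymm h]
  by_cases hk : k = j
  · subst hk
    rw [if_pos (by ring), if_pos rfl]
    push_cast
    simp only [LinearMap.smul_apply, Module.End.one_apply]
    module
  · rw [if_neg hk, if_neg (by omega)]; simp

lemma heis_creE_comm (hsymm : B.IsSymm) (h : Cartan L) (α : L) {m : ℤ} (hm : m ≤ 0) (n : ℤ)
    (v : VSpace L) : heis B h m (creE B α n v) = creE B α n (heis B h m v) := by
  refine congr($(((isExpSeq_creE hsymm α).commute (H := heis B h m) fun k => ?_) n) v)
  exact heis_commute hsymm _ _ (by omega)

lemma heis_annE_comm (hsymm : B.IsSymm) (h : Cartan L) (α : L) {m : ℤ} (hm : 0 ≤ m) (n : ℤ)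
    (v : VSpace L) : heis B h m (annE B α n v) = annE B α n (heis B h m v) := by
  refine congr($(((isExpSeq_annE hsymm α).commute (H := heis B h m) fun k => ?_) n) v)
  exact commute_neg_right
    (heis_commute hsymm h (toCartan α) (by omega : m + ((k : ℤ) + 1) ≠ 0))

lemma creE_comm (hsymm : B.IsSymm) (α β : L) (m n : ℤ) (v : VSpace L) :
    creE B α m (creE B β n v) = creE B β n (creE B α m v) := by
  refine congr($(((isExpSeq_creE hsymm β).commute (H := creE B α m) fun k => ?_) n) v)
  refine LinearMap.ext fun w => ?_
  exact (heis_creE_comm hsymm _ α (by omega) m w).symm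

lemma annE_eV (hsymm : B.IsSymm) (α γ : L) (n : ℤ) :
    annE B α n (eV γ) = if n = 0 then eV γ else 0 := by
  have hE := isExpSeq_annE hsymm α
  rcases lt_trichotomy n 0 with hn | rfl | hn
  · rw [hE.of_neg n hn, if_neg hn.ne, LinearMap.zero_apply]
  · rw [hE.zero, if_pos rfl, Module.End.one_apply]
  · rw [if_neg hn.ne']
    have h := congr($(hE.recurrence n n.toNat (by omega)) (eV γ))
    rw [LinearMap.smul_apply, LinearMap.sum_apply, Finset.sum_eq_zero] at h
    · exact (smul_eq_zero.mp h).resolve_left (by exact_mod_cast hn.ne')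
    · intro k _
      rw [Module.End.mul_apply, LinearMap.neg_apply, heis_annE_comm hsymm _ _ (by omega),
        heis_eV_pos _ (by omega), map_zero, neg_zero]

/-- `E⁺` fixes `e_γ`, and each application of `h(-k-1)` raises the degree in `z⁻¹` by at most `k +
1`. -/
lemma exists_annE_eq_zero (hsymm : B.IsSymm) (α : L) (v : VSpace L) :
    ∃ N : ℤ, ∀ n, N ≤ n → annE B α n v = 0 := by
  induction v using vSpace_induction (B := B) with
  | zero => exact ⟨0, by simp⟩
  | eV γ => exact ⟨1, fun n hn => by rw [annE_eV hsymm, if_neg (by omega)]⟩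
  | add v w hv hw =>
    obtain ⟨N, hN⟩ := hv
    obtain ⟨M, hM⟩ := hw
    exact ⟨max N M, fun n hn => by rw [map_add, hN n (by omega), hM n (by omega), add_zero]⟩
  | smul c v hv =>
    obtain ⟨N, hN⟩ := hv
    exact ⟨N, fun n hn => by rw [map_smul, hN n hn, smul_zero]⟩
  | heis h k v hv =>
    obtain ⟨N, hN⟩ := hv
    refine ⟨N + (k + 1), fun n hn => ?_⟩
    have h := heis_neg_annE hsymm h α k n v
    rw [hN n (by omega), hN (n - (k + 1)) (by omega), map_zero, smul_zero, add_zero] at h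
    exact h.symm

/-! ### The normally ordered product `E⁻(-α,z)E⁺(-α,z)` -/

lemma finite_support_creE_annE (hsymm : B.IsSymm) (α : L) (n : ℤ) (v : VSpace L) :
    (Function.support fun p : ℤ => creE B α (n + p) (annE B α p v)).Finite := by
  obtain ⟨N, hN⟩ := exists_annE_eq_zero hsymm α v
  refine (Set.finite_Ico 0 N).subset fun p hp => ?_
  by_contra h
  apply hp
  rcases lt_or_ge p 0 with h0 | h0
  · simp [(isExpSeq_annE hsymm α).of_neg p h0]
  · rw [Set.mem_Ico] at h
    simp [hN p (by omega)]

/-- The coefficient of `zⁿ` in `E⁻(-α,z)E⁺(-α,z)`. -/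
def expCoeff (hsymm : B.IsSymm) (α : L) (n : ℤ) : Module.End ℂ (VSpace L) where
  toFun v := ∑ᶠ p : ℤ, creE B α (n + p) (annE B α p v)
  map_add' v w := by
    simp only [map_add]
    exact finsum_add_distrib (finite_support_creE_annE hsymm α n v)
      (finite_support_creE_annE hsymm α n w)
  map_smul' c v := by
    simp only [map_smul, RingHom.id_apply]
    exact (smul_finsum' c (finite_support_creE_annE hsymm α n v)).symm

lemma expCoeff_apply (hsymm : B.IsSymm) (α : L) (n : ℤ) (v : VSpace L) :
    expCoeff hsymm α n v = ∑ᶠ p : ℤ, creE B α (n + p) (annE B α p v) := rfl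

lemma expCoeff_eV (hsymm : B.IsSymm) (α γ : L) (n : ℤ) :
    expCoeff hsymm α n (eV γ) = creE B α n (eV γ) := by
  rw [expCoeff_apply, finsum_eq_single _ 0]
  · simp [annE_eV hsymm]
  · intro p hp
    simp [annE_eV hsymm, hp]

lemma exists_expCoeff_eq_zero (hsymm : B.IsSymm) (α : L) (v : VSpace L) :
    ∃ N : ℤ, ∀ n, n ≤ N → expCoeff hsymm α n v = 0 := by
  obtain ⟨N, hN⟩ := exists_annE_eq_zero hsymm α v
  refine ⟨-N, fun n hn => ?_⟩
  rw [expCoeff_apply]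
  refine finsum_eq_zero_of_forall_eq_zero fun p => ?_
  rcases lt_or_ge p N with h | h
  · rw [(isExpSeq_creE hsymm α).of_neg _ (by omega), LinearMap.zero_apply]
  · rw [hN p h, map_zero]

lemma heis_zero_expCoeff (hsymm : B.IsSymm) (h : Cartan L) (α : L) (n : ℤ) (v : VSpace L) :
    heis B h 0 (expCoeff hsymm α n v) = expCoeff hsymm α n (heis B h 0 v) := by
  simp only [expCoeff_apply]
  rw [map_finsum _ (finite_support_creE_annE hsymm α n v)]
  simp only [heis_creE_comm hsymm h α le_rfl, heis_annE_comm hsymm h α le_rfl]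

/-- Exactly one factor fails to commute with `h(m)`: `E⁻` for `m > 0` and `E⁺` for `m < 0`. Either
way the commutator is multiplication by `⟨h,α⟩ z^m`. -/
lemma heis_expCoeff (hsymm : B.IsSymm) (h : Cartan L) (α : L) {m : ℤ} (hm : m ≠ 0) (n : ℤ)
    (v : VSpace L) :
    heis B h m (expCoeff hsymm α n v) = expCoeff hsymm α n (heis B h m v) +
      B.baseChange ℂ h (toCartan α) • expCoeff hsymm α (n - m) v := by
  have hfin := finite_support_creE_annE hsymm α (n - m) v
  simp only [expCoeff_apply]
  rw [map_finsum _ (finite_support_creE_annE hsymm α n v)]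
  rcases int_cases m with ⟨j, rfl⟩ | rfl | ⟨j, rfl⟩
  · simp only [heis_pos_creE hsymm, heis_annE_comm hsymm h α (by omega : (0 : ℤ) ≤ j + 1)]
    rw [finsum_add_distrib (finite_support_creE_annE hsymm α n _) _]
    · rw [smul_finsum' _ hfin]
      simp only [add_sub_right_comm]
    · refine hfin.subset fun p hp => ?_
      contrapose! hp
      rw [Function.notMem_support, add_sub_right_comm] at *
      rw [hp, smul_zero]
  · exact absurd rfl hm
  -- Here the shift falls on the `E⁺` index and is absorbed by summing over `p - (j + 1)` instead of
  -- `p`.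
  · have hs (p : ℤ) : creE B α (n + p) (annE B α (p - (j + 1)) v) =
        creE B α (n - -(j + 1) + (p - (j + 1))) (annE B α (p - (j + 1)) v) := by
      congr 2
      ring
    have hfin' : (Function.support fun p : ℤ =>
        creE B α (n + p) (annE B α (p - (j + 1)) v)).Finite := by
      simp only [hs]
      exact hfin.preimage (f := fun p : ℤ => p - (j + 1)) (sub_left_injective.injOn)
    simp only [heis_creE_comm hsymm h α (by omega : -((j : ℤ) + 1) ≤ 0), heis_neg_annE hsymm,
      map_add, map_smul]
    rw [finsum_add_distrib (finite_support_creE_annE hsymm α n _) _, ← smul_finsum' _ hfin']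
    · simp only [hs]
      congr 2
      exact finsum_comp_equiv (Equiv.subRight ((j : ℤ) + 1))
        (f := fun p : ℤ => creE B α (n - -(j + 1) + p) (annE B α p v))
    · refine hfin'.subset fun p hp => ?_
      contrapose! hp
      rw [Function.notMem_support] at *
      rw [hp, smul_zero]

/-! ### The vertex operators of the `e_α` -/

/-- Nonzero modes act on the Fock factor alone, so the lattice shift by `α` in `Y(e_α,z)` does not
affect them. -/
lemma heis_tmul_of_ne_zero (h : Cartan L) {m : ℤ} (hm : m ≠ 0) (u : Fock L) :
    ∃ u' : Fock L, ∀ f : L →₀ ℂ, heis B h m (u ⊗ₜ[ℂ] f) = u' ⊗ₜ[ℂ] f := by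
  rcases int_cases m with ⟨j, rfl⟩ | rfl | ⟨j, rfl⟩
  · exact ⟨_, heis_pos_tmul B h j u⟩
  · exact absurd rfl hm
  · exact ⟨_, heis_neg_tmul B h j u⟩

/-- The mode `(e_α)_n` on `V_L`: the coefficient of `z^{-n-1}` in
`E⁻(-α,z)E⁺(-α,z)e_α z^α`. -/
def eMode (hsymm : B.IsSymm) (ε : L → L → ℂˣ) (α : L) (n : ℤ) : Module.End ℂ (VSpace L) :=
  TensorProduct.lift (LinearMap.flip (Finsupp.lsum ℂ fun β : L =>
    LinearMap.toSpanSingleton ℂ (Fock L →ₗ[ℂ] VSpace L)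
      (expCoeff hsymm α (-n - 1 - B α β) ∘ₗ
        (TensorProduct.mk ℂ (Fock L) (L →₀ ℂ)).flip (Finsupp.single (α + β) (ε α β : ℂ)))))

lemma eMode_tmul (hsymm : B.IsSymm) (ε : L → L → ℂˣ) (α β : L) (n : ℤ) (u : Fock L) :
    eMode hsymm ε α n (u ⊗ₜ[ℂ] Finsupp.single β 1) =
      (ε α β : ℂ) • expCoeff hsymm α (-n - 1 - B α β) (u ⊗ₜ[ℂ] Finsupp.single (α + β) 1) := by
  rw [← map_smul, ← TensorProduct.tmul_smul, Finsupp.smul_single, smul_eq_mul, mul_one]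
  simp [eMode]

lemma eMode_eV (hsymm : B.IsSymm) (ε : L → L → ℂˣ) (α γ : L) (n : ℤ) :
    eMode hsymm ε α n (eV γ) = (ε α γ : ℂ) • creE B α (-n - 1 - B α γ) (eV (α + γ)) := by
  rw [← expCoeff_eV hsymm]
  exact eMode_tmul hsymm ε α γ n 1

lemma exists_eMode_eq_zero (hsymm : B.IsSymm) (ε : L → L → ℂˣ) (α : L) (v : VSpace L) :
    ∃ N : ℤ, ∀ n, N ≤ n → eMode hsymm ε α n v = 0 := by
  induction v using vSpace_induction_tmul with
  | zero => exact ⟨0, by simp⟩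
  | add v w hv hw =>
    obtain ⟨N, hN⟩ := hv
    obtain ⟨M, hM⟩ := hw
    exact ⟨max N M, fun n hn => by rw [map_add, hN n (by omega), hM n (by omega), add_zero]⟩
  | tmul u β =>
    obtain ⟨N, hN⟩ := exists_expCoeff_eq_zero hsymm α (u ⊗ₜ[ℂ] Finsupp.single (α + β) (1 : ℂ))
    refine ⟨-N - 1 - B α β, fun n hn => ?_⟩
    rw [eMode_tmul, hN _ (by omega), smul_zero]

lemma toCartan_add (α β : L) : toCartan (α + β) = toCartan α + toCartan β := by
  simp [toCartan, TensorProduct.tmul_add]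

/-- For `m = 0` the extra term comes from the lattice shift `β ↦ α + β`, and for `m ≠ 0` from the
exponentials. -/
lemma heis_eMode (hsymm : B.IsSymm) (ε : L → L → ℂˣ) (h : Cartan L) (α : L) (m n : ℤ)
    (v : VSpace L) :
    heis B h m (eMode hsymm ε α n v) = eMode hsymm ε α n (heis B h m v) +
      B.baseChange ℂ h (toCartan α) • eMode hsymm ε α (n + m) v := by
  induction v using vSpace_induction_tmul with
  | zero => simp
  | add v w hv hw => simp only [map_add, hv, hw, smul_add]; abel
  | tmul u β =>
    rcases eq_or_ne m 0 with rfl | hm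
    · rw [heis_zero_tmul, map_smul, eMode_tmul, map_smul, heis_zero_expCoeff, heis_zero_tmul,
        add_zero, eMode_tmul, map_smul, toCartan_add, map_add]
      module
    · obtain ⟨u', hu'⟩ := heis_tmul_of_ne_zero (B := B) h hm u
      rw [hu', eMode_tmul, eMode_tmul, eMode_tmul, map_smul, heis_expCoeff hsymm h α hm, hu',
        show -(n + m) - 1 - B α β = -n - 1 - B α β - m by ring]
      module

/-- The vertex operators `Y(e_α,z)` are translation covariant. -/
lemma transV_eMode (hsymm : B.IsSymm) (ε : L → L → ℂˣ) (α : L) (n : ℤ) (v : VSpace L) :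
    transV L (eMode hsymm ε α n v) =
      eMode hsymm ε α n (transV L v) - n • eMode hsymm ε α (n - 1) v := by
  induction v using vSpace_induction (B := B) generalizing n with
  | zero => simp
  | add v w hv hw => simp only [map_add, hv, hw, smul_add]; abel
  | smul c v hv => simp only [map_smul, hv, smul_sub, smul_comm n c]
  | eV γ =>
    -- On `e_{α+γ}` the translation is `α(-1) + γ(-1)`. The `α(-1)` part cancels the term `X 0` of
    -- the derivative formula. The `γ(-1)` part, moved through `(e_α)_n`, gives `⟨α,γ⟩ (e_α)_{n-1}`.
    have hT := congr($((isExpSeq_creE hsymm α).derivation (T := transV L)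
      (fun k => heis_commute hsymm _ _ (by omega)) (fun k => by
        refine LinearMap.ext fun v => ?_
        simp only [Module.End.mul_apply, LinearMap.add_apply, LinearMap.smul_apply]
        rw [transV_heis_neg]
        push_cast
        ring_nf) (-n - 1 - B α γ)) (eV (α + γ)))
    simp only [Module.End.mul_apply, LinearMap.add_apply, LinearMap.sub_apply,
      LinearMap.smul_apply, CharP.cast_eq_zero, zero_add] at hT
    have h1 := heis_toCartan_add_neg (B := B) α γ 0 (eV (α + γ))
    simp only [CharP.cast_eq_zero, zero_add] at h1
    have h2 := heis_eMode hsymm ε (toCartan γ) α (-1) n (eV γ)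
    have hs : B γ α = B α γ := hsymm.eq γ α
    rw [baseChange_toCartan, hs] at h2
    rw [transV_eV (B := B) γ, ← sub_eq_iff_eq_add.mpr h2, eMode_eV, map_smul, hT,
      transV_eV (B := B), h1, map_add, ← heis_creE_comm hsymm _ _ (by omega),
      ← heis_creE_comm hsymm _ _ (by omega), map_smul, ← sub_eq_add_neg, eMode_eV,
      show -(n - 1) - 1 - B α γ = -n - 1 - B α γ + 1 by ring, ← Int.cast_smul_eq_zsmul ℂ]
    push_cast
    module
  | heis h k v hv =>
    have h2 (n : ℤ) (w : VSpace L) (m : ℤ) :=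
      sub_eq_iff_eq_add.mpr (heis_eMode hsymm ε h α m n w)
    rw [transV_heis hsymm, ← h2, map_sub, map_smul, transV_heis hsymm, hv, hv, map_sub, map_sub,
      map_zsmul, map_zsmul, ← h2, ← h2, ← h2]
    simp only [← Int.cast_smul_eq_zsmul ℂ]
    rw [show n + -(k + 1 : ℤ) - 1 = n - 1 + -(k + 1) by ring,
      show n + (-(k + 1 : ℤ) - 1) = n - 1 + -(k + 1) by ring]
    push_cast
    module

end LatticeVA

/-! ### Further expansion identities for the locality of the lattice fields -/

namespace VertexOperator

/-- The logarithmic derivative of `(1 - y)^l`, namely `y ((1 - y)^l)' = -l y (1 - y)^{-1} (1 -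
y)^l`, at the coefficient of `y^p`. -/
lemma sum_signedChoose (l : ℤ) (p : ℕ) :
    -l * ∑ j ∈ Finset.range p, signedChoose l j = p * signedChoose l p := by
  induction p with
  | zero => simp
  | succ p ih =>
    have h := succ_mul_signedChoose_succ l p
    rw [Finset.sum_range_succ, mul_add, ih]
    push_cast
    rw [h]
    ring

section

variable {V : Type*} [AddCommGroup V]

lemma IsTruncated.expand {f : ℤ → ℤ → V} (hf : IsTruncated f) (l : ℤ) :
    IsTruncated (expand l f) := by
  obtain ⟨N, hN⟩ := hf
  refine ⟨N, fun m n hn => ?_⟩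
  rw [VertexOperator.expand, finsum_eq_zero_of_forall_eq_zero]
  intro i
  rw [hN _ _ (by omega), smul_zero]

lemma expand_expand {f : ℤ → ℤ → V} (hf : IsTruncated f) (l : ℤ) (N : ℕ) (m n : ℤ) :
    expand N (expand l f) m n = expand (l + N) f m n := by
  induction N generalizing m n with
  | zero => rw [Nat.cast_zero, expand_zero_left, add_zero]
  | succ N ih =>
    push_cast
    rw [expand_succ (hf.expand l), ih, ih, ← add_assoc, expand_succ hf]

/-- For a nonnegative exponent `(x - y)^N` is a polynomial, so the direction of expansion is
irrelevant and only the sign of `y - x` remains. -/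
lemma expand_swap {f : ℤ → ℤ → V} (hf : IsTruncated f) (hf' : IsTruncated fun n m => f m n)
    (N : ℕ) (m n : ℤ) :
    expand N (fun n m => f m n) n m = Int.negOnePow N • expand N f m n := by
  induction N generalizing m n with
  | zero => simp [expand_zero_left]
  | succ N ih =>
    push_cast
    rw [expand_succ hf', ih, ih, expand_succ hf, Int.negOnePow_succ, Units.neg_smul, smul_sub,
      neg_sub]

end

section

variable {V : Type*} [AddCommGroup V] [Module ℂ V]

/-- The hypotheses say `[H, A(x)] = a x^k A(x)` and `[H, B(y)] = b y^k B(y)`; these scalar factors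
commute with `(x - y)^l`. This is how relations on one vector pass to its images under the
Heisenberg operators. -/
lemma orderedProd_commutator {A B : VertexOperator ℂ V} {H : Module.End ℂ V} {a b : ℂ} {k : ℤ}
    (hA : ∀ n w, H (ncoeff A n w) = ncoeff A n (H w) + a • ncoeff A (n + k) w)
    (hB : ∀ n w, H (ncoeff B n w) = ncoeff B n (H w) + b • ncoeff B (n + k) w)
    (l m n : ℤ) (w : V) :
    H (orderedProd A B l m n w) = orderedProd A B l m n (H w) +
      a • orderedProd A B l (m + k) n w + b • orderedProd A B l m (n + k) w := by
  have h := isTruncated_comp A B w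
  have h1 (c : ℂ) (i j : ℤ) : IsTruncated fun m n => c • ncoeff A (m + i) (ncoeff B (n + j) w) :=
    (h.shift i j).map (LinearMap.lsmul ℂ V c)
  have h2 (c : ℂ) (i j : ℤ) :
      expand l (fun m n => c • ncoeff A (m + i) (ncoeff B (n + j) w)) m n =
        c • orderedProd A B l (m + i) (n + j) w := by
    rw [orderedProd, ← LinearMap.lsmul_apply, map_expand h (LinearMap.lsmul ℂ V c)]
    simp only [expand, LinearMap.lsmul_apply]
    refine finsum_congr fun p => ?_
    ring_nf
  rw [orderedProd, map_expand h]
  simp only [hA, hB, map_add, map_smul]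
  have e1 := h1 a k 0
  have e2 := h1 b 0 k
  have f1 := h2 a k 0
  have f2 := h2 b 0 k
  simp only [add_zero] at e1 e2 f1 f2
  rw [expand_add ((isTruncated_comp A B (H w)).add e2) e1,
    expand_add (isTruncated_comp A B (H w)) e2, f1, f2, add_right_comm]
  rfl

lemma borcherdsProd_commutator {A B : VertexOperator ℂ V} {H : Module.End ℂ V} {a b : ℂ} {k : ℤ}
    (hA : ∀ n w, H (ncoeff A n w) = ncoeff A n (H w) + a • ncoeff A (n + k) w)
    (hB : ∀ n w, H (ncoeff B n w) = ncoeff B n (H w) + b • ncoeff B (n + k) w)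
    (l m n : ℤ) (w : V) :
    H (borcherdsProd A B l m n w) = borcherdsProd A B l m n (H w) +
      a • borcherdsProd A B l (m + k) n w + b • borcherdsProd A B l m (n + k) w := by
  have hs (z : V) : H (Int.negOnePow l • z) = Int.negOnePow l • H z := by
    rw [Units.smul_def, map_zsmul, ← Units.smul_def]
  rw [borcherdsProd, map_sub, hs, orderedProd_commutator hA hB, orderedProd_commutator hB hA]
  simp only [borcherdsProd, smul_sub, smul_add, smul_comm a, smul_comm b]
  abel

end

end VertexOperator

lemma finsum_int_eq_finsum_nat {M : Type*} [AddCommMonoid M] {f : ℤ → M}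
    (hf : ∀ n < 0, f n = 0) : ∑ᶠ n : ℤ, f n = ∑ᶠ n : ℕ, f n := by
  rw [← finsum_mem_range (f := f) (g := ((↑) : ℕ → ℤ)) Nat.cast_injective]
  refine finsum_congr fun n => ?_
  classical
  by_cases hn : n ∈ Set.range ((↑) : ℕ → ℤ)
  · rw [finsum_eq_if, if_pos hn]
  · rw [finsum_eq_if, if_neg hn]
    refine hf n ?_
    by_contra h
    exact hn ⟨n.toNat, by omega⟩

namespace LatticeVA

open VertexData VertexOperator

variable {L : Type*} [AddCommGroup L] {B : LinearMap.BilinForm ℤ L}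

/-! ### Locality -/

/-- `E⁻` is multiplication by a series in the Fock space, independent of the lattice part. A second
`e_α`-mode can then be evaluated with `eMode_tmul`. -/
lemma exists_creE_eV (hsymm : B.IsSymm) (α : L) (n : ℤ) :
    ∃ u : Fock L, ∀ γ, creE B α n (eV γ) = u ⊗ₜ[ℂ] Finsupp.single γ 1 := by
  have hE := isExpSeq_creE hsymm α
  rcases lt_or_ge n 0 with hn | hn
  · exact ⟨0, fun γ => by rw [hE.of_neg n hn, TensorProduct.zero_tmul, LinearMap.zero_apply]⟩
  obtain ⟨n, rfl⟩ := Int.eq_ofNat_of_zero_le hn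
  induction n using Nat.strong_induction_on with
  | _ n ih =>
    rcases Nat.eq_zero_or_pos n with rfl | hpos
    · exact ⟨1, fun γ => by rw [Nat.cast_zero, hE.zero]; rfl⟩
    have ih' (k : ℕ) : ∃ u : Fock L, ∀ γ,
        creE B α (n - 1 - k) (eV γ) = u ⊗ₜ[ℂ] Finsupp.single γ 1 := by
      rcases lt_or_ge k n with hk | hk
      · obtain ⟨u, hu⟩ := ih (n - 1 - k) (by omega) (by omega)
        exact ⟨u, fun γ => by rw [← hu]; congr 2; omega⟩
      · exact ⟨0, fun γ => by
          rw [hE.of_neg _ (by omega), TensorProduct.zero_tmul, LinearMap.zero_apply]⟩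
    choose u hu using ih'
    refine ⟨(n : ℂ)⁻¹ • ∑ k ∈ Finset.range n, neg (toCartan α) k * u k, fun γ => ?_⟩
    have h := congr($(hE.recurrence n n le_rfl) (eV γ))
    simp only [LinearMap.smul_apply, LinearMap.sum_apply, Module.End.mul_apply, hu,
      heis_neg_tmul, ← TensorProduct.sum_tmul, Int.cast_natCast] at h
    rw [← TensorProduct.smul_tmul', ← h, smul_smul, inv_mul_cancel₀ (by exact_mod_cast hpos.ne'),
      one_smul]

/-- The reordering `E⁺(-α,x) E⁻(-β,y) = (1 - y/x)^{⟨α,β⟩} E⁻(-β,y) E⁺(-α,x)` on `e_γ`, where `E⁺`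
acts trivially. -/
lemma annE_creE_eV (hsymm : B.IsSymm) (α β γ : L) (p : ℕ) (n : ℤ) :
    annE B α p (creE B β n (eV γ)) = signedChoose (B α β) p • creE B β (n - p) (eV γ) := by
  have hE := isExpSeq_annE hsymm α
  induction p using Nat.strong_induction_on generalizing n with
  | _ p ih =>
    rcases Nat.eq_zero_or_pos p with rfl | hpos
    · rw [Nat.cast_zero, hE.zero]
      simp
    have hp : (p : ℂ) ≠ 0 := by exact_mod_cast hpos.ne'
    have h := congr($(hE.recurrence p p le_rfl) (creE B β n (eV γ)))
    rw [LinearMap.smul_apply, LinearMap.sum_apply] at h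
    have hterm (k : ℕ) (hk : k ∈ Finset.range p) :
        ((-heis B (toCartan α) (k + 1)) * annE B α (p - 1 - k)) (creE B β n (eV γ)) =
          (-B α β * signedChoose (B α β) (p - 1 - k)) • creE B β (n - p) (eV γ) := by
      rw [Finset.mem_range] at hk
      rw [show (p : ℤ) - 1 - k = (p - 1 - k : ℕ) by omega, Module.End.mul_apply,
        ih (p - 1 - k) (by omega), LinearMap.neg_apply, map_zsmul, heis_pos_creE hsymm,
        heis_eV_pos _ (by omega), map_zero, zero_add, baseChange_toCartan,
        show n - (p - 1 - k : ℕ) - (k + 1) = n - p by omega, ← Int.cast_smul_eq_zsmul ℂ,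
        ← Int.cast_smul_eq_zsmul ℂ]
      push_cast
      module
    rw [Finset.sum_congr rfl hterm, ← Finset.sum_smul, ← Finset.mul_sum,
      Finset.sum_range_reflect (fun j => signedChoose (B α β) j), sum_signedChoose, mul_smul,
      ← Int.cast_smul_eq_zsmul ℂ] at h
    exact smul_right_injective _ hp (by simpa using h)

/-- Combining `(1 - y/x)^{⟨α,β⟩}` with the power `x^{⟨α,β⟩}` from `z^α` gives `(x - y)^{⟨α,β⟩}`;
what remains is symmetric under exchanging `(α, x)` with `(β, y)`. -/
lemma eMode_eMode_eV (hsymm : B.IsSymm) (ε : L → L → ℂˣ) (α β γ : L) (m n : ℤ) :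
    eMode hsymm ε α m (eMode hsymm ε β n (eV γ)) =
      ((ε β γ : ℂ) * ε α (β + γ)) • expand (B α β) (fun m n =>
        creE B α (-m - 1 - B α γ) (creE B β (-n - 1 - B β γ) (eV (α + β + γ)))) m n := by
  rw [eMode_eV, map_smul]
  obtain ⟨u, hu⟩ := exists_creE_eV hsymm β (-n - 1 - B β γ)
  rw [hu, eMode_tmul, ← hu, smul_smul, expCoeff_apply, finsum_int_eq_finsum_nat, expand]
  · congr 1
    refine finsum_congr fun p => ?_
    rw [annE_creE_eV hsymm, map_zsmul, map_add, add_assoc,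
      show -m - 1 - (B α β + B α γ) + p = -(m + B α β - p) - 1 - B α γ by ring,
      show -n - 1 - B β γ - p = -(n + p) - 1 - B β γ by ring]
  · intro p hp
    rw [(isExpSeq_annE hsymm α).of_neg p hp, LinearMap.zero_apply, map_zero]

/-- The vertex operator `Y(e_α,z)`. -/
def eField (hsymm : B.IsSymm) (ε : L → L → ℂˣ) (α : L) : VertexOperator ℂ (VSpace L) :=
  ofModes (eMode hsymm ε α) (exists_eMode_eq_zero hsymm ε α)

lemma exists_heis_eq_zero (hsymm : B.IsSymm) (h : Cartan L) (v : VSpace L) :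
    ∃ N : ℤ, ∀ n, N ≤ n → heis B h n v = 0 := by
  induction v using vSpace_induction (B := B) with
  | zero => exact ⟨0, by simp⟩
  | eV γ => exact ⟨1, fun n hn => heis_eV_pos h (by omega) γ⟩
  | add v w hv hw =>
    obtain ⟨N, hN⟩ := hv
    obtain ⟨M, hM⟩ := hw
    exact ⟨max N M, fun n hn => by rw [map_add, hN n (by omega), hM n (by omega), add_zero]⟩
  | smul c v hv =>
    obtain ⟨N, hN⟩ := hv
    exact ⟨N, fun n hn => by rw [map_smul, hN n hn, smul_zero]⟩
  | heis h' k v hv =>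
    obtain ⟨N, hN⟩ := hv
    refine ⟨max N (k + 2), fun n hn => ?_⟩
    rw [heis_commutator hsymm, hN n (by omega), if_neg (by omega), map_zero, zero_smul, add_zero]

/-- The vertex operator `Y(h,z)`. -/
def hField (hsymm : B.IsSymm) (h : Cartan L) : VertexOperator ℂ (VSpace L) :=
  ofModes (heis B h) (exists_heis_eq_zero hsymm h)

@[simp] lemma ncoeff_eField (hsymm : B.IsSymm) (ε : L → L → ℂˣ) (α : L) (n : ℤ) :
    ncoeff (eField hsymm ε α) n = eMode hsymm ε α n := ncoeff_ofModes _ _ n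

@[simp] lemma ncoeff_hField (hsymm : B.IsSymm) (h : Cartan L) (n : ℤ) :
    ncoeff (hField hsymm h) n = heis B h n := ncoeff_ofModes _ _ n

lemma isLocal_hField_hField (hsymm : B.IsSymm) (h h' : Cartan L) :
    IsLocal (hField hsymm h) (hField hsymm h') := by
  have h0 (m n : ℤ) (w : VSpace L) : borcherdsProd (hField hsymm h) (hField hsymm h') 0 m n w =
      (if m + n = 0 then (m : ℂ) * B.baseChange ℂ h h' else 0) • w := by
    rw [borcherdsProd_zero, ncoeff_hField, ncoeff_hField, heis_commutator hsymm h h' m n w]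
    abel
  -- The commutator is a multiple of a first derivative of the delta function, so two factors `x -
  -- y` are needed.
  refine ⟨2, fun m n w => ?_⟩
  rw [show ((2 : ℕ) : ℤ) = 0 + 1 + 1 by norm_num]
  simp only [borcherdsProd_succ, h0]
  by_cases hmn : m + n = -2
  · rw [if_pos (by omega), if_pos (by omega), if_pos (by omega)]
    push_cast
    module
  · rw [if_neg (by omega), if_neg (by omega), if_neg (by omega)]
    simp

lemma isLocal_hField_eField (hsymm : B.IsSymm) (ε : L → L → ℂˣ) (h : Cartan L) (α : L) :
    IsLocal (hField hsymm h) (eField hsymm ε α) := by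
  have h0 (m n : ℤ) (w : VSpace L) : borcherdsProd (hField hsymm h) (eField hsymm ε α) 0 m n w =
      B.baseChange ℂ h (toCartan α) • eMode hsymm ε α (n + m) w := by
    rw [borcherdsProd_zero, ncoeff_hField, ncoeff_eField, heis_eMode hsymm ε h α m n w]
    abel
  refine ⟨1, fun m n w => ?_⟩
  rw [show ((1 : ℕ) : ℤ) = 0 + 1 by norm_num, borcherdsProd_succ, h0, h0,
    show n + (m + 1) = n + 1 + m by ring, sub_self]

/-- Take `N` with `M = ⟨α,β⟩ + N ≥ 0`. On `e_γ` both orders become multiples of the same polynomial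
expansion `(x - y)^M g`, and the cocycle condition equates the multiples. Commutators with `h(-k-1)`
extend the relation to all vectors. -/
lemma isLocal_eField_eField (hsymm : B.IsSymm) {ε : L → L → ℂˣ}
    (hcocycle : ∀ α β γ : L, ε α β * ε (α + β) γ = ε β γ * ε α (β + γ))
    (hcomm : ∀ α β : L, ε α β * (ε β α)⁻¹ = (-1) ^ (B α β)) (α β : L) :
    IsLocal (eField hsymm ε α) (eField hsymm ε β) := by
  have hc : ∃ N M : ℕ, B α β + N = M := ⟨(-B α β).toNat, (B α β).toNat, by omega⟩
  obtain ⟨N, M, hNM⟩ := hc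
  refine ⟨N, fun m n w => ?_⟩
  induction w using vSpace_induction (B := B) generalizing m n with
  | zero => exact borcherdsProd_map_zero _ _ _ _ _
  | add v w hv hw => rw [borcherdsProd_map_add, hv, hw, add_zero]
  | smul c v hv =>
    have h := hv m n
    rw [borcherdsProd] at h ⊢
    rw [orderedProd_map_smul, orderedProd_map_smul, smul_comm _ c, ← smul_sub, h, smul_zero]
  | heis h k v hv =>
    have h := borcherdsProd_commutator (A := eField hsymm ε α) (B := eField hsymm ε β)
      (H := heis B h (-(k + 1))) (k := -(k + 1))
      (fun n w => by simpa using heis_eMode hsymm ε h α (-(k + 1)) n w)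
      (fun n w => by simpa using heis_eMode hsymm ε h β (-(k + 1)) n w) N m n v
    rw [hv, hv, hv, map_zero, smul_zero, smul_zero, add_zero, add_zero] at h
    exact h.symm
  | eV γ =>
    set g : ℤ → ℤ → VSpace L := fun m n =>
      creE B α (-m - 1 - B α γ) (creE B β (-n - 1 - B β γ) (eV (α + β + γ))) with hg
    have hgt : IsTruncated g := ⟨-B β γ, fun m n hn => by
      rw [hg]; simp only
      rw [(isExpSeq_creE hsymm β).of_neg _ (by omega), LinearMap.zero_apply, map_zero]⟩
    have hgt' : IsTruncated fun n m => g m n := ⟨-B α γ, fun n m hm => by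
      rw [hg]; simp only
      rw [(isExpSeq_creE hsymm α).of_neg _ (by omega), LinearMap.zero_apply]⟩
    have h1 : orderedProd (eField hsymm ε α) (eField hsymm ε β) N m n (eV γ) =
        ((ε β γ : ℂ) * ε α (β + γ)) • expand M g m n := by
      simp only [orderedProd, ncoeff_eField, eMode_eMode_eV]
      rw [← hNM, ← expand_expand hgt, ← LinearMap.lsmul_apply, map_expand (hgt.expand _)]
      rfl
    have h2 : orderedProd (eField hsymm ε β) (eField hsymm ε α) N n m (eV γ) =
        ((ε α γ : ℂ) * ε β (α + γ)) • Int.negOnePow M • expand M g m n := by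
      rw [← expand_swap hgt hgt']
      simp only [orderedProd, ncoeff_eField, eMode_eMode_eV]
      rw [← hNM, ← expand_expand hgt', ← LinearMap.lsmul_apply, map_expand (hgt'.expand _)]
      have hs : B β α = B α β := hsymm.eq β α
      simp only [hs, add_comm β α, creE_comm hsymm β α]
      rfl
    have hsign : (-1 : ℂ) ^ (N : ℤ) * (-1) ^ (M : ℤ) = (-1) ^ (B α β) := by
      rw [← hNM, ← zpow_add₀ (by norm_num), show (N : ℤ) + (B α β + N) = B α β + 2 * N by ring,
        zpow_add₀ (by norm_num), zpow_mul]
      norm_num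
    -- The cocycle identity turns both sides into multiples of `ε(α + β, γ)`, leaving only the ratio
    -- of `ε α β` and `ε β α`.
    have hε : ε β γ * ε α (β + γ) = (-1) ^ (B α β) * (ε α γ * ε β (α + γ)) := by
      rw [← hcocycle, ← hcocycle, ← hcomm α β, add_comm β α, mul_assoc, inv_mul_cancel_left]
    have hε' := congrArg (Units.val : ℂˣ → ℂ) hε
    push_cast at hε'
    rw [borcherdsProd, h1, h2]
    simp only [Units.smul_def, ← Int.cast_smul_eq_zsmul ℂ, Int.cast_negOnePow, smul_smul]
    rw [hε', ← hsign]
    module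

end LatticeVA

namespace LatticeVA

open VertexData VertexOperator

variable {L : Type*} [AddCommGroup L] {B : LinearMap.BilinForm ℤ L}

/-! ### The lattice vertex algebra -/

lemma heis_neg_one_eV_zero (h : Cartan L) : heis B h (-1) (eV 0) = hV h := by
  simpa [eV, hV] using heis_neg_tmul B h 0 1 (Finsupp.single (0 : L) (1 : ℂ))

lemma eMode_neg_one_eV_zero (hsymm : B.IsSymm) {ε : L → L → ℂˣ} (hright : ∀ α : L, ε α 0 = 1)
    (α : L) : eMode hsymm ε α (-1) (eV 0) = eV α := by
  rw [eMode_eV, hright, map_zero, show -(-1 : ℤ) - 1 - 0 = 0 by norm_num,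
    (isExpSeq_creE hsymm α).zero, add_zero, Units.val_one, one_smul, Module.End.one_apply]

lemma transV_eV_zero : transV L (eV 0) = 0 := by
  rw [← bEquivV_eB, transV_bEquivV, bDeriv_eB]
  simp [toCartan, neg]

/-- The coefficients of `E⁻(-α,z)E⁺(-α,z)` in terms of the coefficients of the factors. -/
lemma finsum_coeff_eq_expCoeff (hsymm : B.IsSymm) (α : L) (c m : ℤ) (v : VSpace L) :
    (∑ᶠ p : ℕ × ℕ, if c + (p.1 : ℤ) - (p.2 : ℤ) = m then
      PowerSeries.coeff p.1 (Eminus B α) (PowerSeries.coeff p.2 (Eplus B α) v) else 0) =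
        expCoeff hsymm α (m - c) v := by
  obtain ⟨N, hN⟩ := exists_annE_eq_zero hsymm α v
  have hcre (n : ℕ) : PowerSeries.coeff n (Eminus B α) = creE B α n := by simp [creE]
  have hann (n : ℕ) : PowerSeries.coeff n (Eplus B α) = annE B α n := by simp [annE]
  simp only [hcre, hann]
  rw [expCoeff_apply, finsum_int_eq_finsum_nat, finsum_eq_sum_of_support_subset
    (s := Finset.range (m - c + N).toNat ×ˢ Finset.range N.toNat),
    finsum_eq_sum_of_support_subset (s := Finset.range N.toNat), Finset.sum_product_right]
  · refine Finset.sum_congr rfl fun q hq => ?_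
    rw [Finset.mem_range] at hq
    dsimp only
    rcases lt_or_ge (m - c + q) 0 with h | h
    · rw [(isExpSeq_creE hsymm α).of_neg _ h, LinearMap.zero_apply]
      exact Finset.sum_eq_zero fun p _ => if_neg (by omega)
    · rw [Finset.sum_eq_single (m - c + q).toNat]
      · rw [if_pos (by omega), Int.toNat_of_nonneg h]
      · intro p _ hp
        exact if_neg (by omega)
      · intro hp
        rw [Finset.mem_range] at hp
        omega
  · intro q hq
    by_contra h
    simp only [Finset.coe_range, Set.mem_Iio, not_lt] at h
    exact hq (by simp only [hN q (by omega), map_zero])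
  · intro p hp
    rw [Function.mem_support] at hp
    by_cases hm : c + (p.1 : ℤ) - (p.2 : ℤ) = m
    · rw [if_pos hm] at hp
      have hp2 : (p.2 : ℤ) < N := by
        by_contra h
        exact hp (by rw [hN _ (by omega), map_zero])
      simp only [Finset.coe_product, Finset.coe_range, Set.mem_prod, Set.mem_Iio]
      omega
    · exact absurd (if_neg hm) hp
  · intro p hp
    rw [(isExpSeq_annE hsymm α).of_neg p hp, LinearMap.zero_apply, map_zero]

lemma isLatticeVertexAlgebra_iff (hsymm : B.IsSymm) (ε : L → L → ℂˣ)
    (𝒱 : VertexData (VSpace L)) :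
    IsLatticeVertexAlgebra B ε 𝒱 ↔ 𝒱.IsVertexAlgebra ∧ 𝒱.vac = eV 0 ∧
      (∀ h n, 𝒱.mode (hV h) n = heis B h n) ∧ ∀ α n, 𝒱.mode (eV α) n = eMode hsymm ε α n := by
  have key (α : L) : (∀ n, 𝒱.mode (eV α) n = eMode hsymm ε α n) ↔
      ∀ (β : L) (u : Fock L) (m : ℤ),
      HVertexOperator.coeff (𝒱.Y (eV α)) m (u ⊗ₜ[ℂ] Finsupp.single β 1) =
      ∑ᶠ p : ℕ × ℕ, if B α β + (p.1 : ℤ) - (p.2 : ℤ) = m then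
        PowerSeries.coeff p.1 (Eminus B α) (PowerSeries.coeff p.2 (Eplus B α)
          ((ε α β : ℂ) • (u ⊗ₜ[ℂ] Finsupp.single (α + β) (1 : ℂ)))) else 0 := by
    have hc (m : ℤ) : HVertexOperator.coeff (𝒱.Y (eV α)) m = 𝒱.mode (eV α) (-m - 1) := by
      rw [mode, coeff_eq_ncoeff]
    simp only [finsum_coeff_eq_expCoeff hsymm, hc]
    simp only [map_smul]
    constructor
    · intro h β u m
      rw [h, eMode_tmul]
      congr 3
      ring
    · intro h n
      refine LinearMap.ext fun v => ?_
      induction v using vSpace_induction_tmul with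
      | zero => simp
      | add v w hv hw => rw [map_add, map_add, hv, hw]
      | tmul u β =>
        have h' := h β u (-n - 1)
        rwa [show -(-n - 1) - 1 = n by ring, ← eMode_tmul] at h'
  constructor
  · rintro ⟨h1, h2, h3, h4⟩
    exact ⟨h1, h2, h3, fun α => (key α).mpr (h4 α)⟩
  · rintro ⟨h1, h2, h3, h4⟩
    exact ⟨h1, h2, h3, fun α => (key α).mp (h4 α)⟩

/-- Reconstruction from the fields `Y(h,z)` and `Y(e_α,z)`. They generate: `(e_α)_{-1}` sends the
vacuum to `e_α`, and the `h(-k-1)` produce the rest. -/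
theorem exists_isLatticeVertexAlgebra (hsymm : B.IsSymm) {ε : L → L → ℂˣ}
    (hcocycle : ∀ α β γ : L, ε α β * ε (α + β) γ = ε β γ * ε α (β + γ))
    (hcomm : ∀ α β : L, ε α β * (ε β α)⁻¹ = (-1) ^ (B α β)) (hright : ∀ α : L, ε α 0 = 1) :
    ∃ 𝒱 : VertexData (VSpace L), IsLatticeVertexAlgebra B ε 𝒱 := by
  have hex := exists_isVertexAlgebra (eV (0 : L)) (transV L) transV_eV_zero
    (Set.range (hField hsymm) ∪ Set.range (eField hsymm ε))
  refine Exists.elim (hex ?_ ?_ ?_ ?_) fun 𝒱 h => ?_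
  · rintro _ (⟨h, rfl⟩ | ⟨α, rfl⟩) _ (⟨h', rfl⟩ | ⟨β, rfl⟩)
    · exact isLocal_hField_hField hsymm h h'
    · exact isLocal_hField_eField hsymm ε h β
    · exact (isLocal_hField_eField hsymm ε h' α).symm
    · exact isLocal_eField_eField hsymm hcocycle hcomm α β
  · rintro _ (⟨h, rfl⟩ | ⟨α, rfl⟩) n w
    · simpa using transV_heis hsymm h n w
    · simpa using transV_eMode hsymm ε α n w
  · rintro _ (⟨h, rfl⟩ | ⟨α, rfl⟩) n hn
    · rw [ncoeff_hField]
      rcases hn.eq_or_lt with rfl | hn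
      · rw [heis_zero_eV]
        simp [toCartan]
      · exact heis_eV_pos h hn 0
    · rw [ncoeff_eField, eMode_eV, (isExpSeq_creE hsymm α).of_neg _ (by rw [map_zero]; omega),
        LinearMap.zero_apply, smul_zero]
  · intro p h0 hp
    refine eq_top_iff.mpr fun v _ => ?_
    induction v using vSpace_induction (B := B) with
    | zero => exact p.zero_mem
    | eV α =>
      have h := hp _ (Or.inr ⟨α, rfl⟩) (-1) _ h0
      rwa [ncoeff_eField, eMode_neg_one_eV_zero hsymm hright] at h
    | add v w hv hw => exact p.add_mem (hv trivial) (hw trivial)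
    | smul c v hv => exact p.smul_mem c (hv trivial)
    | heis h k v hv =>
      have h := hp _ (Or.inl ⟨h, rfl⟩) (-(k + 1)) _ (hv trivial)
      rwa [ncoeff_hField] at h
  · obtain ⟨h1, h2, h3⟩ := h
    refine ⟨𝒱, (isLatticeVertexAlgebra_iff hsymm ε 𝒱).mpr ⟨h1, h2, fun h n => ?_, fun α n => ?_⟩⟩
    · have h4 := h3 _ (Or.inl ⟨h, rfl⟩)
      rw [ncoeff_hField, heis_neg_one_eV_zero] at h4
      rw [mode, h4, ncoeff_hField]
    · have h4 := h3 _ (Or.inr ⟨α, rfl⟩)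
      rw [ncoeff_eField, eMode_neg_one_eV_zero hsymm hright] at h4
      rw [mode, h4, ncoeff_eField]

/-- The modes of `e_α` and `h` are prescribed. Those of `h(-k-1)v` follow by associativity, here
`map_mode_mode` for the identity map. -/
theorem IsLatticeVertexAlgebra.unique (hsymm : B.IsSymm) {ε : L → L → ℂˣ}
    {𝒱 𝒲 : VertexData (VSpace L)} (h𝒱 : IsLatticeVertexAlgebra B ε 𝒱)
    (h𝒲 : IsLatticeVertexAlgebra B ε 𝒲) : 𝒱 = 𝒲 := by
  obtain ⟨hV1, hV2, hV3, hV4⟩ := (isLatticeVertexAlgebra_iff hsymm ε 𝒱).mp h𝒱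
  obtain ⟨hW1, hW2, hW3, hW4⟩ := (isLatticeVertexAlgebra_iff hsymm ε 𝒲).mp h𝒲
  refine ext_mode (fun v => ?_) (hV2.trans hW2.symm)
  induction v using vSpace_induction (B := B) with
  | zero => simp
  | eV α => simp only [hV4, hW4, implies_true]
  | add v w hv hw => intro n; rw [mode_add_left, mode_add_left, hv, hw]
  | smul c v hv => intro n; rw [mode_smul_left, mode_smul_left, hv]
  | heis h k v hv =>
    intro n
    refine LinearMap.ext fun w => ?_
    have key := hV1.map_mode_mode hW1 LinearMap.id (u := hV h) (v := v)
      (fun n w => by simp [hV3, hW3]) (fun n w => by simp [hv]) (-(k + 1)) n w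
    simpa [hV3] using key

end LatticeVA

/-! ### Tensor modes with a vacuum factor, and a commutator formula -/

namespace VertexData

open VertexOperator

variable {V W : Type*} [AddCommGroup V] [Module ℂ V] [AddCommGroup W] [Module ℂ W]

lemma tensor_mode_tmul_vac (𝒱 : VertexData V) {𝒲 : VertexData W} (h𝒲 : 𝒲.IsVertexAlgebra)
    (u v : V) (b : W) (n : ℤ) :
    (𝒱.tensor 𝒲).mode (u ⊗ₜ 𝒲.vac) n (v ⊗ₜ b) = 𝒱.mode u n v ⊗ₜ b := by
  rw [tensor_mode_tmul, finsum_eq_single _ n]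
  · rw [h𝒲.vacuum, if_pos (by ring)]
  · intro j hj
    rw [h𝒲.vacuum, if_neg (by omega), TensorProduct.tmul_zero]

lemma tensor_mode_vac_tmul {𝒱 : VertexData V} (h𝒱 : 𝒱.IsVertexAlgebra) (𝒲 : VertexData W)
    (v : V) (a b : W) (n : ℤ) :
    (𝒱.tensor 𝒲).mode (𝒱.vac ⊗ₜ a) n (v ⊗ₜ b) = v ⊗ₜ 𝒲.mode a n b := by
  rw [tensor_mode_tmul, finsum_eq_single _ (-1)]
  · rw [h𝒱.vacuum, if_pos rfl, show n - 1 - -1 = n by ring]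
  · intro j hj
    rw [h𝒱.vacuum, if_neg hj, TensorProduct.zero_tmul]

/-- The commutator formula for a vector `u` acting on `v` through an eigenvalue of `u_0`. -/
lemma IsVertexAlgebra.mode_commutator {𝒱 : VertexData V} (h𝒱 : 𝒱.IsVertexAlgebra) {u v : V}
    {c : ℂ} (h0 : 𝒱.mode u 0 v = c • v) (hpos : ∀ n, 0 < n → 𝒱.mode u n v = 0) (m n : ℤ)
    (w : V) :
    𝒱.mode u m (𝒱.mode v n w) = 𝒱.mode v n (𝒱.mode u m w) + c • 𝒱.mode v (n + m) w := by
  have h := h𝒱.jacobi u v w 0 m n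
  rw [finsum_eq_single _ 0, finsum_eq_single _ 0] at h
  · simp only [Ring.choose_zero_right, Nat.cast_zero, add_zero, one_smul, h0, sub_zero, pow_zero,
      mul_one, Int.negOnePow_zero, mode_smul_left, LinearMap.smul_apply] at h
    rw [add_comm n m, h]
    abel
  · intro i hi
    obtain ⟨j, rfl⟩ := Nat.exists_eq_succ_of_ne_zero hi
    rw [Nat.succ_eq_add_one, Ring.choose_zero_succ, mul_zero, zero_smul]
  · intro i hi
    rw [hpos _ (by omega), mode_zero_left, LinearMap.zero_apply, smul_zero]

end VertexData

/-! ### Coactions transported from a comultiplication -/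

section Coaction

variable {C V : Type*} [AddCommGroup C] [Module ℂ C] [Coalgebra ℂ C] [AddCommGroup V] [Module ℂ V]

/-- The right coaction on `V` obtained from the comultiplication of `C` by a linear equivalence. -/
def coactionOfEquiv (e : C ≃ₗ[ℂ] V) : V →ₗ[ℂ] V ⊗[ℂ] C :=
  e.toLinearMap.rTensor C ∘ₗ Coalgebra.comul ∘ₗ e.symm.toLinearMap

lemma coactionOfEquiv_apply (e : C ≃ₗ[ℂ] V) (c : C) :
    coactionOfEquiv e (e c) = e.toLinearMap.rTensor C (Coalgebra.comul c) := by
  simp [coactionOfEquiv]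

lemma coactionOfEquiv_coassoc (e : C ≃ₗ[ℂ] V) :
    (TensorProduct.assoc ℂ V C C).toLinearMap ∘ₗ (coactionOfEquiv e).rTensor C ∘ₗ
      coactionOfEquiv e =
        (Coalgebra.comul (R := ℂ) (A := C)).lTensor V ∘ₗ coactionOfEquiv e := by
  have key (z : C ⊗[ℂ] C) : TensorProduct.assoc ℂ V C C ((coactionOfEquiv e).rTensor C
      (e.toLinearMap.rTensor C z)) = e.toLinearMap.rTensor (C ⊗[ℂ] C)
        (TensorProduct.assoc ℂ C C C ((Coalgebra.comul (R := ℂ) (A := C)).rTensor C z)) := by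
    induction z using TensorProduct.induction_on with
    | zero => simp
    | add x y hx hy => simp only [map_add, hx, hy]
    | tmul x y =>
      simp only [LinearMap.rTensor_tmul, LinearEquiv.coe_coe, coactionOfEquiv_apply]
      generalize Coalgebra.comul (R := ℂ) x = z
      induction z using TensorProduct.induction_on with
      | zero => simp
      | add x y hx hy => simp only [map_add, TensorProduct.add_tmul, hx, hy]
      | tmul x y => simp
  refine LinearMap.ext fun v => ?_
  obtain ⟨c, rfl⟩ := e.surjective v
  simp only [LinearMap.comp_apply, coactionOfEquiv_apply, LinearEquiv.coe_coe, key,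
    Coalgebra.coassoc_apply]
  generalize Coalgebra.comul (R := ℂ) c = z
  induction z using TensorProduct.induction_on with
  | zero => simp
  | add x y hx hy => simp only [map_add, hx, hy]
  | tmul x y => simp

lemma coactionOfEquiv_counit (e : C ≃ₗ[ℂ] V) :
    (TensorProduct.rid ℂ V).toLinearMap ∘ₗ (Coalgebra.counit (R := ℂ) (A := C)).lTensor V ∘ₗ
      coactionOfEquiv e = LinearMap.id := by
  refine LinearMap.ext fun v => ?_
  obtain ⟨c, rfl⟩ := e.surjective v
  have h : (Coalgebra.counit (R := ℂ) (A := C)).lTensor V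
      (e.toLinearMap.rTensor C (Coalgebra.comul c)) = e.toLinearMap.rTensor ℂ (c ⊗ₜ 1) := by
    rw [← Coalgebra.lTensor_counit_comul]
    generalize Coalgebra.comul (R := ℂ) c = z
    induction z using TensorProduct.induction_on with
    | zero => simp
    | add x y hx hy => simp only [map_add, hx, hy]
    | tmul x y => simp
  simp only [LinearMap.comp_apply, coactionOfEquiv_apply, h]
  simp

end Coaction

namespace LatticeVA

open VertexData VertexOperator

variable {L : Type*} [AddCommGroup L] {B : LinearMap.BilinForm ℤ L}

/-! ### The coaction -/

variable (L) in
/-- The coaction of `B_L` on `V_L`. -/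
def coaction : VSpace L →ₗ[ℂ] VSpace L ⊗[ℂ] BSpace L := coactionOfEquiv (bEquivV L)

lemma coaction_eV (α : L) : coaction L (eV α) = eV α ⊗ₜ[ℂ] eB α := by
  rw [coaction, ← bEquivV_eB, coactionOfEquiv_apply, comul_eB]
  rfl

variable (B) in
/-- The operator `h(-k-1) ⊗ 1 + 1 ⊗ h(-k-1)` on `V_L ⊗ B_L`. -/
def negTensor (h : Cartan L) (k : ℕ) : Module.End ℂ (VSpace L ⊗[ℂ] BSpace L) :=
  (heis B h (-(k + 1))).rTensor (BSpace L) +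
    (LinearMap.mulLeft ℂ (neg h k ⊗ₜ[ℂ] (1 : AddMonoidAlgebra ℂ L))).lTensor (VSpace L)

lemma negTensor_tmul (h : Cartan L) (k : ℕ) (x : VSpace L) (y : BSpace L) :
    negTensor B h k (x ⊗ₜ y) = heis B h (-(k + 1)) x ⊗ₜ y + x ⊗ₜ ((neg h k ⊗ₜ[ℂ] 1) * y) := by
  simp [negTensor]

/-- On `B_L` this operator is multiplication by a primitive element, and the comultiplication is
multiplicative. -/
lemma coaction_heis_neg (h : Cartan L) (k : ℕ) (v : VSpace L) :
    coaction L (heis B h (-(k + 1)) v) = negTensor B h k (coaction L v) := by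
  obtain ⟨c, rfl⟩ := (bEquivV L).surjective v
  rw [← bEquivV_neg_mul, coaction, coactionOfEquiv_apply, coactionOfEquiv_apply,
    Bialgebra.comul_mul, comul_neg]
  generalize Coalgebra.comul (R := ℂ) c = z
  induction z using TensorProduct.induction_on with
  | zero => simp
  | add x y hx hy => rw [mul_add, map_add, hx, hy, map_add, map_add]
  | tmul x y =>
    rw [add_mul, Algebra.TensorProduct.tmul_mul_tmul, Algebra.TensorProduct.tmul_mul_tmul, one_mul,
      one_mul, map_add, LinearMap.rTensor_tmul, LinearMap.rTensor_tmul, LinearMap.rTensor_tmul,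
      negTensor_tmul]
    congr 2
    exact bEquivV_neg_mul h k x

/-- The operator `h(n) ⊗ 1` commutes with `1 ⊗ h'(-k-1)` and has with `h'(-k-1) ⊗ 1` the same scalar
commutator as on `V_L`, so it suffices to compare on the `e_γ`. -/
lemma coaction_heis_of_nonneg (hsymm : B.IsSymm) (h : Cartan L) {n : ℤ} (hn : 0 ≤ n)
    (v : VSpace L) :
    coaction L (heis B h n v) = (heis B h n).rTensor (BSpace L) (coaction L v) := by
  induction v using vSpace_induction (B := B) with
  | zero => simp
  | add v w hv hw => simp only [map_add, hv, hw]
  | smul c v hv => simp only [map_smul, hv]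
  | eV γ =>
    rw [coaction_eV, LinearMap.rTensor_tmul]
    rcases hn.eq_or_lt with rfl | hn
    · rw [heis_zero_eV, map_smul, coaction_eV, TensorProduct.smul_tmul']
    · rw [heis_eV_pos h hn, map_zero, TensorProduct.zero_tmul]
  | heis h' k v hv =>
    rw [heis_commutator hsymm, map_add, map_smul, coaction_heis_neg, coaction_heis_neg, hv]
    generalize coaction L v = z
    induction z using TensorProduct.induction_on with
    | zero => simp
    | add x y hx hy => simp only [map_add, smul_add, ← hx, ← hy]; abel
    | tmul x y =>
      simp only [LinearMap.rTensor_tmul, negTensor_tmul, map_add, heis_commutator hsymm h h' n,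
        TensorProduct.add_tmul, TensorProduct.smul_tmul']
      abel

lemma eB_zero : (eB 0 : BSpace L) = 1 := rfl

lemma coaction_hV (h : Cartan L) :
    coaction L (hV h) = hV h ⊗ₜ[ℂ] 1 + eV 0 ⊗ₜ[ℂ] hB h := by
  -- Negative modes do not involve the bilinear form, so the zero form can be used.
  have h0 := coaction_heis_neg (B := 0) h 0 (eV 0)
  rw [coaction_eV, negTensor_tmul] at h0
  simp only [CharP.cast_eq_zero, zero_add, heis_neg_one_eV_zero, eB_zero, mul_one] at h0
  exact h0

/-! ### The vertex operators of `B_L` -/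

lemma bDeriv_iterate_neg (h : Cartan L) (k : ℕ) :
    (k.factorial : ℂ)⁻¹ • ((bDeriv (L := L) : BSpace L →ₗ[ℂ] BSpace L))^[k] (hB h) =
      neg h k ⊗ₜ[ℂ] (1 : AddMonoidAlgebra ℂ L) := by
  have key : ((bDeriv (L := L) : BSpace L →ₗ[ℂ] BSpace L))^[k] (hB h) =
      (k.factorial : ℂ) • (neg h k ⊗ₜ[ℂ] (1 : AddMonoidAlgebra ℂ L)) := by
    induction k with
    | zero => rw [Nat.factorial_zero, Nat.cast_one, one_smul]; rfl
    | succ k ih =>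
      rw [Function.iterate_succ_apply', ih, map_smul, Derivation.coeFn_coe, bDeriv_neg, smul_smul,
        Nat.factorial_succ]
      push_cast
      rw [mul_comm]
  rw [key, smul_smul, inv_mul_cancel₀ (by exact_mod_cast k.factorial_ne_zero), one_smul]

lemma vertexB_mode_hB_neg (h : Cartan L) (k : ℕ) (y : BSpace L) :
    (vertexB L).mode (hB h) (-(k + 1)) y = (neg h k ⊗ₜ[ℂ] 1) * y := by
  rw [show -((k : ℤ) + 1) = -1 - k by ring, vertexB,
    borcherds_mode_natCast (A := BSpace L) (bDeriv (L := L)), bDeriv_iterate_neg]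

lemma vertexB_mode_of_nonneg (x y : BSpace L) {n : ℤ} (hn : 0 ≤ n) :
    (vertexB L).mode x n y = 0 :=
  borcherds_mode_of_nonneg (A := BSpace L) (bDeriv (L := L)) x y hn

end LatticeVA

namespace LatticeVA

open VertexData VertexOperator

variable {L : Type*} [AddCommGroup L] {B : LinearMap.BilinForm ℤ L} {ε : L → L → ℂˣ}
  {𝒱 : VertexData (VSpace L)}

/-! ### The coaction is a homomorphism -/

lemma vertexB_isVertexAlgebra : (vertexB L).IsVertexAlgebra :=
  vertexB_isVertexBialgebra.isVertexAlgebra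

lemma coaction_hV_mode (hsymm : B.IsSymm) (h𝒱 : IsLatticeVertexAlgebra B ε 𝒱) (h : Cartan L)
    (n : ℤ) (v : VSpace L) :
    coaction L (heis B h n v) =
      (𝒱.tensor (vertexB L)).mode (coaction L (hV h)) n (coaction L v) := by
  have key (x : VSpace L) (y : BSpace L) :
      (𝒱.tensor (vertexB L)).mode (coaction L (hV h)) n (x ⊗ₜ y) =
        heis B h n x ⊗ₜ y + x ⊗ₜ (vertexB L).mode (hB h) n y := by
    have h1 := tensor_mode_tmul_vac 𝒱 (vertexB_isVertexAlgebra (L := L)) (hV h) x y n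
    have h2 := tensor_mode_vac_tmul h𝒱.isVertexAlgebra (vertexB L) x (hB h) y n
    rw [h𝒱.Y_h] at h1
    rw [h𝒱.vac_eq] at h2
    rw [coaction_hV, mode_add_left, LinearMap.add_apply, ← h1, ← h2]
    rfl
  rcases le_or_gt 0 n with hn | hn
  · rw [coaction_heis_of_nonneg hsymm h hn]
    generalize coaction L v = z
    induction z using TensorProduct.induction_on with
    | zero => simp
    | add x y hx hy => rw [map_add, map_add, hx, hy]
    | tmul x y =>
      rw [key, vertexB_mode_of_nonneg _ _ hn, TensorProduct.tmul_zero, add_zero,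
        LinearMap.rTensor_tmul]
  · obtain ⟨k, rfl⟩ : ∃ k : ℕ, n = -(k + 1) := ⟨(-n - 1).toNat, by omega⟩
    rw [coaction_heis_neg]
    generalize coaction L v = z
    induction z using TensorProduct.induction_on with
    | zero => simp
    | add x y hx hy => rw [map_add, map_add, hx, hy]
    | tmul x y => rw [key, vertexB_mode_hB_neg, negTensor_tmul]

lemma vertexB_mode_neg_one (x y : BSpace L) : (vertexB L).mode x (-1) y = x * y := by
  have h := borcherds_mode_natCast (A := BSpace L) (bDeriv (L := L)) x y 0
  rw [Nat.factorial_zero, Nat.cast_one, inv_one, one_smul, Function.iterate_zero_apply] at h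
  exact h

lemma vertexB_mode_neg_two (x y : BSpace L) : (vertexB L).mode x (-2) y = bDeriv x * y := by
  have h := borcherds_mode_natCast (A := BSpace L) (bDeriv (L := L)) x y 1
  simp only [Nat.factorial_one, Nat.cast_one, inv_one, one_smul, Function.iterate_one] at h
  exact h

lemma creE_one (hsymm : B.IsSymm) (α : L) (v : VSpace L) :
    creE B α 1 v = heis B (toCartan α) (-1) v := by
  have h := congr($((isExpSeq_creE hsymm α).recurrence 1 1 (by norm_num)) v)
  rw [Finset.sum_range_one] at h
  simp only [Int.cast_one, one_smul, Nat.cast_zero, zero_add, sub_self,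
    (isExpSeq_creE hsymm α).zero, mul_one] at h
  exact h

/-- On `e_γ` both sides are `γ(-1)e_γ ⊗ e^γ + e_γ ⊗ ∂e^γ`. Covariance of the fields of `h` and
`ρ(h)` carries the equality to all vectors. -/
lemma coaction_transV (hsymm : B.IsSymm) (hright : ∀ α : L, ε α 0 = 1)
    (h𝒱 : IsLatticeVertexAlgebra B ε 𝒱) (v : VSpace L) :
    coaction L (transV L v) = (𝒱.tensor (vertexB L)).translation (coaction L v) := by
  have hten := h𝒱.isVertexAlgebra.tensor (vertexB_isVertexAlgebra (L := L))
  induction v using vSpace_induction (B := B) with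
  | zero => simp
  | add v w hv hw => rw [map_add, map_add, hv, hw, map_add, map_add]
  | smul c v hv => rw [map_smul, map_smul, hv, map_smul, map_smul]
  | eV γ =>
    have he := ((isLatticeVertexAlgebra_iff hsymm ε 𝒱).mp h𝒱).2.2.2 γ
    have h1 : 𝒱.mode (eV γ) (-1) (eV 0) = eV γ := by
      rw [he, eMode_neg_one_eV_zero hsymm hright]
    have h2 : 𝒱.mode (eV γ) (-2) (eV 0) = heis B (toCartan γ) (-1) (eV γ) := by
      rw [he, eMode_eV, hright, map_zero, show -(-2 : ℤ) - 1 - 0 = 1 by norm_num,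
        creE_one hsymm, add_zero, Units.val_one, one_smul]
    have h3 := coaction_heis_neg (B := B) (toCartan γ) 0 (eV γ)
    rw [coaction_eV, negTensor_tmul, ← bDeriv_eB] at h3
    simp only [CharP.cast_eq_zero, zero_add] at h3
    have h4 : (𝒱.tensor (vertexB L)).translation (eV γ ⊗ₜ eB γ) =
        (𝒱.tensor (vertexB L)).mode (eV γ ⊗ₜ eB γ) (-2) (eV 0 ⊗ₜ 1) := by
      rw [← h𝒱.vac_eq]
      rfl
    rw [transV_eV (B := B), h3, coaction_eV, h4, tensor_mode_tmul,
      -- Terms with `j ≥ 0` vanish by creation in `V_L`. Those with `j ≤ -3` vanish because `B_L`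
      -- has only negative modes.
      finsum_eq_sum_of_support_subset (s := {-2, -1}), Finset.sum_pair (by norm_num), h1, h2,
      show (-2 : ℤ) - 1 - -2 = -1 by norm_num, show (-2 : ℤ) - 1 - -1 = -2 by norm_num,
      vertexB_mode_neg_one, vertexB_mode_neg_two, mul_one, mul_one]
    intro j hj
    by_contra hj'
    simp only [Finset.coe_insert, Finset.coe_singleton, Set.mem_insert_iff,
      Set.mem_singleton_iff, not_or] at hj'
    apply hj
    dsimp only
    rcases le_or_gt 0 j with h | h
    · rw [← h𝒱.vac_eq, h𝒱.isVertexAlgebra.creation_regular _ _ h, TensorProduct.zero_tmul]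
    · rw [vertexB_mode_of_nonneg _ _ (by omega), TensorProduct.tmul_zero]
  | heis h k v hv =>
    have h1 := hten.isCovariant (coaction L (hV h)) (-(k + 1)) (coaction L v)
    change _ = (𝒱.tensor (vertexB L)).mode _ _ _ - _ • (𝒱.tensor (vertexB L)).mode _ _ _ at h1
    rw [transV_heis hsymm, map_sub, map_zsmul, coaction_hV_mode hsymm h𝒱, hv,
      coaction_hV_mode hsymm h𝒱, coaction_hV_mode hsymm h𝒱, ← h1]
    rfl

lemma eq_of_sub_smul_sub_zsmul {M : Type*} [AddCommGroup M] [Module ℂ M] {a b x : M} {c : ℂ} {n : ℤ}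
    (hc : c + n ≠ 0) (h : x - c • a - n • a = x - c • b - n • b) : a = b := by
  rw [sub_sub, sub_sub, sub_right_inj, ← Int.cast_smul_eq_zsmul ℂ, ← Int.cast_smul_eq_zsmul ℂ,
    ← add_smul, ← add_smul] at h
  exact smul_right_injective _ hc h

/-- Compatibility of the coaction with the modes of `e_α`, on the vectors `e_γ`. -/
lemma coaction_eMode_eV (hsymm : B.IsSymm) (hright : ∀ α : L, ε α 0 = 1)
    (h𝒱 : IsLatticeVertexAlgebra B ε 𝒱) (α : L)
    (hcomm : ∀ (h : Cartan L) (m n : ℤ) (w : VSpace L ⊗[ℂ] BSpace L),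
      (𝒱.tensor (vertexB L)).mode (coaction L (hV h)) m
          ((𝒱.tensor (vertexB L)).mode (coaction L (eV α)) n w) =
        (𝒱.tensor (vertexB L)).mode (coaction L (eV α)) n
            ((𝒱.tensor (vertexB L)).mode (coaction L (hV h)) m w) +
          B.baseChange ℂ h (toCartan α) •
            (𝒱.tensor (vertexB L)).mode (coaction L (eV α)) (n + m) w) (γ : L) (n : ℤ) :
    coaction L (eMode hsymm ε α n (eV γ)) =
      (𝒱.tensor (vertexB L)).mode (coaction L (eV α)) n (coaction L (eV γ)) := by
  have hten := h𝒱.isVertexAlgebra.tensor (vertexB_isVertexAlgebra (L := L))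
  have he := ((isLatticeVertexAlgebra_iff hsymm ε 𝒱).mp h𝒱).2.2.2 α
  have hs : B γ α = B α γ := hsymm.eq γ α
  have hzero (j : ℤ) (hj : -B α γ ≤ j) : eMode hsymm ε α j (eV γ) = 0 := by
    rw [eMode_eV, (isExpSeq_creE hsymm α).of_neg _ (by omega), LinearMap.zero_apply, smul_zero]
  -- `(e_α)_j e_γ = 0` for `j ≥ -⟨α,γ⟩`, and `e^α` has no nonnegative modes. Only `j = n` can
  -- contribute, and it is nonzero just for the leading index `-⟨α,γ⟩ - 1`.
  have hlarge (n : ℤ) (hn : -B α γ - 1 ≤ n) : coaction L (eMode hsymm ε α n (eV γ)) =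
      (𝒱.tensor (vertexB L)).mode (coaction L (eV α)) n (coaction L (eV γ)) := by
    rw [coaction_eV, coaction_eV, tensor_mode_tmul, finsum_eq_single _ n]
    · rw [he, show n - 1 - n = -1 by ring, vertexB_mode_neg_one]
      rcases hn.eq_or_lt with rfl | hn
      · rw [eMode_eV, show -(-B α γ - 1) - 1 - B α γ = 0 by ring, (isExpSeq_creE hsymm α).zero,
          map_smul, Module.End.one_apply, coaction_eV, TensorProduct.smul_tmul']
        congr 1
        simp [eB, AddMonoidAlgebra.single_mul_single]
      · rw [hzero n (by omega), map_zero, TensorProduct.zero_tmul]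
    · intro j hj
      rcases lt_or_gt_of_ne hj with h | h
      · rw [vertexB_mode_of_nonneg _ _ (by omega), TensorProduct.tmul_zero]
      · rw [he, hzero j (by omega), TensorProduct.zero_tmul]
  rcases le_or_gt (-B α γ - 1) n with hn | hn
  · exact hlarge n hn
  obtain ⟨k, rfl⟩ : ∃ k : ℕ, n = -B α γ - 1 - k := ⟨(-B α γ - 1 - n).toNat, by omega⟩
  clear hn
  induction k with
  | zero => exact hlarge _ (by simp)
  | succ k ih =>
    set n : ℤ := -B α γ - 1 - k with hn
    -- Translate the equality at `n`. Covariance and the commutator with `γ(-1)` turn both sides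
    -- into a common term minus `⟨α,γ⟩ + n` times the modes at `n - 1`. The factor is `-(k + 1) ≠
    -- 0`, so those modes agree.
    have hT : coaction L (transV L (eMode hsymm ε α n (eV γ))) =
        (𝒱.tensor (vertexB L)).translation
          ((𝒱.tensor (vertexB L)).mode (coaction L (eV α)) n (coaction L (eV γ))) := by
      rw [coaction_transV hsymm hright h𝒱, ih]
    have h1 : (𝒱.tensor (vertexB L)).translation
          ((𝒱.tensor (vertexB L)).mode (coaction L (eV α)) n (coaction L (eV γ))) =
        (𝒱.tensor (vertexB L)).mode (coaction L (eV α)) n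
          ((𝒱.tensor (vertexB L)).translation (coaction L (eV γ))) -
        n • (𝒱.tensor (vertexB L)).mode (coaction L (eV α)) (n - 1) (coaction L (eV γ)) :=
      hten.isCovariant (coaction L (eV α)) n (coaction L (eV γ))
    have h2 := sub_eq_iff_eq_add.mpr (heis_eMode hsymm ε (toCartan γ) α (-1) n (eV γ))
    have h3 : (𝒱.tensor (vertexB L)).mode (coaction L (eV α)) n
          ((𝒱.tensor (vertexB L)).mode (coaction L (hV (toCartan γ))) (-1) (coaction L (eV γ))) =
        (𝒱.tensor (vertexB L)).mode (coaction L (hV (toCartan γ))) (-1)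
          ((𝒱.tensor (vertexB L)).mode (coaction L (eV α)) n (coaction L (eV γ))) -
        B.baseChange ℂ (toCartan γ) (toCartan α) •
          (𝒱.tensor (vertexB L)).mode (coaction L (eV α)) (n + -1) (coaction L (eV γ)) := by
      rw [hcomm]
      abel
    rw [transV_eMode, transV_eV (B := B), ← h2, h1, ← coaction_transV hsymm hright h𝒱,
      transV_eV (B := B), coaction_hV_mode hsymm h𝒱, h3, map_sub, map_sub,
      coaction_hV_mode hsymm h𝒱, ih, map_smul, map_zsmul, baseChange_toCartan, hs,
      ← sub_eq_add_neg n 1] at hT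
    rw [show -B α γ - 1 - ((k + 1 : ℕ) : ℤ) = n - 1 by rw [hn]; push_cast; ring]
    refine eq_of_sub_smul_sub_zsmul ?_ hT
    rw [hn]
    push_cast
    intro h
    have h' : ((k + 1 : ℕ) : ℂ) = 0 := by
      push_cast
      linear_combination -h
    exact absurd h' (Nat.cast_ne_zero.mpr (Nat.succ_ne_zero k))

/-- Induction on `u` by `map_mode_mode` leaves `u = h` and `u = e_α`. For `e_α`, induction on `v`
through commutators with the modes of `h` leaves `v = e_γ`. -/
theorem coaction_isHom (hsymm : B.IsSymm) (hright : ∀ α : L, ε α 0 = 1)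
    (h𝒱 : IsLatticeVertexAlgebra B ε 𝒱) : IsHom 𝒱 (𝒱.tensor (vertexB L)) (coaction L) where
  map_vac := by
    rw [h𝒱.vac_eq, coaction_eV, eB_zero, ← h𝒱.vac_eq]
    rfl
  map_mode := by
    have hten := h𝒱.isVertexAlgebra.tensor (vertexB_isVertexAlgebra (L := L))
    have he := ((isLatticeVertexAlgebra_iff hsymm ε 𝒱).mp h𝒱).2.2.2
    have hh (h : Cartan L) (n : ℤ) (w : VSpace L) :
        coaction L (𝒱.mode (hV h) n w) =
          (𝒱.tensor (vertexB L)).mode (coaction L (hV h)) n (coaction L w) := by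
      rw [h𝒱.Y_h, coaction_hV_mode hsymm h𝒱]
    intro u v n
    induction u using vSpace_induction (B := B) generalizing v n with
    | zero => simp
    | add u u' hu hu' =>
      rw [mode_add_left, LinearMap.add_apply, map_add, hu, hu', map_add, mode_add_left,
        LinearMap.add_apply]
    | smul c u hu =>
      rw [mode_smul_left, LinearMap.smul_apply, map_smul, hu, map_smul, mode_smul_left,
        LinearMap.smul_apply]
    | heis h k u hu =>
      rw [← h𝒱.Y_h]
      exact h𝒱.isVertexAlgebra.map_mode_mode hten (coaction L) (hh h)
        (fun n w => hu w n) (-(k + 1)) n v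
    | eV α =>
      -- Compatibility with the modes of `h` is already known. It makes `ρ(e_α)` an eigenvector of
      -- `ρ(h)_0` annihilated by the positive modes of `ρ(h)`, and the commutators take the same
      -- form as on `V_L`.
      have hcomm (h : Cartan L) := hten.mode_commutator (u := coaction L (hV h))
        (v := coaction L (eV α)) (c := B.baseChange ℂ h (toCartan α))
        (by rw [← coaction_hV_mode hsymm h𝒱, heis_zero_eV, map_smul])
        (fun n hn => by rw [← coaction_hV_mode hsymm h𝒱, heis_eV_pos h hn, map_zero])
      rw [he]
      induction v using vSpace_induction (B := B) generalizing n with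
      | zero => simp
      | add v w hv hw => rw [map_add, map_add, hv, hw, map_add, map_add]
      | smul c v hv => rw [map_smul, map_smul, hv, map_smul, map_smul]
      | eV γ => exact coaction_eMode_eV hsymm hright h𝒱 α hcomm γ n
      | heis h k v hv =>
        rw [← sub_eq_iff_eq_add.mpr (heis_eMode hsymm ε h α (-(k + 1)) n v), map_sub, map_smul,
          coaction_hV_mode hsymm h𝒱, hv, hv, coaction_hV_mode hsymm h𝒱, hcomm]
        abel

/-- The modes `h(-k-1)` generate `V_L` from the `e_α`, and a homomorphism carries them to modes of
its value at `h`. -/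
theorem coaction_unique (h𝒱 : IsLatticeVertexAlgebra B ε 𝒱)
    {ρ ρ' : VSpace L →ₗ[ℂ] VSpace L ⊗[ℂ] BSpace L} (hρ : IsHom 𝒱 (𝒱.tensor (vertexB L)) ρ)
    (hρ' : IsHom 𝒱 (𝒱.tensor (vertexB L)) ρ') (hh : ∀ h, ρ (hV h) = ρ' (hV h))
    (he : ∀ α, ρ (eV α) = ρ' (eV α)) : ρ = ρ' := by
  refine LinearMap.ext fun v => ?_
  induction v using vSpace_induction (B := B) with
  | zero => simp
  | eV α => exact he α
  | add v w hv hw => rw [map_add, map_add, hv, hw]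
  | smul c v hv => rw [map_smul, map_smul, hv]
  | heis h k v hv => rw [← h𝒱.Y_h, hρ.map_mode, hρ'.map_mode, hh, hv]

end LatticeVA
end

/-! ### The main theorem -/

theorem theorem5p4 {L : Type*} [AddCommGroup L] [Module.Free ℤ L] [Module.Finite ℤ L]
    (B : LinearMap.BilinForm ℤ L) (hsymm : B.IsSymm) (hnondeg : B.Nondegenerate)
    (heven : ∀ α : L, Even (B α α))
    (ε : L → L → ℂˣ)
    (hcocycle : ∀ α β γ : L, ε α β * ε (α + β) γ = ε β γ * ε α (β + γ))
    (hcomm : ∀ α β : L, ε α β * (ε β α)⁻¹ = (-1) ^ (B α β))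
    (hright : ∀ α : L, ε α 0 = 1) (hleft : ∀ α : L, ε 0 α = 1) :
    (∃! 𝒱 : VertexData (LatticeVA.VSpace L), LatticeVA.IsLatticeVertexAlgebra B ε 𝒱) ∧
    (LatticeVA.vertexB L).IsVertexBialgebra ∧ (LatticeVA.vertexB L).IsCommutative ∧
    Coalgebra.IsCocomm ℂ (LatticeVA.BSpace L) ∧
    ∀ 𝒱 : VertexData (LatticeVA.VSpace L), LatticeVA.IsLatticeVertexAlgebra B ε 𝒱 →
      ∃! ρ : LatticeVA.VSpace L →ₗ[ℂ] LatticeVA.VSpace L ⊗[ℂ] LatticeVA.BSpace L,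
        𝒱.IsRightComoduleVertexAlgebra (LatticeVA.vertexB L) ρ ∧
        (∀ h : LatticeVA.Cartan L, ρ (LatticeVA.hV h) =
          LatticeVA.hV h ⊗ₜ[ℂ] 1 + 𝒱.vac ⊗ₜ[ℂ] LatticeVA.hB h) ∧
        (∀ α : L, ρ (LatticeVA.eV α) = LatticeVA.eV α ⊗ₜ[ℂ] LatticeVA.eB α) := by
  refine ⟨?_, LatticeVA.vertexB_isVertexBialgebra,
    VertexData.borcherds_isCommutative (LatticeVA.bDeriv (L := L)), inferInstance,
    fun 𝒱 h𝒱 => ?_⟩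
  · obtain ⟨𝒱, h𝒱⟩ :=
      LatticeVA.exists_isLatticeVertexAlgebra hsymm hcocycle hcomm hright
    exact ⟨𝒱, h𝒱, fun 𝒲 h𝒲 => h𝒲.unique hsymm h𝒱⟩
  · refine ⟨LatticeVA.coaction L, ⟨⟨h𝒱.isVertexAlgebra, LatticeVA.vertexB_isVertexBialgebra,
      LatticeVA.coaction_isHom hsymm hright h𝒱, coactionOfEquiv_coassoc _,
      coactionOfEquiv_counit _⟩, fun h => ?_, LatticeVA.coaction_eV⟩, ?_⟩
    · rw [LatticeVA.coaction_hV, h𝒱.vac_eq]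
    · rintro ρ ⟨h1, h2, h3⟩
      refine LatticeVA.coaction_unique h𝒱 h1.isHom
        (LatticeVA.coaction_isHom hsymm hright h𝒱) (fun h => ?_) fun α => ?_
      · rw [h2, LatticeVA.coaction_hV, h𝒱.vac_eq]
      · rw [h3, LatticeVA.coaction_eV]
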